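/- **Conventions.** Supermanifolds are real, smooth and finite-dimensional, with structure sheaves of $\mathbb Z_2$-graded $\mathbb Z_2$-commutative $\mathbb R$-algebras locally isomorphic to $C^\infty\otimes\Lambda\mathbb R^n$; $\mathrm{Vect}(M)$ is the module of derivations of $C^\infty(M)$, and $[X,Y]=XY-(-1)^{|X||Y|}YX$. For a vector field $X$ and a function $f$ put $X\cdot f=(-1)^{|X||f|}fX$. A Riemannian metric $g$ is a homogeneous (of degree $|g|\in\mathbb Z_2$), $\mathbb Z_2$-symmetric, left $C^\infty(M)$-linear, non-degenerate form on vector fields; its Levi-Civita connection $\nabla^L$ is the torsion-free metric connection, and $\mathrm{grad}_g f$ is defined by $X(f)=(-1)^{|f||g|}g(X,\mathrm{grad}_g f)$. For $P\in\mathrm{Vect}(M)$ with $|g|+|P|=0$ the semi-symmetric metric connection is $\nabla_XY=\nabla^L_XY+X\cdot g(Y,P)-g(X,Y)P$. The curvature of a connection is $R_\nabla(X,Y)Z=\nabla_X\nabla_YZ-(-1)^{|X||Y|}\nabla_Y\nabla_XZ-\nabla_{[X,Y]}Z$. **Proposition 3.5.** Let $(M,g_1)$ and $(N,g_2)$ be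 Riemannian supermanifolds with $|g_1|=|g_2|=|g|$, let $h\in C^\infty(M)$ be even and invertible, and let $M_1=M\times_\mu N$ with $\mu=h^2$ be the super warped product, that is, $M\times N$ with the metric $g_\mu=\pi_1^*g_1+\pi_1^*(h^2)\,\pi_2^*g_2$. Let $\nabla^{L,M}$, $\nabla^{L,N}$ be the Levi-Civita connections of $g_1$, $g_2$, and $R^{L,N}$ the curvature of $\nabla^{L,N}$. Let $P\in\mathrm{Vect}(M)$ be homogeneous with $|P|=|g|$, let $\nabla^\mu$ be the semi-symmetric metric connection of $(M_1,g_\mu)$ determined by $P$ and $\nabla^M$ that of $(M,g_1)$, and put $\pi(X)=g_1(X,P)$ and $H^h_M(X,Y)=X(Y(h))-(\nabla^{L,M}_XY)(h)$. Vector fields on $M$ and on $N$, and functions on $M$, are regarded as vector fields and functions on $M\times N$ in the usual way. Then for all homogeneous $X,Y,Z\in\mathrm{Vect}(M)$ and $U,V,W\in\mathrm{Vect}(N)$: 1. $R_{\nabla^\mu}(X,Y)Z=R_{\nabla^M}(X,Y)Z$. 2. $R_{\nabla^\mu}(V,X)Y=-(-1)^{|V|(|X|+|Y|)}\Big[\frac{H^h_M(X,Y)}{h}+(-1)^{|X||Y|}g_1(Y,\nabla^{L,M}_XP)+g_1(X,Y)\frac{P(h)}{h}+g_1(X,Y)\pi(P)-\pi(X)\pi(Y)\Big]V$.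 3. $R_{\nabla^\mu}(X,Y)V=0$. 4. $R_{\nabla^\mu}(V,W)X=0$. 5. $R_{\nabla^\mu}(X,V)W=-(-1)^{|X|(|V|+|W|+|g|)}g_\mu(V,W)\Big[\frac{\nabla^{L,M}_X(\mathrm{grad}_{g_1}h)}{h}+(-1)^{(|X|+|P|)|g|}\frac{P(h)}{h}X+\nabla^{L,M}_XP+X\cdot g_1(P,P)-\pi(X)P\Big]$; when $|g|=|P|=0$ this reads $$R_{\nabla^\mu}(X,V)W=-(-1)^{|X|(|V|+|W|)}g_\mu(V,W)\Big[\frac{\nabla^{L,M}_X(\mathrm{grad}_{g_1}h)}{h}+\frac{P(h)}{h}X+\nabla^{L,M}_XP+X\cdot g_1(P,P)-\pi(X)P\Big].$$ 6. $$\begin{aligned}R_{\nabla^\mu}(U,V)W&=R^{L,N}(U,V)W+\Big[(-1)^{|g|(|W|+|g|)}\frac{(\mathrm{grad}_{g_1}h)(h)}{h^2}+(-1)^{|P||W|}\frac{P(h)}{h}+(-1)^{|P|(|W|+|g|)}\pi(P)\Big]\\&\quad\cdot\Big[(-1)^{|V||W|}(-1)^{|P||U|}g_\mu(U,W)V-(-1)^{|U|(|V|+|W|)}(-1)^{|P||V|}g_\mu(V,W)U\Big]\\&\quad+(-1)^{|V||W|}g_\mu(U,W)\frac{P(h)}{h}V-(-1)^{|U|(|V|+|W|)}g_\mu(V,W)\frac{P(h)}{h}U;\end{aligned}$$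 when $|g|=|P|=0$ this reads $$R_{\nabla^\mu}(U,V)W=R^{L,N}(U,V)W+\Big[\frac{(\mathrm{grad}_{g_1}h)(h)}{h^2}+2\frac{P(h)}{h}+\pi(P)\Big]\Big[(-1)^{|V||W|}g_\mu(U,W)V-(-1)^{|U|(|V|+|W|)}g_\mu(V,W)U\Big].$$ -/

import Mathlib

open scoped Manifold ContDiff TensorProduct
open TopologicalSpace

universe u

namespace SuperGeometry

/-- The sign `(-1)^k` for `k ∈ ℤ/2`. -/
abbrev sgn (k : ZMod 2) : ℤˣ := (-1 : ℤˣ) ^ k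

/-! ### Supermanifolds -/

/-- A `ℤ/2`-ringed space: a topological space with a sheaf of `ℤ/2`-graded, `ℤ/2`-commutative
associative unital `ℝ`-algebras. `sec U` is the algebra of sections over `U`, and `par U 0`,
`par U 1` are its even and odd parts. -/
structure SuperSpace where
  carrier : Type u
  [top : TopologicalSpace carrier]
  sec : Opens carrier → Type u
  [ring : ∀ U, Ring (sec U)]
  [algebra : ∀ U, Algebra ℝ (sec U)]
  par : ∀ U, ZMod 2 → Submodule ℝ (sec U)
  [graded : ∀ U, GradedAlgebra (par U)]
  supercomm : ∀ (U : Opens carrier) (i j : ZMod 2) (a b : sec U), a ∈ par U i → b ∈ par U j →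
    a * b = (-1 : ℤˣ) ^ (i * j) • (b * a)
  res : ∀ {U V : Opens carrier}, U ≤ V → (sec V →ₐ[ℝ] sec U)
  res_par : ∀ {U V : Opens carrier} (h : U ≤ V) (i : ZMod 2) (a : sec V),
    a ∈ par V i → res h a ∈ par U i
  res_self : ∀ (U : Opens carrier) (a : sec U), res le_rfl a = a
  res_res : ∀ {U V W : Opens carrier} (h : U ≤ V) (h' : V ≤ W) (a : sec W),
    res h (res h' a) = res (h.trans h') a
  existsUnique_glue : ∀ {ι : Type u} (U : ι → Opens carrier) (s : ∀ i, sec (U i)),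
    (∀ i j, res (inf_le_left : U i ⊓ U j ≤ U i) (s i) =
      res (inf_le_right : U i ⊓ U j ≤ U j) (s j)) →
    ∃! t : sec (iSup U), ∀ i, res (le_iSup U i) t = s i

attribute [instance] SuperSpace.top SuperSpace.ring SuperSpace.algebra SuperSpace.graded

/-- Sections over `W ⊆ ℝᵐ` of the structure sheaf of the standard superdomain:
`C^∞(W) ⊗ Λ ℝⁿ`. -/
abbrev ModelSec (m n : ℕ) (W : Opens (EuclideanSpace ℝ (Fin m))) : Type :=
  C^∞⟮𝓘(ℝ, EuclideanSpace ℝ (Fin m)), W; 𝓘(ℝ, ℝ), ℝ⟯ ⊗[ℝ] ExteriorAlgebra ℝ (Fin n → ℝ)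

/-- The even and odd parts of `C^∞(W) ⊗ Λ ℝⁿ`: `C^∞(W) ⊗ Λ^even` and `C^∞(W) ⊗ Λ^odd`. -/
noncomputable def modelPar (m n : ℕ) (W : Opens (EuclideanSpace ℝ (Fin m))) (i : ZMod 2) :
    Submodule ℝ (ModelSec m n W) :=
  (Submodule.baseChange C^∞⟮𝓘(ℝ, EuclideanSpace ℝ (Fin m)), W; 𝓘(ℝ, ℝ), ℝ⟯
    (CliffordAlgebra.evenOdd (0 : QuadraticForm ℝ (Fin n → ℝ)) i)).restrictScalars ℝ

/-- Restriction of smooth functions to a smaller open set. -/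
noncomputable def smoothRes {m : ℕ} {V W : Opens (EuclideanSpace ℝ (Fin m))} (h : V ≤ W) :
    C^∞⟮𝓘(ℝ, EuclideanSpace ℝ (Fin m)), W; 𝓘(ℝ, ℝ), ℝ⟯ →ₐ[ℝ]
      C^∞⟮𝓘(ℝ, EuclideanSpace ℝ (Fin m)), V; 𝓘(ℝ, ℝ), ℝ⟯ :=
  { ContMDiffMap.restrictRingHom 𝓘(ℝ, EuclideanSpace ℝ (Fin m)) 𝓘(ℝ, ℝ) ℝ h with
    commutes' := fun _ => rfl }

/-- Restriction of sections of the standard superdomain. -/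
noncomputable def modelRes {m : ℕ} (n : ℕ) {V W : Opens (EuclideanSpace ℝ (Fin m))} (h : V ≤ W) :
    ModelSec m n W →ₐ[ℝ] ModelSec m n V :=
  Algebra.TensorProduct.map (smoothRes h) (AlgHom.id ℝ _)

/-- The open part of `φ.source` that a chart map `φ` sends to `W`. -/
def chartPre {X : Type u} [TopologicalSpace X] {m : ℕ}
    (φ : OpenPartialHomeomorph X (EuclideanSpace ℝ (Fin m)))
    (W : Opens (EuclideanSpace ℝ (Fin m))) : Opens X :=
  ⟨φ.source ∩ φ ⁻¹' (W : Set _), φ.isOpen_inter_preimage W.2⟩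

/-- A superchart: an isomorphism of `ℤ/2`-ringed spaces between an open part `(φ.source, O|)` of
`M` and the standard superdomain over the open set `φ.target ⊆ ℝᵐ` with `n` odd coordinates. -/
structure SuperChart (M : SuperSpace.{u}) (m n : ℕ) where
  φ : OpenPartialHomeomorph M.carrier (EuclideanSpace ℝ (Fin m))
  iso : ∀ W : Opens (EuclideanSpace ℝ (Fin m)), (W : Set _) ⊆ φ.target →
    (M.sec (chartPre φ W) ≃ₐ[ℝ] ModelSec m n W)
  iso_par : ∀ W hW (i : ZMod 2) (a : M.sec (chartPre φ W)), a ∈ M.par (chartPre φ W) i →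
    iso W hW a ∈ modelPar m n W i
  iso_res : ∀ {V W : Opens (EuclideanSpace ℝ (Fin m))} (h : V ≤ W)
    (h' : chartPre φ V ≤ chartPre φ W) hV hW (a : M.sec (chartPre φ W)),
    iso V hV (M.res h' a) = modelRes n h (iso W hW a)

/-- A supermanifold of dimension `m|n`: a `ℤ/2`-ringed space over a second countable Hausdorff
space that is locally isomorphic to the standard superdomains of dimension `m|n`. (Its stalks are
then automatically local rings.) -/
structure SuperManifold extends SuperSpace.{u} where
  [t2 : T2Space carrier]
  [secondCountable : SecondCountableTopology carrier]
  m : ℕ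
  n : ℕ
  exists_chart : ∀ x : carrier, ∃ c : SuperChart toSuperSpace m n, x ∈ c.φ.source

/-- A morphism of supermanifolds: a continuous map together with a morphism of sheaves of
`ℤ/2`-graded `ℝ`-algebras. (Locality on stalks is automatic for supermanifolds.) -/
@[ext]
structure Hom (S M : SuperSpace.{u}) where
  base : C(S.carrier, M.carrier)
  pull : ∀ U : Opens M.carrier, M.sec U →ₐ[ℝ] S.sec (Opens.comap base U)
  pull_par : ∀ U (i : ZMod 2) (a : M.sec U), a ∈ M.par U i → pull U a ∈ S.par _ i
  pull_res : ∀ {U V : Opens M.carrier} (h : U ≤ V) (a : M.sec V),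
    pull U (M.res h a) = S.res (fun _ hx => h hx : Opens.comap base U ≤ Opens.comap base V) (pull V a)

/-- Composition of morphisms, `f.comp g = f ∘ g`. -/
def Hom.comp {S M N : SuperSpace.{u}} (f : Hom M N) (g : Hom S M) : Hom S N where
  base := f.base.comp g.base
  pull U := (g.pull (Opens.comap f.base U)).comp (f.pull U)
  pull_par U i a ha := g.pull_par _ i _ (f.pull_par U i a ha)
  pull_res h a := by
    exact (congrArg (g.pull _) (f.pull_res h a)).trans (g.pull_res _ (f.pull _ a))

/-- `M₁` with the projections `π₁`, `π₂` is the product of the supermanifolds `M` and `N`. -/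
def IsProduct {M N M₁ : SuperManifold.{u}} (π₁ : Hom M₁.toSuperSpace M.toSuperSpace)
    (π₂ : Hom M₁.toSuperSpace N.toSuperSpace) : Prop :=
  ∀ (S : SuperManifold.{u}) (f : Hom S.toSuperSpace M.toSuperSpace)
    (g : Hom S.toSuperSpace N.toSuperSpace),
    ∃! k : Hom S.toSuperSpace M₁.toSuperSpace, π₁.comp k = f ∧ π₂.comp k = g

namespace SuperSpace

variable (M : SuperSpace.{u})

/-- The superalgebra `C^∞(M)` of global sections. -/
abbrev Fn : Type u := M.sec ⊤

/-- `f ∈ C^∞(M)` is homogeneous of degree `i`. -/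
abbrev FnDeg (i : ZMod 2) : Submodule ℝ M.Fn := M.par ⊤ i

/-- The homogeneous component of degree `i` of a function. -/
noncomputable abbrev fnComp (i : ZMod 2) : M.Fn →ₗ[ℝ] M.Fn := GradedAlgebra.proj (M.par ⊤) i

/-- `X` is a derivation of `C^∞(M)` that is homogeneous of degree `i`. -/
def IsDer (i : ZMod 2) (X : M.Fn →ₗ[ℝ] M.Fn) : Prop :=
  (∀ (j : ZMod 2) (a : M.Fn), a ∈ M.FnDeg j → X a ∈ M.FnDeg (i + j)) ∧
  ∀ (j : ZMod 2) (a b : M.Fn), a ∈ M.FnDeg j →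
    X (a * b) = X a * b + (-1 : ℤˣ) ^ (i * j) • (a * X b)

variable {M}

theorem zmod_two_cases (i : ZMod 2) : i = 0 ∨ i = 1 := by
  revert i
  decide

theorem IsDer.add {i : ZMod 2} {X Y : M.Fn →ₗ[ℝ] M.Fn} (hX : M.IsDer i X) (hY : M.IsDer i Y) :
    M.IsDer i (X + Y) := by
  refine ⟨fun j a ha => add_mem (hX.1 j a ha) (hY.1 j a ha), fun j a b ha => ?_⟩
  simp only [LinearMap.add_apply, hX.2 j a b ha, hY.2 j a b ha, mul_add, add_mul, smul_add]
  abel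

theorem IsDer.zero (i : ZMod 2) : M.IsDer i 0 :=
  ⟨fun j a _ => zero_mem _, fun j a b _ => by simp⟩

theorem units_smul_mem {A : Type*} [AddCommGroup A] [Module ℝ A] {p : Submodule ℝ A} (s : ℤˣ)
    {a : A} (ha : a ∈ p) : s • a ∈ p := by
  rw [Units.smul_def]
  exact zsmul_mem ha _

theorem IsDer.sgn_smul {i : ZMod 2} {X : M.Fn →ₗ[ℝ] M.Fn} (hX : M.IsDer i X) (s : ℤˣ) :
    M.IsDer i (s • X) := by
  rcases Int.units_eq_one_or s with rfl | rfl
  · simpa using hX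
  · refine ⟨fun j a ha => ?_, fun j a b ha => ?_⟩
    · simpa [Units.smul_def] using hX.1 j a ha
    · simp [Units.smul_def, hX.2 j a b ha]
      abel

theorem IsDer.fn_smul {i k : ZMod 2} {f : M.Fn} {X : M.Fn →ₗ[ℝ] M.Fn} (hf : f ∈ M.FnDeg k)
    (hX : M.IsDer i X) : M.IsDer (k + i) (f • X) := by
  refine ⟨fun j a ha => ?_, fun j a b ha => ?_⟩
  · have := SetLike.GradedMul.mul_mem hf (hX.1 j a ha)
    rwa [← add_assoc] at this
  · have h1 := M.supercomm ⊤ k j f a hf ha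
    simp only [LinearMap.smul_apply, smul_eq_mul, hX.2 j a b ha, mul_add, mul_smul_comm]
    rw [← mul_assoc f a, h1, add_mul (R := ZMod 2), uzpow_add, mul_comm ((-1 : ℤˣ) ^ (k * j)),
      smul_mul_assoc, mul_smul]
    simp only [mul_assoc]

theorem fn_eq_sum (f : M.Fn) : M.fnComp 0 f + M.fnComp 1 f = f := by
  classical
  conv_rhs => rw [← DirectSum.sum_support_decompose (M.par ⊤) f]
  rw [Finset.sum_subset (Finset.subset_univ _) (by intro i _ hi; simpa using hi)]
  exact (Fin.sum_univ_two
    (fun i : Fin 2 => ((DirectSum.decompose (M.par ⊤) f (i : ZMod 2) : M.FnDeg i) : M.Fn))).symm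

theorem fnComp_mem (i : ZMod 2) (f : M.Fn) : M.fnComp i f ∈ M.FnDeg i :=
  (DirectSum.decompose (M.par ⊤) f i).2

variable (M)

/-- The `C^∞(M)`-submodule `Vect(M) = Der(C^∞(M))` of vector fields: sums of an even and an odd
derivation. The module structure is `(f X)(a) = f * X(a)`. -/
def vectSubmodule : Submodule M.Fn (M.Fn →ₗ[ℝ] M.Fn) where
  carrier := {X | ∃ X₀ X₁, M.IsDer 0 X₀ ∧ M.IsDer 1 X₁ ∧ X = X₀ + X₁}
  zero_mem' := ⟨0, 0, IsDer.zero 0, IsDer.zero 1, by simp⟩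
  add_mem' := by
    rintro _ _ ⟨X₀, X₁, h₀, h₁, rfl⟩ ⟨Y₀, Y₁, k₀, k₁, rfl⟩
    exact ⟨X₀ + Y₀, X₁ + Y₁, h₀.add k₀, h₁.add k₁, by abel⟩
  smul_mem' := by
    rintro f _ ⟨X₀, X₁, h₀, h₁, rfl⟩
    refine ⟨M.fnComp 0 f • X₀ + M.fnComp 1 f • X₁, M.fnComp 0 f • X₁ + M.fnComp 1 f • X₀,
      IsDer.add (i := 0) (h₀.fn_smul (fnComp_mem 0 f)) (h₁.fn_smul (fnComp_mem 1 f)),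
      IsDer.add (i := 1) (h₁.fn_smul (fnComp_mem 0 f)) (h₀.fn_smul (fnComp_mem 1 f)), ?_⟩
    conv_lhs => rw [← fn_eq_sum f]
    simp only [add_smul, smul_add]
    abel

/-- The `C^∞(M)`-module of vector fields on `M`. -/
abbrev Vect : Type u := M.vectSubmodule

variable {M}

/-- The derivative `X(f)`. -/
def Vect.app (X : M.Vect) (f : M.Fn) : M.Fn := X.1 f

/-- `X` is homogeneous of degree `i`. -/
def Vect.HasDeg (X : M.Vect) (i : ZMod 2) : Prop := M.IsDer i X.1

theorem IsDer.mem {i : ZMod 2} {X : M.Fn →ₗ[ℝ] M.Fn} (hX : M.IsDer i X) : X ∈ M.vectSubmodule := by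
  rcases zmod_two_cases i with rfl | rfl
  · exact ⟨X, 0, hX, IsDer.zero 1, by simp⟩
  · exact ⟨0, X, IsDer.zero 0, hX, by simp⟩

theorem fnComp_of_mem {i : ZMod 2} {f : M.Fn} (hf : f ∈ M.FnDeg i) (j : ZMod 2) :
    M.fnComp j f = if i = j then f else 0 := by
  split_ifs with h
  · subst h; exact DirectSum.decompose_of_mem_same _ hf
  · exact DirectSum.decompose_of_mem_ne _ hf h

/-- The homogeneous component of degree `i` of a linear endomorphism of `C^∞(M)`. -/
noncomputable def endComp (i : ZMod 2) (X : M.Fn →ₗ[ℝ] M.Fn) : M.Fn →ₗ[ℝ] M.Fn :=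
  ∑ j : ZMod 2, M.fnComp (i + j) ∘ₗ X ∘ₗ M.fnComp j

theorem endComp_of_isDer {i : ZMod 2} {X : M.Fn →ₗ[ℝ] M.Fn} (hX : M.IsDer i X) (k : ZMod 2) :
    endComp k X = if i = k then X else 0 := by
  ext f
  have key : ∀ j, M.fnComp (k + j) (X (M.fnComp j f)) =
      if i = k then X (M.fnComp j f) else 0 := fun j => by
    rw [fnComp_of_mem (hX.1 j _ (fnComp_mem j f))]
    simp
  have e : endComp k X f = ∑ j : ZMod 2, M.fnComp (k + j) (X (M.fnComp j f)) := by
    simp [endComp]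
  rw [e]
  simp only [key]
  split_ifs
  · have : ∑ j : ZMod 2, X (M.fnComp j f) = X (M.fnComp 0 f) + X (M.fnComp 1 f) :=
      Fin.sum_univ_two _
    rw [this, ← map_add, fn_eq_sum]
  · simp

theorem endComp_add (i : ZMod 2) (X Y : M.Fn →ₗ[ℝ] M.Fn) :
    endComp i (X + Y) = endComp i X + endComp i Y := by
  simp [endComp, LinearMap.add_comp, LinearMap.comp_add, Finset.sum_add_distrib]

theorem isDer_endComp (X : M.Vect) (i : ZMod 2) : M.IsDer i (endComp i X.1) := by
  obtain ⟨X₀, X₁, h₀, h₁, h⟩ := X.2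
  rw [h, endComp_add, endComp_of_isDer h₀, endComp_of_isDer h₁]
  rcases zmod_two_cases i with rfl | rfl
  · simpa using h₀
  · simpa using h₁

/-- The homogeneous component of degree `i` of a vector field. -/
noncomputable def Vect.comp (i : ZMod 2) (X : M.Vect) : M.Vect :=
  ⟨endComp i X.1, (isDer_endComp X i).mem⟩

theorem isDer_bracket {i j : ZMod 2} {X Y : M.Fn →ₗ[ℝ] M.Fn} (hX : M.IsDer i X)
    (hY : M.IsDer j Y) :
    M.IsDer (i + j) (X ∘ₗ Y - (-1 : ℤˣ) ^ (i * j) • (Y ∘ₗ X)) := by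
  have hs : ∀ (s : ℤˣ) (f : M.Fn →ₗ[ℝ] M.Fn) a, (s • f) a = s • f a := fun _ _ _ => rfl
  have hm : ∀ (s : ℤˣ) (f : M.Fn →ₗ[ℝ] M.Fn) a, f (s • a) = s • f a := fun s f a => by
    rw [Units.smul_def, Units.smul_def, map_zsmul]
  refine ⟨fun k a ha => ?_, fun k a b ha => ?_⟩
  · simp only [LinearMap.sub_apply, LinearMap.comp_apply, hs]
    refine sub_mem ?_ (units_smul_mem _ ?_)
    · have := hX.1 _ _ (hY.1 k a ha)
      rwa [← add_assoc] at this
    · have := hY.1 _ _ (hX.1 k a ha)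
      rwa [← add_assoc, add_comm j i] at this
  · simp only [LinearMap.sub_apply, LinearMap.comp_apply, hs, hX.2 k a b ha, hY.2 k a b ha,
      map_add, hm, hX.2 _ _ b (hY.1 k a ha), hY.2 _ _ b (hX.1 k a ha), hX.2 k a _ ha,
      hY.2 k a _ ha]
    clear hX hY ha
    rcases zmod_two_cases i with rfl | rfl <;> rcases zmod_two_cases j with rfl | rfl <;>
      rcases zmod_two_cases k with rfl | rfl <;>
      simp [Units.smul_def, sub_mul, mul_sub, add_mul, mul_add, show (1 : ZMod 2) + 1 = 0 from rfl] <;> abel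

/-- The graded commutator of vector fields: the biadditive extension of
`[X, Y] = X ∘ Y - (-1)^{|X||Y|} Y ∘ X`. -/
noncomputable def Vect.bracket (X Y : M.Vect) : M.Vect :=
  ∑ i : ZMod 2, ∑ j : ZMod 2,
    ⟨(X.comp i).1 ∘ₗ (Y.comp j).1 - (-1 : ℤˣ) ^ (i * j) • ((Y.comp j).1 ∘ₗ (X.comp i).1),
      (isDer_bracket (isDer_endComp X i) (isDer_endComp Y j)).mem⟩

/-- The right multiplication of a vector field by a function: the biadditive extension of
`X · f = (-1)^{|X||f|} f X`. -/
noncomputable def Vect.rmul (X : M.Vect) (f : M.Fn) : M.Vect :=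
  ∑ i : ZMod 2, ∑ j : ZMod 2, (-1 : ℤˣ) ^ (i * j) • (M.fnComp j f • X.comp i)

/-! ### Metrics and connections -/

variable (M)

/-- A `ℤ/2`-homogeneous (of degree `d`), `ℤ/2`-symmetric, left `C^∞(M)`-linear form
`⟨-,-⟩ : Vect(M) × Vect(M) → C^∞(M)`. -/
structure SymmForm (d : ZMod 2) where
  form : M.Vect →+ M.Vect →+ M.Fn
  deg : ∀ (i j : ZMod 2) (X Y : M.Vect), X.HasDeg i → Y.HasDeg j → form X Y ∈ M.FnDeg (i + j + d)
  symm : ∀ (i j : ZMod 2) (X Y : M.Vect), X.HasDeg i → Y.HasDeg j →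
    form X Y = (-1 : ℤˣ) ^ (i * j) • form Y X
  smul_left : ∀ (f : M.Fn) (X Y : M.Vect), form (f • X) Y = f * form X Y

/-- A Riemannian metric of degree `d`: a form as above that is non-degenerate, that is, it
identifies vector fields with one-forms (the `C^∞(M)`-linear maps `Vect(M) → C^∞(M)`). -/
structure Metric (d : ZMod 2) extends SymmForm M d where
  nondeg_inj : ∀ X : M.Vect, (∀ Y, form X Y = 0) → X = 0
  nondeg_surj : ∀ α : M.Vect →ₗ[M.Fn] M.Fn, ∃ X : M.Vect, ∀ Y, α Y = form Y X

/-- An affine connection. -/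
structure Connection where
  cov : M.Vect →+ M.Vect →+ M.Vect
  deg : ∀ (i j : ZMod 2) (X Y : M.Vect), X.HasDeg i → Y.HasDeg j → (cov X Y).HasDeg (i + j)
  smul_left : ∀ (f : M.Fn) (X Y : M.Vect), cov (f • X) Y = f • cov X Y
  leibniz : ∀ (i k : ZMod 2) (X Y : M.Vect) (f : M.Fn), X.HasDeg i → f ∈ M.FnDeg k →
    cov X (f • Y) = X.app f • Y + (-1 : ℤˣ) ^ (i * k) • (f • cov X Y)

variable {M}

/-- `L` is a Levi-Civita connection of `g`: it is torsion-free and compatible with `g`. -/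
structure IsLeviCivita {d : ZMod 2} (g : SymmForm M d) (L : Connection M) : Prop where
  torsion_free : ∀ (i j : ZMod 2) (X Y : M.Vect), X.HasDeg i → Y.HasDeg j →
    L.cov X Y - (-1 : ℤˣ) ^ (i * j) • L.cov Y X - X.bracket Y = 0
  metric : ∀ (i j : ZMod 2) (X Y Z : M.Vect), X.HasDeg i → Y.HasDeg j →
    X.app (g.form Y Z) = g.form (L.cov X Y) Z + (-1 : ℤˣ) ^ (i * j) • g.form Y (L.cov X Z)

/-- The semi-symmetric connection determined by `∇^L` and `P`:
`∇_X Y = ∇^L_X Y + X · g(Y, P) - g(X, Y) P`. -/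
noncomputable def semiSymm {d : ZMod 2} (g : SymmForm M d) (L : Connection M) (P X Y : M.Vect) :
    M.Vect :=
  L.cov X Y + X.rmul (g.form Y P) - g.form X Y • P

/-- The curvature `R(X, Y) Z = ∇_X ∇_Y Z - (-1)^{|X||Y|} ∇_Y ∇_X Z - ∇_{[X, Y]} Z` (extended
additively to inhomogeneous `X` and `Y`). -/
noncomputable def curvature (D : M.Vect → M.Vect → M.Vect) (X Y Z : M.Vect) : M.Vect :=
  D X (D Y Z) - (∑ i : ZMod 2, ∑ j : ZMod 2, (-1 : ℤˣ) ^ (i * j) • D (Y.comp j) (D (X.comp i) Z))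
    - D (X.bracket Y) Z

/-- The curvature of the semi-symmetric connection determined by `∇^L` and `P`. -/
noncomputable def semiSymmCurvature {d : ZMod 2} (g : SymmForm M d) (L : Connection M)
    (P X Y Z : M.Vect) : M.Vect :=
  curvature (semiSymm g L P) X Y Z

/-- The curvature of a connection. -/
noncomputable def Connection.curv (L : Connection M) (X Y Z : M.Vect) : M.Vect :=
  curvature (fun A B => L.cov A B) X Y Z

/-- `G` is the gradient of `f`: `X(f) = (-1)^{|f||g|} ⟨X, G⟩` for all `X` (where `f` is split
into its homogeneous components). -/
def IsGradient {d : ZMod 2} (g : SymmForm M d) (f : M.Fn) (G : M.Vect) : Prop :=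
  ∀ X : M.Vect, ∑ k : ZMod 2, (-1 : ℤˣ) ^ (k * d) • X.app (M.fnComp k f) = g.form X G

theorem exists_gradient {d : ZMod 2} (g : Metric M d) (f : M.Fn) :
    ∃ G, IsGradient g.toSymmForm f G := by
  obtain ⟨G, hG⟩ := g.nondeg_surj
    { toFun := fun X => ∑ k : ZMod 2, (-1 : ℤˣ) ^ (k * d) • X.app (M.fnComp k f)
      map_add' := fun X Y => by
        simp [Vect.app, smul_add, Finset.sum_add_distrib]
      map_smul' := fun a X => by
        simp [Vect.app, Finset.mul_sum, mul_smul_comm] }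
  exact ⟨G, fun X => hG X⟩

/-- The gradient of a function. -/
noncomputable def grad {d : ZMod 2} (g : Metric M d) (f : M.Fn) : M.Vect :=
  (exists_gradient g f).choose

/-- The Hessian `H^h(X, Y) = X(Y(h)) - (∇^L_X Y)(h)`. -/
def hessian (L : Connection M) (h : M.Fn) (X Y : M.Vect) : M.Fn :=
  X.app (Y.app h) - (L.cov X Y).app h

end SuperSpace

/-! ### Products and warped products -/

open SuperSpace

section

variable {S M N : SuperSpace.{u}}

/-- The pullback `φ^* : C^∞(M) → C^∞(S)`. -/
def Hom.star (φ : Hom S M) : M.Fn →ₐ[ℝ] S.Fn := φ.pull ⊤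

/-- `A ∈ Vect(S)` is `φ`-related to `X ∈ Vect(M)`. -/
def Related (φ : Hom S M) (A : S.Vect) (X : M.Vect) : Prop :=
  ∀ f : M.Fn, A.app (φ.star f) = φ.star (X.app f)

/-- `G` is the pullback `φ^* g`: if `dφ(A) = ∑ₖ aₖ φ^*Xₖ` and `dφ(B) = ∑ₗ bₗ φ^*Yₗ` as vector
fields along `φ`, then `G(A, B) = ∑ₖₗ (-1)^{|Xₖ||bₗ|} aₖ bₗ φ^*(g(Xₖ, Yₗ))`. -/
def IsPullback {d : ZMod 2} (φ : Hom S M) (g : SymmForm M d) (G : SymmForm S d) : Prop :=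
  ∀ (A B : S.Vect) (r s : ℕ) (a : Fin r → S.Fn) (X : Fin r → M.Vect) (b : Fin s → S.Fn)
    (Y : Fin s → M.Vect) (i : Fin r → ZMod 2) (j : Fin s → ZMod 2),
    (∀ k, (X k).HasDeg (i k)) → (∀ l, b l ∈ S.FnDeg (j l)) →
    (∀ f, A.app (φ.star f) = ∑ k, a k * φ.star ((X k).app f)) →
    (∀ f, B.app (φ.star f) = ∑ l, b l * φ.star ((Y l).app f)) →
    G.form A B = ∑ k, ∑ l, (-1 : ℤˣ) ^ (i k * j l) • (a k * b l * φ.star (g.form (X k) (Y l)))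

/-- `G` is the form `π₁^* g₁ + (π₁^* μ) π₂^* g₂` of the warped product. -/
def IsWarped {d : ZMod 2} (π₁ : Hom S M) (π₂ : Hom S N) (g₁ : SymmForm M d) (g₂ : SymmForm N d)
    (μ : M.Fn) (G : SymmForm S d) : Prop :=
  ∃ G₁ G₂ : SymmForm S d, IsPullback π₁ g₁ G₁ ∧ IsPullback π₂ g₂ G₂ ∧
    ∀ A B, G.form A B = G₁.form A B + π₁.star μ * G₂.form A B

/-- The vector field on the product that is induced by `X ∈ Vect(M)`: the one that is related to
`X` by `π₁` and to `0` by `π₂`. -/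
noncomputable def lift₁ (π₁ : Hom S M) (π₂ : Hom S N) (X : M.Vect) : S.Vect :=
  Classical.epsilon fun A => Related π₁ A X ∧ Related π₂ A 0

/-- The vector field on the product that is induced by `U ∈ Vect(N)`: the one that is related to
`0` by `π₁` and to `U` by `π₂`. -/
noncomputable def lift₂ (π₁ : Hom S M) (π₂ : Hom S N) (U : N.Vect) : S.Vect :=
  Classical.epsilon fun A => Related π₁ A 0 ∧ Related π₂ A U

end

end SuperGeometry

open SuperGeometry SuperGeometry.SuperSpace

/-! Put β(X) = X(h)/h + g₁(X,P) and Q = grad(h)/h + P (`logForm`, `logField`). On lifts, the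
semi-symmetric connection of the warped product is given by four formulas: ∇_X Y is the lift of
∇^M_X Y; ∇_X U = (X(h)/h) U; ∇_U X = ±β(X) U; ∇_U V = ∇^N_U V − g_μ(U,V) Q. Lifts from one factor
kill the functions of the other factor, and lifts from different factors commute. Hence all six
curvatures follow from these formulas and the Leibniz rule, and only X(β(Y)), ∇_X Q and β(Q) remain
to be expanded on the base (`app_logForm`, `semiSymm_logField`, `form_logField`).

The four formulas rest on those for the Levi-Civita connection (`cov_lift`), which are proved by
checking candidates. The difference of two torsion-free metric connections, lowered by the form, is
graded symmetric in its first two indices and graded skew in its last two, hence zero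
(`IsLeviCivita.cov_eq`). This needs the warped form to be nondegenerate against lifts, which is not
assumed but proved (`IsWarped.eq_zero`): a field C orthogonal to all lifts kills every π₁^*f and
π₂^*f, as one sees by pairing C with the lift of grad f. The pullback of a metric, however, is
prescribed only on fields with a finite expansion Σ aₗ Xₗ along the projection, so local coordinate
frames for derivations along a morphism are required (`exists_local_frame`). Such a derivation minus
its coordinate part kills the coordinates. By iterating Hadamard's lemma, the values at a point of
the remainder on functions of the even coordinates lie in every power of the augmentation ideal of
an exterior algebra; that ideal is nilpotent, so the remainder vanishes.

Finally, the product is given only by its universal property and lifts only by a choice, so lifts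
must be shown to exist and to be unique (`IsProduct.exists_isDer`, `IsProduct.isDer_eq_zero`). An
odd derivation D along φ yields a morphism φ^* + τD from S × ℝ^{0|1}, an even one a morphism φ^* +
Dτ₁τ₂ from S × ℝ^{0|2}; the universal property is tested on these sources. Therefore M × ℝ^{0|1} has
to be shown to be a supermanifold (`SuperManifold.tau`), and derivations of global functions have to
be extended to local sections by means of cutoff functions (`SuperManifold.exists_cutoff`). -/

namespace SuperGeometry

/-! ### Signs and the parity involution of a graded algebra -/

section Graded

variable {A : Type*} [Ring A]

theorem sgn_mul_self (k : ZMod 2) : sgn k * sgn k = 1 := by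
  rcases Int.units_eq_one_or (sgn k) with h | h <;> simp [h]

theorem sgn_zero : sgn 0 = 1 := uzpow_zero _

theorem sgn_one : sgn 1 = -1 := uzpow_one _

theorem sgn_add (i j : ZMod 2) : sgn (i + j) = sgn i * sgn j := by
  simp [sgn, uzpow_add]

theorem map_units_smul {B C : Type*} [AddCommGroup B] [AddCommGroup C] {F : Type*} [FunLike F B C]
    [AddMonoidHomClass F B C] (f : F) (s : ℤˣ) (b : B) : f (s • b) = s • f b := by
  rw [Units.smul_def, Units.smul_def, map_zsmul]

theorem units_mul_smul_comm (s : ℤˣ) (a b : A) : a * s • b = s • (a * b) := by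
  rw [Units.smul_def, Units.smul_def, mul_smul_comm]

theorem units_smul_mul_assoc (s : ℤˣ) (a b : A) : (s • a) * b = s • (a * b) := by
  rw [Units.smul_def, Units.smul_def, smul_mul_assoc]

variable [Algebra ℝ A] (𝒜 : ZMod 2 → Submodule ℝ A) [GradedAlgebra 𝒜]

theorem proj_zero_add_proj_one (f : A) :
    GradedAlgebra.proj 𝒜 0 f + GradedAlgebra.proj 𝒜 1 f = f := by
  classical
  conv_rhs => rw [← DirectSum.sum_support_decompose 𝒜 f]
  rw [Finset.sum_subset (Finset.subset_univ _) (by intro i _ hi; simpa using hi)]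
  exact (Fin.sum_univ_two
    (fun i : Fin 2 => ((DirectSum.decompose 𝒜 f (i : ZMod 2) : 𝒜 i) : A))).symm

theorem proj_mem (i : ZMod 2) (f : A) : GradedAlgebra.proj 𝒜 i f ∈ 𝒜 i :=
  (DirectSum.decompose 𝒜 f i).2

theorem proj_of_mem {i : ZMod 2} {f : A} (hf : f ∈ 𝒜 i) (j : ZMod 2) :
    GradedAlgebra.proj 𝒜 j f = if i = j then f else 0 := by
  split_ifs with h
  · subst h; exact DirectSum.decompose_of_mem_same _ hf
  · exact DirectSum.decompose_of_mem_ne _ hf h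

/-- Induction on the homogeneous components of a `ℤ/2`-graded algebra. -/
theorem homogeneous_induction {p : A → Prop} (hom : ∀ i, ∀ a ∈ 𝒜 i, p a)
    (add : ∀ a b, p a → p b → p (a + b)) (a : A) : p a := by
  rw [← proj_zero_add_proj_one 𝒜 a]
  exact add _ _ (hom _ _ (proj_mem _ _ _)) (hom _ _ (proj_mem _ _ _))

/-- The parity involution of a `ℤ/2`-graded algebra, as a linear map. -/
noncomputable def parityLin : A →ₗ[ℝ] A :=
  GradedAlgebra.proj 𝒜 0 - GradedAlgebra.proj 𝒜 1

variable {𝒜} in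
theorem parityLin_of_mem {i : ZMod 2} {a : A} (ha : a ∈ 𝒜 i) :
    parityLin 𝒜 a = sgn i • a := by
  rcases zmod_two_cases i with rfl | rfl <;>
    simp [parityLin, -GradedAlgebra.proj_apply, proj_of_mem 𝒜 ha, Units.smul_def]

theorem parityLin_mul (a b : A) : parityLin 𝒜 (a * b) = parityLin 𝒜 a * parityLin 𝒜 b := by
  induction a using homogeneous_induction 𝒜 with
  | add a a' ha ha' => simp only [add_mul, map_add, ha, ha']
  | hom i a ha =>
    induction b using homogeneous_induction 𝒜 with
    | add b b' hb hb' => simp only [mul_add, map_add, hb, hb']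
    | hom j b hb =>
      rw [parityLin_of_mem (SetLike.mul_mem_graded ha hb), parityLin_of_mem ha,
        parityLin_of_mem hb, sgn_add, units_mul_smul_comm, units_smul_mul_assoc, smul_smul,
        mul_comm]

/-- The parity involution of a `ℤ/2`-graded algebra. -/
noncomputable def parity : A →ₐ[ℝ] A :=
  AlgHom.ofLinearMap (parityLin 𝒜)
    (by rw [parityLin_of_mem (SetLike.one_mem_graded 𝒜)]; simp) (parityLin_mul 𝒜)

variable {𝒜} in
theorem parity_of_mem {i : ZMod 2} {a : A} (ha : a ∈ 𝒜 i) : parity 𝒜 a = sgn i • a :=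
  parityLin_of_mem ha

end Graded

/-! ### Adjoining one odd variable to a superalgebra -/

/-- The algebra `A[τ]` obtained by adjoining an element `τ` with `τ² = 0` and `τ a = σ(a) τ`; the
pair `(a, b)` stands for `a + b τ`. -/
def TauExt {A : Type*} [Ring A] [Algebra ℝ A] (_σ : A →ₐ[ℝ] A) : Type _ := A × A

namespace TauExt

section Ring

variable {A : Type*} [Ring A] [Algebra ℝ A] {σ : A →ₐ[ℝ] A}

instance : AddCommGroup (TauExt σ) := inferInstanceAs (AddCommGroup (A × A))

noncomputable instance : Module ℝ (TauExt σ) := inferInstanceAs (Module ℝ (A × A))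

/-- The element `a + b τ`. -/
def mk (σ : A →ₐ[ℝ] A) (a b : A) : TauExt σ := (a, b)

/-- The coefficient of `1`. -/
def fst (x : TauExt σ) : A := Prod.fst x

/-- The coefficient of `τ`. -/
def snd (x : TauExt σ) : A := Prod.snd x

@[ext] theorem ext {x y : TauExt σ} (h₁ : x.fst = y.fst) (h₂ : x.snd = y.snd) : x = y :=
  Prod.ext h₁ h₂

@[simp] theorem fst_mk (a b : A) : (mk σ a b).fst = a := rfl
@[simp] theorem snd_mk (a b : A) : (mk σ a b).snd = b := rfl
@[simp] theorem fst_add (x y : TauExt σ) : (x + y).fst = x.fst + y.fst := rfl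
@[simp] theorem snd_add (x y : TauExt σ) : (x + y).snd = x.snd + y.snd := rfl
@[simp] theorem fst_zero : (0 : TauExt σ).fst = 0 := rfl
@[simp] theorem snd_zero : (0 : TauExt σ).snd = 0 := rfl
@[simp] theorem fst_neg (x : TauExt σ) : (-x).fst = -x.fst := rfl
@[simp] theorem snd_neg (x : TauExt σ) : (-x).snd = -x.snd := rfl
@[simp] theorem fst_smul (r : ℝ) (x : TauExt σ) : (r • x).fst = r • x.fst := rfl
@[simp] theorem snd_smul (r : ℝ) (x : TauExt σ) : (r • x).snd = r • x.snd := rfl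

instance : Mul (TauExt σ) := ⟨fun x y => mk σ (x.fst * y.fst) (x.fst * y.snd + x.snd * σ y.fst)⟩
instance : One (TauExt σ) := ⟨mk σ 1 0⟩

@[simp] theorem fst_mul (x y : TauExt σ) : (x * y).fst = x.fst * y.fst := rfl
@[simp] theorem snd_mul (x y : TauExt σ) : (x * y).snd = x.fst * y.snd + x.snd * σ y.fst := rfl
@[simp] theorem fst_one : (1 : TauExt σ).fst = 1 := rfl
@[simp] theorem snd_one : (1 : TauExt σ).snd = 0 := rfl

noncomputable instance : Ring (TauExt σ) :=
  { (inferInstance : AddCommGroup (TauExt σ)) with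
    left_distrib := fun x y z => by ext <;> simp [mul_add]; abel
    right_distrib := fun x y z => by ext <;> simp [add_mul]; abel
    zero_mul := fun x => by ext <;> simp
    mul_zero := fun x => by ext <;> simp
    mul_assoc := fun x y z => by ext <;> simp [mul_assoc, mul_add, add_mul, add_assoc]
    one_mul := fun x => by ext <;> simp
    mul_one := fun x => by ext <;> simp }

noncomputable instance : Algebra ℝ (TauExt σ) :=
  Algebra.ofModule (fun r x y => by ext <;> simp)
    (fun r x y => by ext <;> simp)

theorem algebraMap_eq (r : ℝ) : algebraMap ℝ (TauExt σ) r = mk σ (algebraMap ℝ A r) 0 := by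
  rw [Algebra.algebraMap_eq_smul_one]
  ext
  · simp [Algebra.algebraMap_eq_smul_one]
  · simp

variable {B : Type*} [Ring B] [Algebra ℝ B] {ρ : B →ₐ[ℝ] B}

/-- Functoriality of `A[τ]` in `(A, σ)`. -/
noncomputable def map (f : A →ₐ[ℝ] B) (h : ∀ a, f (σ a) = ρ (f a)) : TauExt σ →ₐ[ℝ] TauExt ρ where
  toFun x := mk ρ (f x.fst) (f x.snd)
  map_one' := by ext <;> simp
  map_mul' x y := by ext <;> simp [h]
  map_zero' := by ext <;> simp
  map_add' x y := by ext <;> simp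
  commutes' r := by simp only [algebraMap_eq]; ext <;> simp

/-- Functoriality of `A[τ]` for isomorphisms. -/
noncomputable def mapEquiv (f : A ≃ₐ[ℝ] B) (h : ∀ a, f (σ a) = ρ (f a)) :
    TauExt σ ≃ₐ[ℝ] TauExt ρ :=
  AlgEquiv.ofAlgHom (map f.toAlgHom h)
    (map f.symm.toAlgHom fun b => by
      apply f.injective
      have := h (f.symm b)
      simp_all)
    (AlgHom.ext fun x => TauExt.ext (f.apply_symm_apply x.fst) (f.apply_symm_apply x.snd))
    (AlgHom.ext fun x => TauExt.ext (f.symm_apply_apply x.fst) (f.symm_apply_apply x.snd))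

end Ring

section Graded

variable {A : Type*} [Ring A] [Algebra ℝ A] (𝒜 : ZMod 2 → Submodule ℝ A) [GradedAlgebra 𝒜]

/-- The grading of `A[τ]` for which `τ` is odd. -/
def grading (i : ZMod 2) : Submodule ℝ (TauExt (parity 𝒜)) where
  carrier := {x | x.fst ∈ 𝒜 i ∧ x.snd ∈ 𝒜 (i + 1)}
  zero_mem' := ⟨zero_mem _, zero_mem _⟩
  add_mem' hx hy := ⟨add_mem hx.1 hy.1, add_mem hx.2 hy.2⟩
  smul_mem' r _ hx := ⟨Submodule.smul_mem _ r hx.1, Submodule.smul_mem _ r hx.2⟩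

variable {𝒜}

theorem grading_mul_mem {i j : ZMod 2} {x y : TauExt (parity 𝒜)} (hx : x ∈ grading 𝒜 i)
    (hy : y ∈ grading 𝒜 j) : x * y ∈ grading 𝒜 (i + j) := by
  refine ⟨SetLike.mul_mem_graded hx.1 hy.1, add_mem ?_ ?_⟩
  · rw [add_assoc]; exact SetLike.mul_mem_graded hx.1 hy.2
  · rw [parity_of_mem hy.1, units_mul_smul_comm]
    refine units_smul_mem _ ?_
    rw [add_right_comm]; exact SetLike.mul_mem_graded hx.2 hy.1

noncomputable instance : GradedAlgebra (grading 𝒜) where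
  one_mem := ⟨SetLike.one_mem_graded 𝒜, zero_mem _⟩
  mul_mem _ _ _ _ hx hy := grading_mul_mem hx hy
  toDecomposition := by
    refine DirectSum.Decomposition.ofAddHom (grading 𝒜)
      { toFun := fun x => ∑ i : ZMod 2, DirectSum.of (fun i => grading 𝒜 i) i
          ⟨mk _ (GradedAlgebra.proj 𝒜 i x.fst) (GradedAlgebra.proj 𝒜 (i + 1) x.snd),
            proj_mem _ _ _, proj_mem _ _ _⟩
        map_zero' := ?_
        map_add' := ?_ } ?_ ?_
    · refine Finset.sum_eq_zero fun i _ => ?_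
      refine (congrArg _ (Subtype.ext ?_)).trans (map_zero _)
      ext <;> simp
    · intro x y
      rw [← Finset.sum_add_distrib]
      refine Finset.sum_congr rfl fun i _ => ?_
      rw [← map_add]
      congr 1
      apply Subtype.ext
      ext <;> simp
    · ext x
      · have : ∀ f : ZMod 2 → TauExt (parity 𝒜), ∑ i, f i = f 0 + f 1 := fun f =>
          Fin.sum_univ_two f
        simp only [AddMonoidHom.comp_apply, AddMonoidHom.coe_mk, ZeroHom.coe_mk, map_sum,
          DirectSum.coeAddMonoidHom_of, AddMonoidHom.id_apply, this, fst_add, fst_mk]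
        exact proj_zero_add_proj_one 𝒜 _
      · have : ∀ f : ZMod 2 → TauExt (parity 𝒜), ∑ i, f i = f 0 + f 1 := fun f =>
          Fin.sum_univ_two f
        simp only [AddMonoidHom.comp_apply, AddMonoidHom.coe_mk, ZeroHom.coe_mk, map_sum,
          DirectSum.coeAddMonoidHom_of, AddMonoidHom.id_apply, this, snd_add, snd_mk]
        rw [add_comm, zero_add, show (1 : ZMod 2) + 1 = 0 from rfl]
        exact proj_zero_add_proj_one 𝒜 _
    · ext j x : 2
      simp only [AddMonoidHom.comp_apply, AddMonoidHom.coe_mk, ZeroHom.coe_mk,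
        DirectSum.coeAddMonoidHom_of, AddMonoidHom.id_apply]
      rw [Finset.sum_eq_single j]
      · congr 1
        apply Subtype.ext
        ext
        · simp [-GradedAlgebra.proj_apply, proj_of_mem 𝒜 x.2.1]
        · simp [-GradedAlgebra.proj_apply, proj_of_mem 𝒜 x.2.2]
      · intro i _ hi
        refine (congrArg _ (Subtype.ext ?_)).trans (map_zero _)
        ext
        · simp [-GradedAlgebra.proj_apply, proj_of_mem 𝒜 x.2.1, hi.symm]
        · simp [-GradedAlgebra.proj_apply, proj_of_mem 𝒜 x.2.2, hi.symm]
      · simp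

end Graded

end TauExt

/-- As 2 is invertible, the homogeneous parts are the eigenspaces of the parity. Membership thereby
becomes an equation, which can be tested locally and transported along isomorphisms. -/
theorem mem_iff_parity {A : Type*} [Ring A] [Algebra ℝ A] (𝒜 : ZMod 2 → Submodule ℝ A)
    [GradedAlgebra 𝒜] {i : ZMod 2} {a : A} : a ∈ 𝒜 i ↔ parity 𝒜 a = sgn i • a := by
  refine ⟨parity_of_mem, fun h => ?_⟩
  have h2 : ∀ b : A, b = -b → b = 0 := fun b hb => by
    have : (2 : ℝ) • b = 0 := by rw [two_smul]; nth_rw 1 [hb]; simp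
    exact (smul_eq_zero.1 this).resolve_left two_ne_zero
  have e := proj_zero_add_proj_one 𝒜 a
  have e' : GradedAlgebra.proj 𝒜 0 a - GradedAlgebra.proj 𝒜 1 a = sgn i • a := h
  have m₀ := proj_mem 𝒜 0 a
  have m₁ := proj_mem 𝒜 1 a
  generalize GradedAlgebra.proj 𝒜 0 a = p at *
  generalize GradedAlgebra.proj 𝒜 1 a = q at *
  subst e
  rcases zmod_two_cases i with rfl | rfl
  · have : q = 0 := h2 _ (add_left_cancel (a := p) (by
      rw [← sub_eq_add_neg, e']; simp))
    simpa [this] using m₀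
  · have : p = 0 := h2 _ (add_right_cancel (b := -q) (by
      rw [← sub_eq_add_neg, e']; simp [Units.smul_def]))
    simpa [this] using m₁

/-! ### The superspace M × ℝ^{0|1} -/

namespace SuperSpace

variable (M : SuperSpace.{u})

theorem res_parity {U V : Opens M.carrier} (h : U ≤ V) (a : M.sec V) :
    M.res h (parity (M.par V) a) = parity (M.par U) (M.res h a) := by
  induction a using homogeneous_induction (M.par V) with
  | add a b ha hb => simp only [map_add, ha, hb]
  | hom i a ha => rw [parity_of_mem ha, parity_of_mem (M.res_par h i a ha), map_units_smul]

/-- The superspace `M × ℝ^{0|1}`, with an additional global odd coordinate `τ`. -/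
noncomputable def tau : SuperSpace.{u} where
  carrier := M.carrier
  sec U := TauExt (parity (M.par U))
  par U := TauExt.grading (M.par U)
  supercomm U i j a b ha hb := by
    have e : ∀ s : ℤˣ, ∀ x : TauExt (parity (M.par U)), (s • x).fst = s • x.fst :=
      fun _ _ => rfl
    have e' : ∀ s : ℤˣ, ∀ x : TauExt (parity (M.par U)), (s • x).snd = s • x.snd :=
      fun _ _ => rfl
    ext
    · exact M.supercomm U i j _ _ ha.1 hb.1
    · simp only [e', TauExt.snd_mul, parity_of_mem ha.1, parity_of_mem hb.1, smul_add,
        units_mul_smul_comm]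
      -- The τ-coefficients have degrees `i + 1` and `j + 1`; the additional signs are exactly those
      -- created by the parity in the product of `A[τ]`.
      rw [M.supercomm U i (j + 1) _ _ ha.1 hb.2, M.supercomm U (i + 1) j _ _ ha.2 hb.1, add_comm]
      simp only [← sgn_add, smul_smul]
      rw [show j + (i + 1) * j = i * j by clear ha hb; revert i j; decide,
        show i * (j + 1) = i * j + i by ring]
  res h := TauExt.map (M.res h) (M.res_parity h)
  res_par h i a ha := ⟨M.res_par h _ _ ha.1, M.res_par h _ _ ha.2⟩
  res_self U a := TauExt.ext (M.res_self U _) (M.res_self U _)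
  res_res h h' a := TauExt.ext (M.res_res h h' _) (M.res_res h h' _)
  existsUnique_glue U s hs := by
    obtain ⟨a, ha, ha'⟩ := M.existsUnique_glue U (fun i => (s i).fst)
      (fun i j => congrArg TauExt.fst (hs i j))
    obtain ⟨b, hb, hb'⟩ := M.existsUnique_glue U (fun i => (s i).snd)
      (fun i j => congrArg TauExt.snd (hs i j))
    refine ⟨TauExt.mk _ a b, fun i => TauExt.ext (ha i) (hb i), fun t ht => TauExt.ext ?_ ?_⟩
    · exact ha' _ fun i => congrArg TauExt.fst (ht i)
    · exact hb' _ fun i => congrArg TauExt.snd (ht i)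

end SuperSpace

/-! ### The exterior algebra in n + 1 generators as an extension by τ -/

section Exterior

open CliffordAlgebra

/-- The inclusion `ℝⁿ → ℝⁿ⁺¹` as the last `n` coordinates. -/
def inclSucc (n : ℕ) : (Fin n → ℝ) →ₗ[ℝ] (Fin (n + 1) → ℝ) where
  toFun v := Fin.cons 0 v
  map_add' v w := by ext i; refine Fin.cases ?_ (fun i => ?_) i <;> simp
  map_smul' r v := by ext i; refine Fin.cases ?_ (fun i => ?_) i <;> simp

theorem inclSucc_add (n : ℕ) (v : Fin (n + 1) → ℝ) :
    inclSucc n (fun i => v i.succ) + v 0 • Pi.single 0 1 = v := by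
  ext i
  refine Fin.cases ?_ (fun i => ?_) i <;> simp [inclSucc]

/-- The homomorphism `Λℝⁿ⁺¹ → (Λℝⁿ)[τ]`. -/
noncomputable def exteriorToTau (n : ℕ) : ExteriorAlgebra ℝ (Fin (n + 1) → ℝ) →ₐ[ℝ]
    TauExt (involute : CliffordAlgebra (0 : QuadraticForm ℝ (Fin n → ℝ)) →ₐ[ℝ] _) :=
  ExteriorAlgebra.lift ℝ
    ⟨{ toFun := fun v => TauExt.mk _ (ExteriorAlgebra.ι ℝ fun i => v i.succ) (algebraMap ℝ _ (v 0))
       map_add' := fun v w => by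
        ext
        · simp only [TauExt.fst_mk, TauExt.fst_add, ← map_add]; rfl
        · simp
       map_smul' := fun r v => by
        ext
        · simp only [TauExt.fst_mk, TauExt.fst_smul, ← map_smul, RingHom.id_apply]; rfl
        · simp [Algebra.algebraMap_eq_smul_one, mul_smul] },
    fun v => by
      have h : involute (ExteriorAlgebra.ι ℝ fun i => v (Fin.succ i)) =
        -(ExteriorAlgebra.ι ℝ fun i => v (Fin.succ i)) := involute_ι _
      ext
      · simp
      · simp [h, Algebra.commutes]⟩

theorem exteriorToTau_ι (n : ℕ) (v : Fin (n + 1) → ℝ) :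
    exteriorToTau n (ExteriorAlgebra.ι ℝ v) =
      TauExt.mk _ (ExteriorAlgebra.ι ℝ fun i => v i.succ) (algebraMap ℝ _ (v 0)) := by
  simp [exteriorToTau]

/-- The new generator anticommutes with the old ones. This is the relation τ a = σ(a) τ, and it
makes `tauToExterior` multiplicative. -/
theorem ι_mul_map_inclSucc (n : ℕ) (a : ExteriorAlgebra ℝ (Fin n → ℝ)) :
    ExteriorAlgebra.ι ℝ (Pi.single 0 1 : Fin (n + 1) → ℝ) * ExteriorAlgebra.map (inclSucc n) a =
      ExteriorAlgebra.map (inclSucc n) (involute a) *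
        ExteriorAlgebra.ι ℝ (Pi.single 0 1 : Fin (n + 1) → ℝ) := by
  induction a using ExteriorAlgebra.induction with
  | algebraMap r => simp [Algebra.commutes]
  | ι v =>
    have h : involute (ExteriorAlgebra.ι ℝ v) = -(ExteriorAlgebra.ι ℝ v) := involute_ι _
    rw [h, map_neg, ExteriorAlgebra.map_apply_ι, neg_mul]
    exact eq_neg_of_add_eq_zero_left (ExteriorAlgebra.ι_add_mul_swap _ _)
  | mul a b ha hb =>
    rw [map_mul, ← mul_assoc, ha, mul_assoc, hb, map_mul, map_mul, mul_assoc]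
  | add a b ha hb => simp only [map_add, mul_add, add_mul, ha, hb]

/-- The homomorphism `(Λℝⁿ)[τ] → Λℝⁿ⁺¹`. -/
noncomputable def tauToExterior (n : ℕ) :
    TauExt (involute : CliffordAlgebra (0 : QuadraticForm ℝ (Fin n → ℝ)) →ₐ[ℝ] _) →ₐ[ℝ]
      ExteriorAlgebra ℝ (Fin (n + 1) → ℝ) where
  toFun x := ExteriorAlgebra.map (inclSucc n) x.fst +
    ExteriorAlgebra.map (inclSucc n) x.snd * ExteriorAlgebra.ι ℝ (Pi.single 0 1)
  map_one' := by simp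
  map_zero' := by simp
  map_add' x y := by simp only [TauExt.fst_add, TauExt.snd_add, map_add, add_mul]; abel
  map_mul' x y := by
    have h := ι_mul_map_inclSucc n
    have h0 : ExteriorAlgebra.ι ℝ (Pi.single 0 1 : Fin (n + 1) → ℝ) *
      ExteriorAlgebra.ι ℝ (Pi.single 0 1) = 0 := ExteriorAlgebra.ι_sq_zero _
    simp only [TauExt.fst_mul, TauExt.snd_mul, map_add, map_mul, add_mul, mul_add]
    have h' : ∀ a b, ExteriorAlgebra.ι ℝ (Pi.single 0 1 : Fin (n + 1) → ℝ) *
        (ExteriorAlgebra.map (inclSucc n) a * b) = ExteriorAlgebra.map (inclSucc n) (involute a) *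
        (ExteriorAlgebra.ι ℝ (Pi.single 0 1 : Fin (n + 1) → ℝ) * b) := fun a b => by
      rw [← mul_assoc, h, mul_assoc]
    simp only [mul_assoc, h, h', h0, mul_zero, add_zero]
    abel
  commutes' r := by simp [TauExt.algebraMap_eq]

/-- The isomorphism `Λℝⁿ⁺¹ ≃ (Λℝⁿ)[τ]`. -/
noncomputable def exteriorEquivTau (n : ℕ) : ExteriorAlgebra ℝ (Fin (n + 1) → ℝ) ≃ₐ[ℝ]
    TauExt (involute : CliffordAlgebra (0 : QuadraticForm ℝ (Fin n → ℝ)) →ₐ[ℝ] _) :=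
  AlgEquiv.ofAlgHom (exteriorToTau n) (tauToExterior n)
    (by
      have key : ∀ a : ExteriorAlgebra ℝ (Fin n → ℝ),
          exteriorToTau n (ExteriorAlgebra.map (inclSucc n) a) = TauExt.mk _ a 0 := by
        intro a
        induction a using ExteriorAlgebra.induction with
        | algebraMap r => simp [TauExt.algebraMap_eq]
        | ι v =>
          rw [ExteriorAlgebra.map_apply_ι, exteriorToTau_ι]
          ext <;> simp [inclSucc]
        | mul a b ha hb => rw [map_mul, map_mul, ha, hb]; ext <;> simp
        | add a b ha hb => rw [map_add, map_add, ha, hb]; ext <;> simp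
      refine AlgHom.ext fun x => ?_
      have h0 : (fun i : Fin n => (Pi.single 0 1 : Fin (n + 1) → ℝ) i.succ) = 0 := by
        ext i; simp
      simp only [AlgHom.comp_apply, tauToExterior, AlgHom.coe_mk, RingHom.coe_mk, MonoidHom.coe_mk,
        OneHom.coe_mk, map_add, map_mul, key, exteriorToTau_ι, h0]
      ext <;> simp)
    (by
      refine ExteriorAlgebra.hom_ext (LinearMap.ext fun v => ?_)
      simp only [AlgHom.comp_toLinearMap, LinearMap.comp_apply, AlgHom.toLinearMap_apply,
        exteriorToTau_ι, AlgHom.id_apply, tauToExterior, AlgHom.coe_mk, RingHom.coe_mk,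
        MonoidHom.coe_mk, OneHom.coe_mk, TauExt.fst_mk, TauExt.snd_mk, AlgHom.commutes,
        ExteriorAlgebra.map_apply_ι]
      conv_rhs => rw [← inclSucc_add n v, map_add, map_smul, Algebra.smul_def])

end Exterior

open CliffordAlgebra

/-! ### The standard superdomain with one more odd coordinate -/

section Model

variable (m n : ℕ) (W : Opens (EuclideanSpace ℝ (Fin m)))

/-- The algebra of smooth functions on an open subset of `ℝᵐ`. -/
abbrev SmoothSec (m : ℕ) (W : Opens (EuclideanSpace ℝ (Fin m))) : Type :=
  C^∞⟮𝓘(ℝ, EuclideanSpace ℝ (Fin m)), W; 𝓘(ℝ, ℝ), ℝ⟯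

@[elab_as_elim]
theorem ModelSec.induction {m n : ℕ} {W : Opens (EuclideanSpace ℝ (Fin m))}
    {p : ModelSec m n W → Prop} (zero : p 0)
    (tmul : ∀ (c : SmoothSec m W) (a : ExteriorAlgebra ℝ (Fin n → ℝ)), p (c ⊗ₜ a))
    (add : ∀ x y, p x → p y → p (x + y)) (x : ModelSec m n W) : p x :=
  TensorProduct.induction_on x zero tmul add

/-- The parity involution of `C^∞(W) ⊗ Λ ℝⁿ`. -/
noncomputable def modelParity : ModelSec m n W →ₐ[ℝ] ModelSec m n W :=
  Algebra.TensorProduct.map (AlgHom.id ℝ _) (involute (Q := (0 : QuadraticForm ℝ (Fin n → ℝ))))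

variable {m n W}

theorem modelParity_tmul (c : SmoothSec m W) (a : ExteriorAlgebra ℝ (Fin n → ℝ)) :
    modelParity m n W (c ⊗ₜ a) = c ⊗ₜ involute a := rfl

theorem involute_of_mem_evenOdd {i : ZMod 2} {a : ExteriorAlgebra ℝ (Fin n → ℝ)}
    (ha : a ∈ evenOdd (0 : QuadraticForm ℝ (Fin n → ℝ)) i) : involute a = sgn i • a := by
  rcases zmod_two_cases i with rfl | rfl
  · simpa using involute_eq_of_mem_even ha
  · simpa [Units.smul_def] using involute_eq_of_mem_odd ha

theorem tmul_mem_modelPar {i : ZMod 2} (c : SmoothSec m W) {a : ExteriorAlgebra ℝ (Fin n → ℝ)}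
    (ha : a ∈ evenOdd (0 : QuadraticForm ℝ (Fin n → ℝ)) i) : c ⊗ₜ a ∈ modelPar m n W i :=
  Submodule.tmul_mem_baseChange_of_mem c ha

theorem modelParity_of_mem {i : ZMod 2} {x : ModelSec m n W} (hx : x ∈ modelPar m n W i) :
    modelParity m n W x = sgn i • x := by
  have hx' : x ∈ Submodule.baseChange (SmoothSec m W)
    (evenOdd (0 : QuadraticForm ℝ (Fin n → ℝ)) i) := hx
  rw [Submodule.baseChange_eq_span] at hx'
  clear hx
  induction hx' using Submodule.span_induction with
  | mem x h =>
    obtain ⟨a, ha, rfl⟩ := h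
    have : modelParity m n W ((1 : SmoothSec m W) ⊗ₜ a) = 1 ⊗ₜ involute a := rfl
    refine this.trans ?_
    rw [involute_of_mem_evenOdd ha, Units.smul_def, Units.smul_def, TensorProduct.tmul_smul]
    rfl
  | zero => simp
  | add x y hx hy ihx ihy => rw [map_add, ihx, ihy, smul_add]
  | smul c x hx ih =>
    have hc : ∀ y : ModelSec m n W, c • y = (c ⊗ₜ 1) * y := fun y => by
      induction y using ModelSec.induction with
      | zero => simp
      | tmul a b => simp [TensorProduct.smul_tmul']
      | add y z hy hz => rw [smul_add, hy, hz, mul_add]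
    rw [hc, map_mul, ih, modelParity_tmul, map_one, units_mul_smul_comm]

theorem exists_modelPar_add (x : ModelSec m n W) :
    ∃ x₀ ∈ modelPar m n W 0, ∃ x₁ ∈ modelPar m n W 1, x = x₀ + x₁ := by
  induction x using ModelSec.induction with
  | zero => exact ⟨0, zero_mem _, 0, zero_mem _, by simp⟩
  | tmul c a =>
    refine ⟨c ⊗ₜ GradedAlgebra.proj (evenOdd (0 : QuadraticForm ℝ (Fin n → ℝ))) 0 a,
      tmul_mem_modelPar c (proj_mem _ _ _),
      c ⊗ₜ GradedAlgebra.proj (evenOdd (0 : QuadraticForm ℝ (Fin n → ℝ))) 1 a,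
      tmul_mem_modelPar c (proj_mem _ _ _), ?_⟩
    rw [← TensorProduct.tmul_add]
    exact congrArg _ (proj_zero_add_proj_one _ a).symm
  | add x y hx hy =>
    obtain ⟨x₀, h₀, x₁, h₁, rfl⟩ := hx
    obtain ⟨y₀, k₀, y₁, k₁, rfl⟩ := hy
    exact ⟨x₀ + y₀, add_mem h₀ k₀, x₁ + y₁, add_mem h₁ k₁, by abel⟩

/-- Even and odd parts span, so the eigenspace argument for `mem_iff_parity` applies without first
making `modelPar` a grading. -/
theorem mem_modelPar_iff {i : ZMod 2} {x : ModelSec m n W} :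
    x ∈ modelPar m n W i ↔ modelParity m n W x = sgn i • x := by
  refine ⟨modelParity_of_mem, fun h => ?_⟩
  have h2 : ∀ b : ModelSec m n W, b = -b → b = 0 := fun b hb => by
    have : (2 : ℝ) • b = 0 := by rw [two_smul]; nth_rw 1 [hb]; simp
    exact (smul_eq_zero.1 this).resolve_left two_ne_zero
  obtain ⟨p, hp, q, hq, rfl⟩ := exists_modelPar_add x
  rw [map_add, modelParity_of_mem hp, modelParity_of_mem hq] at h
  rcases zmod_two_cases i with rfl | rfl
  · have : q = 0 := h2 _ (add_left_cancel (a := p) (by simpa [Units.smul_def] using h.symm))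
    simpa [this] using hp
  · have : p = 0 := h2 _ (add_right_cancel (b := -q) (by simpa [Units.smul_def, add_comm] using h))
    simpa [this] using hq

/-- The parity involution of `A[τ]`. -/
noncomputable def tauParity {A : Type*} [Ring A] [Algebra ℝ A] (σ : A →ₐ[ℝ] A) :
    TauExt σ →ₐ[ℝ] TauExt σ where
  toFun x := TauExt.mk σ (σ x.fst) (-σ x.snd)
  map_one' := by ext <;> simp
  map_mul' x y := by ext <;> simp [add_comm]
  map_zero' := by ext <;> simp
  map_add' x y := by ext <;> simp [add_comm]
  commutes' r := by simp only [TauExt.algebraMap_eq]; ext <;> simp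

theorem exteriorEquivTau_involute (a : ExteriorAlgebra ℝ (Fin (n + 1) → ℝ)) :
    exteriorEquivTau n (involute a) = tauParity _ (exteriorEquivTau n a) := by
  have : (exteriorToTau n).comp (involute (Q := (0 : QuadraticForm ℝ (Fin (n + 1) → ℝ)))) =
      (tauParity _).comp (exteriorToTau n) := by
    refine ExteriorAlgebra.hom_ext (LinearMap.ext fun v => ?_)
    have h : involute (ExteriorAlgebra.ι ℝ v) = -(ExteriorAlgebra.ι ℝ v) := involute_ι _
    have h' : involute (ExteriorAlgebra.ι ℝ fun i : Fin n => v i.succ) =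
      -(ExteriorAlgebra.ι ℝ fun i => v i.succ) := involute_ι _
    simp only [AlgHom.comp_toLinearMap, LinearMap.comp_apply, AlgHom.toLinearMap_apply]
    rw [h, map_neg, exteriorToTau_ι]
    ext
    · exact h'.symm
    · simp [tauParity]
  exact DFunLike.congr_fun this a

/-- The underlying linear equivalence of `modelEquivTau`. -/
noncomputable def modelEquivTauLin (m n : ℕ) (W : Opens (EuclideanSpace ℝ (Fin m))) :
    ModelSec m (n + 1) W ≃ₗ[ℝ] TauExt (modelParity m n W) :=
  (TensorProduct.congr (LinearEquiv.refl ℝ _) (exteriorEquivTau n).toLinearEquiv).trans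
    (TensorProduct.prodRight ℝ ℝ (SmoothSec m W) (ExteriorAlgebra ℝ (Fin n → ℝ))
      (ExteriorAlgebra ℝ (Fin n → ℝ)))

theorem modelEquivTauLin_tmul (c : SmoothSec m W) (a : ExteriorAlgebra ℝ (Fin (n + 1) → ℝ)) :
    modelEquivTauLin m n W (c ⊗ₜ a) =
      TauExt.mk _ (c ⊗ₜ (exteriorEquivTau n a).fst) (c ⊗ₜ (exteriorEquivTau n a).snd) := rfl

/-- The isomorphism `C^∞(W) ⊗ Λ ℝⁿ⁺¹ ≃ (C^∞(W) ⊗ Λ ℝⁿ)[τ]`. -/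
noncomputable def modelEquivTau (m n : ℕ) (W : Opens (EuclideanSpace ℝ (Fin m))) :
    ModelSec m (n + 1) W ≃ₐ[ℝ] TauExt (modelParity m n W) :=
  AlgEquiv.ofLinearEquiv (modelEquivTauLin m n W)
    (by
      rw [Algebra.TensorProduct.one_def, modelEquivTauLin_tmul, map_one]
      ext
      · rfl
      · simp)
    (fun x y => by
      induction x using ModelSec.induction with
      | zero => simp
      | add x x' hx hx' => rw [add_mul, map_add, map_add, add_mul, hx, hx']
      | tmul c a =>
        induction y using ModelSec.induction with
        | zero => simp
        | add y y' hy hy' => rw [mul_add, map_add, map_add, mul_add, hy, hy']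
        | tmul c' a' =>
          rw [Algebra.TensorProduct.tmul_mul_tmul]
          simp only [modelEquivTauLin_tmul, map_mul]
          ext
          · simp
          · simp [modelParity_tmul, TensorProduct.tmul_add])

theorem modelEquivTau_tmul (c : SmoothSec m W) (a : ExteriorAlgebra ℝ (Fin (n + 1) → ℝ)) :
    modelEquivTau m n W (c ⊗ₜ a) =
      TauExt.mk _ (c ⊗ₜ (exteriorEquivTau n a).fst) (c ⊗ₜ (exteriorEquivTau n a).snd) := rfl

theorem modelEquivTau_modelParity (x : ModelSec m (n + 1) W) :
    modelEquivTau m n W (modelParity m (n + 1) W x) = tauParity _ (modelEquivTau m n W x) := by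
  induction x using ModelSec.induction with
  | zero => simp
  | add x x' hx hx' => simp only [map_add, hx, hx']
  | tmul c a =>
    rw [modelParity_tmul, modelEquivTau_tmul, modelEquivTau_tmul, exteriorEquivTau_involute]
    ext
    · rfl
    · exact TensorProduct.tmul_neg _ _

theorem modelRes_modelParity {V : Opens (EuclideanSpace ℝ (Fin m))} (h : V ≤ W)
    (x : ModelSec m n W) : modelRes n h (modelParity m n W x) = modelParity m n V (modelRes n h x) := by
  induction x using ModelSec.induction with
  | zero => simp
  | add x x' hx hx' => simp only [map_add, hx, hx']
  | tmul c a => rfl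

theorem modelEquivTau_modelRes {V : Opens (EuclideanSpace ℝ (Fin m))} (h : V ≤ W)
    (x : ModelSec m (n + 1) W) :
    modelEquivTau m n V (modelRes (n + 1) h x) =
      TauExt.map (modelRes n h) (modelRes_modelParity h) (modelEquivTau m n W x) := by
  induction x using ModelSec.induction with
  | zero => simp
  | add x x' hx hx' => simp only [map_add, hx, hx']
  | tmul c a => rfl

theorem modelEquivTau_symm_map {V : Opens (EuclideanSpace ℝ (Fin m))} (h : V ≤ W)
    (y : TauExt (modelParity m n W)) :
    (modelEquivTau m n V).symm (TauExt.map (modelRes n h) (modelRes_modelParity h) y) =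
      modelRes (n + 1) h ((modelEquivTau m n W).symm y) := by
  apply (modelEquivTau m n V).injective
  rw [modelEquivTau_modelRes, AlgEquiv.apply_symm_apply, AlgEquiv.apply_symm_apply]

theorem modelEquivTau_symm_mem {i : ZMod 2} {y : TauExt (modelParity m n W)}
    (h₁ : y.fst ∈ modelPar m n W i) (h₂ : y.snd ∈ modelPar m n W (i + 1)) :
    (modelEquivTau m n W).symm y ∈ modelPar m (n + 1) W i := by
  rw [mem_modelPar_iff]
  apply (modelEquivTau m n W).injective
  rw [modelEquivTau_modelParity, map_units_smul, AlgEquiv.apply_symm_apply]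
  ext
  · exact modelParity_of_mem h₁
  · refine (congrArg Neg.neg (modelParity_of_mem h₂)).trans ?_
    change _ = sgn i • y.snd
    rw [sgn_add]
    rcases zmod_two_cases i with rfl | rfl <;> simp [Units.smul_def]

end Model

/-! ### Charts of M × ℝ^{0|1} -/

section Chart

variable {M : SuperSpace.{u}} {m n : ℕ} (c : SuperChart M m n)

theorem SuperChart.iso_parity (W : Opens (EuclideanSpace ℝ (Fin m))) (hW : (W : Set _) ⊆ c.φ.target)
    (a : M.sec (chartPre c.φ W)) :
    c.iso W hW (parity (M.par _) a) = modelParity m n W (c.iso W hW a) := by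
  induction a using homogeneous_induction (M.par _) with
  | add a b ha hb => simp only [map_add, ha, hb]
  | hom i a ha =>
    rw [parity_of_mem ha, modelParity_of_mem (c.iso_par W hW i a ha), map_units_smul]

/-- A chart is only required to preserve degrees in one direction. It therefore commutes with the
parities, and injectivity gives the converse. -/
theorem SuperChart.mem_par_iff {W : Opens (EuclideanSpace ℝ (Fin m))}
    (hW : (W : Set _) ⊆ c.φ.target) {i : ZMod 2} {a : M.sec (chartPre c.φ W)} :
    a ∈ M.par _ i ↔ c.iso W hW a ∈ modelPar m n W i := by
  rw [mem_modelPar_iff, mem_iff_parity (M.par _), ← c.iso_parity, ← map_units_smul]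
  exact (c.iso W hW).injective.eq_iff.symm

/-- The isomorphism underlying the chart of `M × ℝ^{0|1}` induced by a chart of `M`. -/
noncomputable def SuperChart.tauIso (W : Opens (EuclideanSpace ℝ (Fin m)))
    (hW : (W : Set _) ⊆ c.φ.target) :
    TauExt (parity (M.par (chartPre c.φ W))) ≃ₐ[ℝ] ModelSec m (n + 1) W :=
  (TauExt.mapEquiv (c.iso W hW) (c.iso_parity W hW)).trans (modelEquivTau m n W).symm

theorem SuperChart.tauIso_mem {W : Opens (EuclideanSpace ℝ (Fin m))}
    (hW : (W : Set _) ⊆ c.φ.target) {i : ZMod 2} {a : TauExt (parity (M.par (chartPre c.φ W)))}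
    (ha : a ∈ TauExt.grading (M.par (chartPre c.φ W)) i) :
    c.tauIso W hW a ∈ modelPar m (n + 1) W i :=
  modelEquivTau_symm_mem (c.iso_par W hW i _ ha.1) (c.iso_par W hW (i + 1) _ ha.2)

theorem SuperChart.tauIso_res {V W : Opens (EuclideanSpace ℝ (Fin m))} (h : V ≤ W)
    (h' : chartPre c.φ V ≤ chartPre c.φ W) (hV : (V : Set _) ⊆ c.φ.target)
    (hW : (W : Set _) ⊆ c.φ.target) (a : TauExt (parity (M.par (chartPre c.φ W)))) :
    c.tauIso V hV (TauExt.map (M.res h') (M.res_parity h') a) =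
      modelRes (n + 1) h (c.tauIso W hW a) := by
  have e : TauExt.mapEquiv (c.iso V hV) (c.iso_parity V hV)
      (TauExt.map (M.res h') (M.res_parity h') a) =
      TauExt.map (modelRes n h) (modelRes_modelParity h)
        (TauExt.mapEquiv (c.iso W hW) (c.iso_parity W hW) a) :=
    TauExt.ext (c.iso_res h h' hV hW a.fst) (c.iso_res h h' hV hW a.snd)
  exact (congrArg (modelEquivTau m n V).symm e).trans (modelEquivTau_symm_map h _)

/-- The chart of `M × ℝ^{0|1}` induced by a chart of `M`. -/
noncomputable def SuperChart.tau : SuperChart M.tau m (n + 1) where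
  φ := c.φ
  iso := c.tauIso
  iso_par _ hW _ _ ha := c.tauIso_mem hW ha
  iso_res h h' hV hW a := c.tauIso_res h h' hV hW a

end Chart

/-- The supermanifold `M × ℝ^{0|1}`. -/
noncomputable def SuperManifold.tau (M : SuperManifold.{u}) : SuperManifold.{u} where
  toSuperSpace := M.toSuperSpace.tau
  t2 := M.t2
  secondCountable := M.secondCountable
  m := M.m
  n := M.n + 1
  exists_chart x := by
    obtain ⟨c, hc⟩ := M.exists_chart x
    exact ⟨c.tau, hc⟩

/-! ### Gluing of sections and extension by zero -/

namespace SuperSpace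

section Sheaf

variable (M : SuperSpace.{u})

theorem existsUnique_glue_of_eq {ι : Type u} (V : ι → Opens M.carrier) {U : Opens M.carrier}
    (hU : U = iSup V) (hV : ∀ i, V i ≤ U) (s : ∀ i, M.sec (V i))
    (hs : ∀ i j, M.res (inf_le_left : V i ⊓ V j ≤ V i) (s i) =
      M.res (inf_le_right : V i ⊓ V j ≤ V j) (s j)) :
    ∃! t : M.sec U, ∀ i, M.res (hV i) t = s i := by
  subst hU
  exact M.existsUnique_glue V s hs

theorem eq_of_cover {ι : Type u} (V : ι → Opens M.carrier) {U : Opens M.carrier}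
    (hU : U = iSup V) (hV : ∀ i, V i ≤ U) {a b : M.sec U}
    (h : ∀ i, M.res (hV i) a = M.res (hV i) b) : a = b :=
  (M.existsUnique_glue_of_eq V hU hV (fun i => M.res (hV i) b)
    (fun i j => by rw [M.res_res, M.res_res])).unique h fun _ => rfl

/-- Sections that agree locally are equal. -/
theorem eq_of_local {U : Opens M.carrier} {a b : M.sec U}
    (h : ∀ x ∈ U, ∃ V : Opens M.carrier, x ∈ V ∧ ∃ hV : V ≤ U, M.res hV a = M.res hV b) :
    a = b := by
  choose! V hx hV hab using h
  refine M.eq_of_cover (fun x : U => V x) (le_antisymm (fun x hxU => ?_) ?_)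
    (fun x => hV x x.2) fun x => hab x x.2
  · exact Opens.mem_iSup.2 ⟨⟨x, hxU⟩, hx x hxU⟩
  · exact iSup_le fun x => hV x x.2

theorem exists_glue_pair {U V : Opens M.carrier} (hUV : U ⊔ V = ⊤) (a : M.sec U) (b : M.sec V)
    (hab : M.res (inf_le_left : U ⊓ V ≤ U) a = M.res (inf_le_right : U ⊓ V ≤ V) b) :
    ∃ t : M.Fn, M.res le_top t = a ∧ M.res le_top t = b := by
  obtain ⟨t, ht, -⟩ := M.existsUnique_glue_of_eq (ι := ULift Bool)
    (fun i => match i with | ⟨true⟩ => U | ⟨false⟩ => V) (U := ⊤)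
    (by
      refine le_antisymm ?_ le_top
      rw [← hUV]
      exact sup_le (le_iSup (fun i : ULift Bool => match i with | ⟨true⟩ => U | ⟨false⟩ => V) ⟨true⟩)
        (le_iSup (fun i : ULift Bool => match i with | ⟨true⟩ => U | ⟨false⟩ => V) ⟨false⟩))
    (fun _ => le_top) (fun i => match i with | ⟨true⟩ => a | ⟨false⟩ => b) (by
      rintro ⟨_ | _⟩ ⟨_ | _⟩
      · rfl
      · have e := congrArg (M.res (le_inf inf_le_right inf_le_left : V ⊓ U ≤ U ⊓ V)) hab
        rw [M.res_res, M.res_res] at e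
        exact e.symm
      · exact hab
      · rfl)
  exact ⟨t, ht ⟨true⟩, ht ⟨false⟩⟩

theorem eq_of_pair {U V : Opens M.carrier} (hUV : U ⊔ V = ⊤) {a b : M.Fn}
    (hU : M.res (le_top : U ≤ ⊤) a = M.res le_top b)
    (hV : M.res (le_top : V ≤ ⊤) a = M.res le_top b) : a = b := by
  refine M.eq_of_local fun x _ => ?_
  have hx : x ∈ U ⊔ V := hUV ▸ Opens.mem_top x
  rcases hx with hx | hx
  · exact ⟨U, hx, le_top, hU⟩
  · exact ⟨V, hx, le_top, hV⟩

/-- Being homogeneous is an equation between sections, by `mem_iff_parity`, and equations are local.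
-/
theorem mem_par_of_local {U : Opens M.carrier} {i : ZMod 2} {a : M.sec U}
    (h : ∀ x ∈ U, ∃ V : Opens M.carrier, x ∈ V ∧ ∃ hV : V ≤ U, M.res hV a ∈ M.par V i) :
    a ∈ M.par U i := by
  rw [mem_iff_parity (M.par U)]
  refine M.eq_of_local fun x hx => ?_
  obtain ⟨V, hxV, hV, ha⟩ := h x hx
  refine ⟨V, hxV, hV, ?_⟩
  rw [M.res_parity, parity_of_mem ha, map_units_smul]

theorem res_proj {U V : Opens M.carrier} (h : U ≤ V) (i : ZMod 2) (a : M.sec V) :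
    M.res h (GradedAlgebra.proj (M.par V) i a) = GradedAlgebra.proj (M.par U) i (M.res h a) := by
  induction a using homogeneous_induction (M.par V) with
  | add a b ha hb => simp only [map_add, ha, hb]
  | hom j a ha =>
    rw [proj_of_mem _ ha, proj_of_mem _ (M.res_par h j a ha)]
    split_ifs <;> simp

end Sheaf

/-- A cutoff function for the open set `U`: an even function that vanishes on an open set which
covers the space together with `U`. -/
structure Cutoff (M : SuperSpace.{u}) (U : Opens M.carrier) where
  χ : M.Fn
  even : χ ∈ M.FnDeg 0
  off : Opens M.carrier
  cover : U ⊔ off = ⊤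
  res_off : M.res (le_top : off ≤ ⊤) χ = 0

namespace Cutoff

variable {M : SuperSpace.{u}} {U : Opens M.carrier} (b : Cutoff M U)

theorem exists_extend (f : M.sec U) : ∃ t : M.Fn,
    M.res (le_top : U ≤ ⊤) t = M.res le_top b.χ * f ∧ M.res (le_top : b.off ≤ ⊤) t = 0 := by
  refine M.exists_glue_pair b.cover _ _ ?_
  have : M.res (inf_le_left : U ⊓ b.off ≤ U) (M.res le_top b.χ) =
      M.res (inf_le_right : U ⊓ b.off ≤ b.off) (M.res le_top b.χ) := by
    rw [M.res_res, M.res_res]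
  rw [map_mul, this, b.res_off, map_zero, zero_mul]

/-- The extension by zero of the section `χ f`. -/
noncomputable def extend : M.sec U →ₗ[ℝ] M.Fn where
  toFun f := (b.exists_extend f).choose
  map_add' f g := by
    refine M.eq_of_pair b.cover ?_ ?_
    · rw [map_add, (b.exists_extend _).choose_spec.1, (b.exists_extend _).choose_spec.1,
        (b.exists_extend _).choose_spec.1, mul_add]
    · rw [map_add, (b.exists_extend _).choose_spec.2, (b.exists_extend _).choose_spec.2,
        (b.exists_extend _).choose_spec.2, add_zero]
  map_smul' r f := by
    refine M.eq_of_pair b.cover ?_ ?_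
    · rw [map_smul, (b.exists_extend _).choose_spec.1, (b.exists_extend _).choose_spec.1,
        RingHom.id_apply, mul_smul_comm]
    · rw [map_smul, (b.exists_extend _).choose_spec.2, (b.exists_extend _).choose_spec.2,
        smul_zero]

theorem res_extend (f : M.sec U) :
    M.res (le_top : U ≤ ⊤) (b.extend f) = M.res le_top b.χ * f :=
  (b.exists_extend f).choose_spec.1

theorem res_off_extend (f : M.sec U) : M.res (le_top : b.off ≤ ⊤) (b.extend f) = 0 :=
  (b.exists_extend f).choose_spec.2

theorem extend_mem {i : ZMod 2} {f : M.sec U} (hf : f ∈ M.par U i) : b.extend f ∈ M.FnDeg i := by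
  refine M.mem_par_of_local fun x _ => ?_
  have hx : x ∈ U ⊔ b.off := b.cover ▸ Opens.mem_top x
  rcases hx with hx | hx
  · refine ⟨U, hx, le_top, ?_⟩
    rw [b.res_extend]
    have := SetLike.mul_mem_graded (M.res_par (le_top : U ≤ ⊤) 0 _ b.even) hf
    rwa [zero_add] at this
  · refine ⟨b.off, hx, le_top, ?_⟩
    rw [b.res_off_extend]
    exact zero_mem _

theorem res_extend_of_le {V : Opens M.carrier} (hV : V ≤ U)
    (h : M.res (le_top : V ≤ ⊤) b.χ = 1) (f : M.sec U) :
    M.res (le_top : V ≤ ⊤) (b.extend f) = M.res hV f := by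
  rw [← M.res_res hV le_top, b.res_extend, map_mul, M.res_res, h, one_mul]

end Cutoff

end SuperSpace

/-! ### Existence of cutoff functions -/

section Bump

variable {m : ℕ}

/-- The restriction of a smooth function on `ℝᵐ` to an open subset. -/
def smoothOf (W : Opens (EuclideanSpace ℝ (Fin m))) (f : EuclideanSpace ℝ (Fin m) → ℝ)
    (hf : ContDiff ℝ ∞ f) : SmoothSec m W :=
  ⟨fun x => f x, hf.contMDiff.comp contMDiff_subtype_val⟩

theorem chartPre_mono {X : Type u} [TopologicalSpace X]
    (φ : OpenPartialHomeomorph X (EuclideanSpace ℝ (Fin m)))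
    {V W : Opens (EuclideanSpace ℝ (Fin m))} (h : V ≤ W) : chartPre φ V ≤ chartPre φ W :=
  fun _ hx => ⟨hx.1, h hx.2⟩

/-- The target of a chart map as an open set. -/
def chartTarget {X : Type u} [TopologicalSpace X]
    (φ : OpenPartialHomeomorph X (EuclideanSpace ℝ (Fin m))) :
    Opens (EuclideanSpace ℝ (Fin m)) := ⟨φ.target, φ.open_target⟩

theorem mem_chartPre_target {X : Type u} [TopologicalSpace X]
    (φ : OpenPartialHomeomorph X (EuclideanSpace ℝ (Fin m))) {x : X} (hx : x ∈ φ.source) :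
    x ∈ chartPre φ (chartTarget φ) := ⟨hx, φ.map_source hx⟩

/-- A bump function in a chart is extended by zero. Its support lies in the compact image `C` of a
closed ball, and `C` is closed because the space is Hausdorff. -/
theorem SuperManifold.exists_cutoff (M : SuperManifold.{u}) {U : Opens M.carrier} {x : M.carrier}
    (hx : x ∈ U) : ∃ (b : Cutoff M.toSuperSpace U) (V : Opens M.carrier), x ∈ V ∧ V ≤ U ∧
      M.res (le_top : V ≤ ⊤) b.χ = 1 := by
  obtain ⟨c, hc⟩ := M.exists_chart x
  have := M.t2
  set φ := c.φ with hφ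
  let T := chartTarget φ
  have hN : φ.symm.source ∩ φ.symm ⁻¹' (U : Set M.carrier) ∈ nhds (φ x) := by
    refine (φ.symm.isOpen_inter_preimage U.2).mem_nhds ⟨φ.map_source hc, ?_⟩
    simpa [φ.left_inv hc] using hx
  obtain ⟨ε, hε, hball⟩ := Metric.nhds_basis_closedBall.mem_iff.1 hN
  let f : ContDiffBump (φ x) := ⟨ε / 2, ε, by positivity, by linarith⟩
  have hf : ContDiff ℝ ∞ f := f.contDiff
  let C : Set M.carrier := φ.symm '' Metric.closedBall (φ x) ε
  have hCc : IsCompact C := (isCompact_closedBall _ _).image_of_continuousOn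
    (φ.symm.continuousOn.mono fun y hy => (hball hy).1)
  have hCU : C ⊆ U := by
    rintro _ ⟨y, hy, rfl⟩
    exact (hball hy).2
  have hCs : C ⊆ φ.source := by
    rintro _ ⟨y, hy, rfl⟩
    exact φ.map_target (hball hy).1
  let off : Opens M.carrier := ⟨Cᶜ, hCc.isClosed.isOpen_compl⟩
  have hmem : ∀ y ∈ φ.source, dist (φ y) (φ x) ≤ ε → y ∈ C := fun y hy h =>
    ⟨φ y, h, φ.left_inv hy⟩
  have hoff : ∀ A : Opens M.carrier, C ⊆ A → A ⊔ off = ⊤ := fun A hA => by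
    ext y
    by_cases hy : y ∈ C
    · simp [hA hy]
    · simp [off, hy]
  let W₁ : Opens (EuclideanSpace ℝ (Fin M.m)) :=
    ⟨φ.target ∩ (Metric.closedBall (φ x) ε)ᶜ,
      φ.open_target.inter Metric.isClosed_closedBall.isOpen_compl⟩
  let W₂ : Opens (EuclideanSpace ℝ (Fin M.m)) :=
    ⟨φ.target ∩ Metric.ball (φ x) (ε / 2), φ.open_target.inter Metric.isOpen_ball⟩
  have h₁ : W₁ ≤ T := fun y hy => hy.1
  have h₂ : W₂ ≤ T := fun y hy => hy.1
  let s : M.sec (chartPre φ T) := (c.iso T subset_rfl).symm (smoothOf T f hf ⊗ₜ 1)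
  have hs₁ : M.res (chartPre_mono φ h₁) s = 0 := by
    apply (c.iso W₁ h₁).injective
    rw [c.iso_res h₁ _ h₁ subset_rfl, AlgEquiv.apply_symm_apply, map_zero]
    have : smoothRes h₁ (smoothOf T f hf) = 0 := by
      ext y
      exact f.zero_of_le_dist (not_le.1 fun h => y.2.2 (Metric.mem_closedBall.2 h)).le
    change smoothRes h₁ (smoothOf T f hf) ⊗ₜ _ = _
    rw [this, TensorProduct.zero_tmul]
  have hs₂ : M.res (chartPre_mono φ h₂) s = 1 := by
    apply (c.iso W₂ h₂).injective
    rw [c.iso_res h₂ _ h₂ subset_rfl, AlgEquiv.apply_symm_apply, map_one]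
    have : smoothRes h₂ (smoothOf T f hf) = 1 := by
      ext y
      exact f.one_of_mem_closedBall (Metric.ball_subset_closedBall y.2.2)
    change smoothRes h₂ (smoothOf T f hf) ⊗ₜ _ = _
    rw [this]
    rfl
  have hle : chartPre φ T ⊓ off ≤ chartPre φ W₁ := fun y hy =>
    ⟨hy.1.1, hy.1.2, fun h => hy.2 (hmem y hy.1.1 h)⟩
  obtain ⟨t, ht₁, ht₂⟩ := M.exists_glue_pair
    (hoff (chartPre φ T) fun y hy => mem_chartPre_target φ (hCs hy)) s (0 : M.sec off) (by
      rw [map_zero, ← M.res_res hle (chartPre_mono φ h₁), hs₁, map_zero])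
  have hV : chartPre φ W₂ ≤ U := fun y hy => hCU (hmem y hy.1
    ((Metric.mem_ball.1 hy.2.2).le.trans (by linarith)))
  -- The glued section need not be known to be even. Its even component inherits both local
  -- conditions, since taking components commutes with restriction and 1 is even.
  refine ⟨⟨M.fnComp 0 t, fnComp_mem 0 t, off, hoff U hCU, ?_⟩, chartPre φ W₂,
    ⟨hc, φ.map_source hc, Metric.mem_ball_self (by positivity)⟩, hV, ?_⟩
  · exact (M.res_proj _ _ _).trans (by rw [ht₂, map_zero])
  · refine (M.res_proj _ _ _).trans ?_
    have : M.res (le_top : chartPre φ W₂ ≤ ⊤) t = 1 := by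
      rw [← M.res_res (chartPre_mono φ h₂) le_top, ht₁, hs₂]
    rw [this]
    rw [proj_of_mem _ (SetLike.one_mem_graded (M.par _)), if_pos rfl]

end Bump

/-! ### Derivations along a morphism and their action on local sections -/

/-- `D` is a derivation of degree `i` along the morphism `φ`. -/
structure IsDerAlong {S M : SuperSpace.{u}} (φ : Hom S M) (i : ZMod 2) (D : M.Fn →ₗ[ℝ] S.Fn) :
    Prop where
  deg : ∀ (j : ZMod 2) (a : M.Fn), a ∈ M.FnDeg j → D a ∈ S.FnDeg (i + j)
  leibniz : ∀ (j : ZMod 2) (a b : M.Fn), a ∈ M.FnDeg j →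
    D (a * b) = D a * φ.star b + sgn (i * j) • (φ.star a * D b)

section Along

variable {S M : SuperSpace.{u}} {φ : Hom S M} {i : ZMod 2} {D : M.Fn →ₗ[ℝ] S.Fn}

theorem Hom.star_mem (φ : Hom S M) {j : ZMod 2} {a : M.Fn} (ha : a ∈ M.FnDeg j) :
    φ.star a ∈ S.FnDeg j := φ.pull_par ⊤ j a ha

/-- The preimage of an open set under a morphism. -/
abbrev Hom.pre (φ : Hom S M) (U : Opens M.carrier) : Opens S.carrier := Opens.comap φ.base U

theorem Hom.pre_mono (φ : Hom S M) {U V : Opens M.carrier} (h : U ≤ V) : φ.pre U ≤ φ.pre V :=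
  fun _ hx => h hx

theorem Hom.res_star (φ : Hom S M) (U : Opens M.carrier) (f : M.Fn) :
    S.res (le_top : φ.pre U ≤ ⊤) (φ.star f) = φ.pull U (M.res le_top f) :=
  (φ.pull_res le_top f).symm

theorem SuperSpace.IsDer.comp_star {X : M.Fn →ₗ[ℝ] M.Fn} (hX : M.IsDer i X) (φ : Hom S M) :
    IsDerAlong φ i (φ.star.toLinearMap ∘ₗ X) where
  deg j a ha := φ.star_mem (hX.1 j a ha)
  leibniz j a b ha := by
    simp only [LinearMap.comp_apply, AlgHom.toLinearMap_apply, hX.2 j a b ha, map_add, map_mul,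
      map_units_smul]

theorem SuperSpace.IsDer.star_comp {B : S.Fn →ₗ[ℝ] S.Fn} (hB : S.IsDer i B) (φ : Hom S M) :
    IsDerAlong φ i (B ∘ₗ φ.star.toLinearMap) where
  deg j a ha := hB.1 j _ (φ.star_mem ha)
  leibniz j a b ha := by
    simp only [LinearMap.comp_apply, AlgHom.toLinearMap_apply, map_mul,
      hB.2 j _ _ (φ.star_mem ha)]

end Along

namespace IsDerAlong

variable {S : SuperSpace.{u}} {M : SuperManifold.{u}} {φ : Hom S M.toSuperSpace} {i : ZMod 2}
  {D : M.Fn →ₗ[ℝ] S.Fn}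

/-- With a cutoff χ for `U`, one has χf = 0, hence 0 = D(χ) φ^*f + φ^*χ D(f). Where χ = 1, this says
that D(f) vanishes. -/
theorem res_eq_zero (hD : IsDerAlong φ i D) {U : Opens M.carrier} {f : M.Fn}
    (hf : M.res (le_top : U ≤ ⊤) f = 0) : S.res (le_top : φ.pre U ≤ ⊤) (D f) = 0 := by
  refine S.eq_of_local fun s hs => ?_
  obtain ⟨b, V, hsV, hVU, hV⟩ := M.exists_cutoff (U := U) (x := φ.base s) hs
  refine ⟨φ.pre V, hsV, φ.pre_mono hVU, ?_⟩
  have h0 : b.χ * f = 0 := by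
    refine M.eq_of_pair b.cover ?_ ?_
    · rw [map_mul, hf, mul_zero, map_zero]
    · rw [map_mul, b.res_off, zero_mul, map_zero]
  have e := hD.leibniz 0 b.χ f b.even
  rw [h0, map_zero] at e
  have e' := congrArg (S.res (le_top : φ.pre V ≤ ⊤)) e
  have hfV : M.res (le_top : V ≤ ⊤) f = 0 := by
    rw [← M.res_res hVU le_top, hf, map_zero]
  simp only [map_zero, map_add, map_mul, mul_zero, uzpow_zero, one_smul] at e'
  rw [φ.res_star V f, hfV, φ.res_star V b.χ, hV, map_zero, map_one, mul_zero, zero_add,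
    one_mul] at e'
  rw [S.res_res, map_zero]
  exact e'.symm

theorem res_eq (hD : IsDerAlong φ i D) {U : Opens M.carrier} {f g : M.Fn}
    (h : M.res (le_top : U ≤ ⊤) f = M.res le_top g) :
    S.res (le_top : φ.pre U ≤ ⊤) (D f) = S.res le_top (D g) := by
  rw [← sub_eq_zero, ← map_sub, ← map_sub]
  exact hD.res_eq_zero (by rw [map_sub, h, sub_self])

end IsDerAlong

/-- Multiplication by a cutoff that is 1 near `x` turns a local section into a global one with the
same germ. -/
theorem SuperManifold.exists_germ (M : SuperManifold.{u}) {U : Opens M.carrier} (f : M.sec U)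
    {x : M.carrier} (hx : x ∈ U) : ∃ (V : Opens M.carrier) (hV : V ≤ U) (F : M.Fn), x ∈ V ∧
      M.res (le_top : V ≤ ⊤) F = M.res hV f := by
  obtain ⟨b, V, hxV, hVU, hV⟩ := M.exists_cutoff hx
  exact ⟨V, hVU, b.extend f, hxV, b.res_extend_of_le hVU hV f⟩

namespace IsDerAlong

variable {S : SuperSpace.{u}} {M : SuperManifold.{u}} {φ : Hom S M.toSuperSpace} {i : ZMod 2}
  {D : M.Fn →ₗ[ℝ] S.Fn}

/-- Near each point `f` is represented by a global function `F`, and by locality the germ of D(F)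
does not depend on `F`; so these germs glue. -/
theorem exists_local (hD : IsDerAlong φ i D) {U : Opens M.carrier} (f : M.sec U) :
    ∃ g : S.sec (φ.pre U), ∀ (V : Opens M.carrier) (hV : V ≤ U) (F : M.Fn),
      M.res (le_top : V ≤ ⊤) F = M.res hV f →
      S.res (φ.pre_mono hV) g = S.res le_top (D F) := by
  choose V hVU F hxV hF using fun x : U => M.exists_germ f x.2
  obtain ⟨g, hg, -⟩ := S.existsUnique_glue_of_eq
    (fun s : {s : S.carrier // φ.base s ∈ U} => φ.pre (V ⟨φ.base s, s.2⟩)) (U := φ.pre U)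
    (le_antisymm (fun s hs => Opens.mem_iSup.2 ⟨⟨s, hs⟩, hxV ⟨φ.base s, hs⟩⟩)
      (iSup_le fun s => φ.pre_mono (hVU _)))
    (fun s => φ.pre_mono (hVU _)) (fun s => S.res le_top (D (F ⟨φ.base s, s.2⟩)))
    (fun s t => by
      rw [S.res_res, S.res_res]
      set x : U := ⟨φ.base s, s.2⟩
      set y : U := ⟨φ.base t, t.2⟩
      refine hD.res_eq (U := V x ⊓ V y) ?_
      rw [← M.res_res (inf_le_left : V x ⊓ V y ≤ V x) le_top, hF, M.res_res,
        ← M.res_res (inf_le_right : V x ⊓ V y ≤ V y) le_top, hF, M.res_res])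
  refine ⟨g, fun W hW G hG => S.eq_of_local fun s hs => ?_⟩
  have hsU : φ.base s ∈ U := hW hs
  set x : U := ⟨φ.base s, hsU⟩
  refine ⟨φ.pre (W ⊓ V x), ⟨hs, hxV x⟩, φ.pre_mono inf_le_left, ?_⟩
  have hgx : S.res (φ.pre_mono (hVU x)) g = S.res le_top (D (F x)) := hg ⟨s, hsU⟩
  have e := congrArg (S.res (φ.pre_mono (inf_le_right : W ⊓ V x ≤ V x))) hgx
  rw [S.res_res, S.res_res] at e
  rw [S.res_res, S.res_res, e]
  refine hD.res_eq ?_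
  rw [← M.res_res (inf_le_right : W ⊓ V x ≤ V x) le_top, hF, M.res_res,
    ← M.res_res (inf_le_left : W ⊓ V x ≤ W) le_top, hG, M.res_res]

/-- The action on local sections of a derivation along a morphism. -/
noncomputable def loc (hD : IsDerAlong φ i D) {U : Opens M.carrier} (f : M.sec U) :
    S.sec (φ.pre U) := (hD.exists_local f).choose

theorem res_loc (hD : IsDerAlong φ i D) {U V : Opens M.carrier} {f : M.sec U} (hV : V ≤ U)
    {F : M.Fn} (hF : M.res (le_top : V ≤ ⊤) F = M.res hV f) :
    S.res (φ.pre_mono hV) (hD.loc f) = S.res le_top (D F) :=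
  (hD.exists_local f).choose_spec V hV F hF

theorem loc_top (hD : IsDerAlong φ i D) (f : M.Fn) : hD.loc f = D f := by
  have := hD.res_loc (le_refl ⊤) (F := f) (f := f) rfl
  exact (S.res_self (φ.pre ⊤) _).symm.trans (this.trans (S.res_self ⊤ (D f)))

theorem loc_res (hD : IsDerAlong φ i D) {U V : Opens M.carrier} (h : U ≤ V) (f : M.sec V) :
    hD.loc (M.res h f) = S.res (φ.pre_mono h) (hD.loc f) := by
  refine S.eq_of_local fun s hs => ?_
  obtain ⟨W, hW, F, hsW, hF⟩ := M.exists_germ f (h hs)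
  refine ⟨φ.pre (W ⊓ U), ⟨hsW, hs⟩, φ.pre_mono inf_le_right, ?_⟩
  have hF' : M.res (le_top : W ⊓ U ≤ ⊤) F = M.res (inf_le_left.trans hW) f := by
    rw [← M.res_res inf_le_left le_top, hF, M.res_res]
  rw [S.res_res, hD.res_loc (inf_le_left.trans hW) hF',
    hD.res_loc inf_le_right (F := F) (by rw [hF', M.res_res])]

/-- A global section and an open set on which finitely many sections are represented. -/
theorem exists_germ_pair (M : SuperManifold.{u}) {U : Opens M.carrier} (f g : M.sec U)
    {x : M.carrier} (hx : x ∈ U) : ∃ (V : Opens M.carrier) (hV : V ≤ U) (F G : M.Fn), x ∈ V ∧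
      M.res (le_top : V ≤ ⊤) F = M.res hV f ∧ M.res (le_top : V ≤ ⊤) G = M.res hV g := by
  obtain ⟨b, V, hxV, hVU, hV⟩ := M.exists_cutoff hx
  exact ⟨V, hVU, b.extend f, b.extend g, hxV, b.res_extend_of_le hVU hV f,
    b.res_extend_of_le hVU hV g⟩

theorem loc_add (hD : IsDerAlong φ i D) {U : Opens M.carrier} (f g : M.sec U) :
    hD.loc (f + g) = hD.loc f + hD.loc g := by
  refine S.eq_of_local fun s hs => ?_
  obtain ⟨V, hV, F, G, hsV, hF, hG⟩ := exists_germ_pair M f g hs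
  refine ⟨φ.pre V, hsV, φ.pre_mono hV, ?_⟩
  rw [map_add, hD.res_loc hV hF, hD.res_loc hV hG,
    hD.res_loc hV (F := F + G) (by rw [map_add, map_add, hF, hG]), map_add, map_add]

theorem loc_algebraMap (hD : IsDerAlong φ i D) {U : Opens M.carrier} (r : ℝ) :
    hD.loc (algebraMap ℝ (M.sec U) r) = 0 := by
  have h1 : D 1 = 0 := by
    have := hD.leibniz 0 1 1 (SetLike.one_mem_graded (M.par ⊤))
    simpa using this
  have h0 : D (algebraMap ℝ M.Fn r) = 0 := by
    rw [Algebra.algebraMap_eq_smul_one, map_smul, h1, smul_zero]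
  have h := hD.loc_res (le_top : U ≤ ⊤) (algebraMap ℝ M.Fn r)
  rw [AlgHom.commutes] at h
  exact h.trans ((congrArg _ ((hD.loc_top _).trans h0)).trans (map_zero _))

theorem loc_mem (hD : IsDerAlong φ i D) {U : Opens M.carrier} {f : M.sec U} {j : ZMod 2}
    (hf : f ∈ M.par U j) : hD.loc f ∈ S.par (φ.pre U) (i + j) := by
  refine S.mem_par_of_local fun s hs => ?_
  obtain ⟨b, V, hxV, hVU, hV⟩ := M.exists_cutoff (U := U) (x := φ.base s) hs
  refine ⟨φ.pre V, hxV, φ.pre_mono hVU, ?_⟩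
  rw [hD.res_loc hVU (b.res_extend_of_le hVU hV f)]
  exact S.res_par _ _ _ (hD.deg j _ (b.extend_mem hf))

theorem loc_mul (hD : IsDerAlong φ i D) {U : Opens M.carrier} {f g : M.sec U} {j : ZMod 2}
    (hf : f ∈ M.par U j) :
    hD.loc (f * g) = hD.loc f * φ.pull U g + sgn (i * j) • (φ.pull U f * hD.loc g) := by
  refine S.eq_of_local fun s hs => ?_
  obtain ⟨b, V, hxV, hVU, hV⟩ := M.exists_cutoff (U := U) (x := φ.base s) hs
  refine ⟨φ.pre V, hxV, φ.pre_mono hVU, ?_⟩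
  have hF := b.res_extend_of_le hVU hV f
  have hG := b.res_extend_of_le hVU hV g
  have hp : ∀ (f : M.sec U) (F : M.Fn), M.res (le_top : V ≤ ⊤) F = M.res hVU f →
      S.res (φ.pre_mono hVU) (φ.pull U f) = S.res le_top (φ.star F) := fun f F h => by
    rw [φ.res_star, h, φ.pull_res]
  rw [hD.res_loc hVU (F := b.extend f * b.extend g) (by rw [map_mul, map_mul, hF, hG]),
    hD.leibniz j _ _ (b.extend_mem hf)]
  simp only [map_add, map_mul, map_units_smul, hp _ _ hF, hp _ _ hG, hD.res_loc hVU hF,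
    hD.res_loc hVU hG]

end IsDerAlong

/-! ### Derivations as morphisms with odd parameters -/

section TauHom

variable {S : SuperSpace.{u}} {M : SuperManifold.{u}} {φ : Hom S M.toSuperSpace}
  {D : M.Fn →ₗ[ℝ] S.Fn}

theorem parity_parity {A : Type*} [Ring A] [Algebra ℝ A] (𝒜 : ZMod 2 → Submodule ℝ A)
    [GradedAlgebra 𝒜] (a : A) : parity 𝒜 (parity 𝒜 a) = a := by
  induction a using homogeneous_induction 𝒜 with
  | add a b ha hb => simp only [map_add, ha, hb]
  | hom i a ha => rw [parity_of_mem ha, map_units_smul, parity_of_mem ha, smul_smul,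
      sgn_mul_self, one_smul]

/-- The pullback `f ↦ φ^* f + τ D(f)` on local sections. -/
noncomputable def IsDerAlong.oddPull (hD : IsDerAlong φ 1 D) (U : Opens M.carrier) :
    M.sec U →ₐ[ℝ] TauExt (parity (S.par (φ.pre U))) where
  toFun f := TauExt.mk (parity (S.par (φ.pre U))) (φ.pull U f)
    (parity (S.par (φ.pre U)) (hD.loc f))
  map_one' := by
    ext
    · exact map_one _
    · have := hD.loc_algebraMap (U := U) 1
      rw [map_one] at this
      exact (congrArg _ this).trans (map_zero _)
  map_mul' f g := by
    ext
    · exact map_mul _ _ _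
    · simp only [TauExt.snd_mul, TauExt.snd_mk, TauExt.fst_mk]
      induction f using homogeneous_induction (M.par U) with
      | add a b ha hb => rw [add_mul, hD.loc_add, map_add, ha, hb, map_add, hD.loc_add,
          map_add, add_mul, add_mul]; abel
      | hom j f hf =>
        rw [hD.loc_mul hf, map_add, map_units_smul, map_mul, map_mul,
          parity_of_mem (φ.pull_par U j f hf), units_smul_mul_assoc, smul_smul, one_mul,
          sgn_mul_self, one_smul, add_comm]
  map_zero' := by
    ext
    · exact map_zero _
    · have := hD.loc_algebraMap (U := U) 0
      rw [map_zero] at this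
      exact (congrArg _ this).trans (map_zero _)
  map_add' f g := by
    ext
    · exact map_add _ _ _
    · exact (congrArg _ (hD.loc_add f g)).trans (map_add _ _ _)
  commutes' r := by
    rw [TauExt.algebraMap_eq]
    ext
    · exact (φ.pull U).commutes r
    · exact (congrArg _ (hD.loc_algebraMap r)).trans (map_zero _)

theorem IsDerAlong.oddPull_mem (hD : IsDerAlong φ 1 D) {U : Opens M.carrier} {i : ZMod 2}
    {a : M.sec U} (ha : a ∈ M.par U i) : hD.oddPull U a ∈ TauExt.grading (S.par (φ.pre U)) i := by
  refine ⟨φ.pull_par U i a ha, ?_⟩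
  have := hD.loc_mem ha
  rw [add_comm] at this
  change parity (S.par (φ.pre U)) (hD.loc a) ∈ S.par (φ.pre U) (i + 1)
  rw [parity_of_mem this]
  exact units_smul_mem _ this

theorem IsDerAlong.oddPull_res (hD : IsDerAlong φ 1 D) {U V : Opens M.carrier} (h : U ≤ V)
    (a : M.sec V) : hD.oddPull U (M.res h a) =
      TauExt.map (S.res (φ.pre_mono h)) (S.res_parity (φ.pre_mono h)) (hD.oddPull V a) := by
  refine TauExt.ext (φ.pull_res h a) ?_
  change parity (S.par (φ.pre U)) (hD.loc (M.res h a)) =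
    S.res (φ.pre_mono h) (parity (S.par (φ.pre V)) (hD.loc a))
  rw [hD.loc_res, S.res_parity]

/-- The morphism `S × ℝ^{0|1} → M`, `f ↦ φ^* f + τ D(f)`, for an odd derivation `D` along `φ`. -/
noncomputable def IsDerAlong.oddFlow (hD : IsDerAlong φ 1 D) : Hom S.tau M.toSuperSpace where
  base := φ.base
  pull := hD.oddPull
  pull_par _ _ _ ha := hD.oddPull_mem ha
  pull_res h a := hD.oddPull_res h a

theorem TauExt.parity_grading_mk {A : Type*} [Ring A] [Algebra ℝ A] (𝒜 : ZMod 2 → Submodule ℝ A)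
    [GradedAlgebra 𝒜] (a : A) : parity (TauExt.grading 𝒜) (TauExt.mk (parity 𝒜) a 0) =
      TauExt.mk (parity 𝒜) (parity 𝒜 a) 0 := by
  induction a using homogeneous_induction 𝒜 with
  | add a b ha hb =>
    have : TauExt.mk (parity 𝒜) (a + b) 0 = TauExt.mk (parity 𝒜) a 0 + TauExt.mk (parity 𝒜) b 0 := by
      ext <;> simp
    rw [this, map_add, ha, hb]
    ext <;> simp
  | hom i a ha =>
    have h : TauExt.mk (parity 𝒜) a 0 ∈ TauExt.grading 𝒜 i := ⟨ha, zero_mem _⟩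
    rw [parity_of_mem h, parity_of_mem ha]
    ext
    · rfl
    · exact smul_zero (A := A) (sgn i)

/-- The pullback `f ↦ φ^* f + D(f) τ₁ τ₂` on local sections. -/
noncomputable def IsDerAlong.evenPull (hD : IsDerAlong φ 0 D) (U : Opens M.carrier) :
    M.sec U →ₐ[ℝ] TauExt (parity (TauExt.grading (S.par (φ.pre U)))) where
  toFun f := TauExt.mk (parity (TauExt.grading (S.par (φ.pre U))))
    (TauExt.mk (parity (S.par (φ.pre U))) (φ.pull U f) 0)
    (TauExt.mk (parity (S.par (φ.pre U))) 0 (hD.loc f))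
  map_one' := by
    have := hD.loc_algebraMap (U := U) 1
    rw [map_one] at this
    ext
    · exact map_one _
    · rfl
    · rfl
    · exact this
  map_mul' f g := by
    ext
    · exact map_mul _ _ _
    · simp
    · simp
    -- Moving a function past τ₁ and τ₂ applies the parity twice, so no sign is left: the product
    -- τ₁τ₂ is an even infinitesimal.
    · simp only [TauExt.snd_mul, TauExt.snd_mk, TauExt.fst_mk, TauExt.snd_add,
        TauExt.parity_grading_mk, parity_parity, zero_add, map_zero, mul_zero,
        add_zero]
      induction f using homogeneous_induction (M.par U) with
      | add a b ha hb => rw [add_mul, hD.loc_add, ha, hb, map_add, hD.loc_add,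
          add_mul, add_mul]; abel
      | hom j f hf => rw [hD.loc_mul hf, zero_mul, sgn_zero, one_smul, add_comm]
  map_zero' := by
    have := hD.loc_algebraMap (U := U) 0
    rw [map_zero] at this
    ext
    · exact map_zero _
    · rfl
    · rfl
    · exact this
  map_add' f g := by
    ext
    · exact map_add _ _ _
    · exact (add_zero _).symm
    · exact (add_zero _).symm
    · exact hD.loc_add f g
  commutes' r := by
    rw [TauExt.algebraMap_eq, TauExt.algebraMap_eq]
    ext
    · exact (φ.pull U).commutes r
    · rfl
    · rfl
    · exact hD.loc_algebraMap r

theorem IsDerAlong.evenPull_mem (hD : IsDerAlong φ 0 D) {U : Opens M.carrier} {i : ZMod 2}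
    {a : M.sec U} (ha : a ∈ M.par U i) :
    hD.evenPull U a ∈ TauExt.grading (TauExt.grading (S.par (φ.pre U))) i := by
  refine ⟨⟨φ.pull_par U i a ha, zero_mem _⟩, zero_mem _, ?_⟩
  have := hD.loc_mem ha
  rw [zero_add] at this
  have e : i + 1 + 1 = i := by rw [add_assoc, show (1 : ZMod 2) + 1 = 0 from rfl, add_zero]
  change hD.loc a ∈ S.par (φ.pre U) (i + 1 + 1)
  rwa [e]

theorem IsDerAlong.evenPull_res (hD : IsDerAlong φ 0 D) {U V : Opens M.carrier} (h : U ≤ V)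
    (a : M.sec V) : hD.evenPull U (M.res h a) =
      TauExt.mk _
        (TauExt.map (S.res (φ.pre_mono h)) (S.res_parity (φ.pre_mono h)) (hD.evenPull V a).fst)
        (TauExt.map (S.res (φ.pre_mono h)) (S.res_parity (φ.pre_mono h)) (hD.evenPull V a).snd) :=
  TauExt.ext
    (TauExt.ext (φ.pull_res h a) (map_zero (S.res (φ.pre_mono h))).symm)
    (TauExt.ext (map_zero (S.res (φ.pre_mono h))).symm (hD.loc_res h a))

/-- The morphism `S × ℝ^{0|2} → M`, `f ↦ φ^* f + D(f) τ₁ τ₂`, for an even derivation `D` along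
`φ`. -/
noncomputable def IsDerAlong.evenFlow (hD : IsDerAlong φ 0 D) : Hom S.tau.tau M.toSuperSpace where
  base := φ.base
  pull := hD.evenPull
  pull_par _ _ _ ha := hD.evenPull_mem ha
  pull_res h a := hD.evenPull_res h a

/-- The pullback of functions under a morphism from `S × ℝ^{0|1}`. -/
noncomputable def tauStar {S M : SuperSpace.{u}} (k : Hom S.tau M) :
    M.Fn →ₐ[ℝ] TauExt (parity (S.par ⊤)) := k.star

/-- The pullback of functions under a morphism from `S × ℝ^{0|2}`. -/
noncomputable def tauTauStar {S M : SuperSpace.{u}} (k : Hom S.tau.tau M) :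
    M.Fn →ₐ[ℝ] TauExt (parity (TauExt.grading (S.par ⊤))) := k.star

theorem IsDerAlong.tauStar_oddFlow (hD : IsDerAlong φ 1 D) (F : M.Fn) :
    tauStar hD.oddFlow F = TauExt.mk _ (φ.star F) (parity (S.par ⊤) (D F)) :=
  congrArg (fun x : S.Fn => TauExt.mk _ (φ.star F) (parity (S.par ⊤) x)) (hD.loc_top F)

theorem IsDerAlong.tauTauStar_evenFlow (hD : IsDerAlong φ 0 D) (F : M.Fn) :
    tauTauStar hD.evenFlow F = TauExt.mk _ (TauExt.mk _ (φ.star F) 0) (TauExt.mk _ 0 (D F)) :=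
  congrArg (fun x : S.Fn => TauExt.mk _ (TauExt.mk _ (φ.star F) 0) (TauExt.mk _ 0 x))
    (hD.loc_top F)

end TauHom

/-- When the base maps are literally the same, pullbacks can be compared without transport between
section algebras. -/
theorem Hom.ext_of_pull {S M : SuperSpace.{u}} {f : C(S.carrier, M.carrier)}
    {p q : ∀ U : Opens M.carrier, M.sec U →ₐ[ℝ] S.sec (Opens.comap f U)}
    (h : ∀ U a, p U a = q U a) (hp hp' hq hq') :
    (⟨f, p, hp, hp'⟩ : Hom S M) = ⟨f, q, hq, hq'⟩ := by
  obtain rfl : p = q := funext fun U => AlgHom.ext (h U)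
  rfl

/-- The identity morphism. -/
def Hom.id (M : SuperSpace.{u}) : Hom M M where
  base := ContinuousMap.id _
  pull _ := AlgHom.id ℝ _
  pull_par _ _ _ ha := ha
  pull_res _ _ := rfl

section Tau

variable (M : SuperSpace.{u})

/-- The projection `A ↦ A[τ]`. -/
noncomputable def TauExt.incl {A : Type*} [Ring A] [Algebra ℝ A] (σ : A →ₐ[ℝ] A) :
    A →ₐ[ℝ] TauExt σ where
  toFun a := TauExt.mk σ a 0
  map_one' := rfl
  map_mul' a b := by ext <;> simp
  map_zero' := rfl
  map_add' a b := by ext <;> simp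
  commutes' r := (TauExt.algebraMap_eq r).symm

/-- The homomorphism `A[τ] → A`, `τ ↦ 0`. -/
noncomputable def TauExt.fstHom {A : Type*} [Ring A] [Algebra ℝ A] (σ : A →ₐ[ℝ] A) :
    TauExt σ →ₐ[ℝ] A where
  toFun a := a.fst
  map_one' := rfl
  map_mul' a b := rfl
  map_zero' := rfl
  map_add' a b := rfl
  commutes' r := by rw [TauExt.algebraMap_eq]; rfl

/-- The automorphism `τ ↦ -τ` of `A[τ]`. -/
noncomputable def TauExt.negTau {A : Type*} [Ring A] [Algebra ℝ A] (σ : A →ₐ[ℝ] A) :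
    TauExt σ →ₐ[ℝ] TauExt σ where
  toFun a := TauExt.mk σ a.fst (-a.snd)
  map_one' := by ext <;> simp
  map_mul' a b := by ext <;> simp [add_comm]
  map_zero' := by ext <;> simp
  map_add' a b := by ext <;> simp [add_comm]
  commutes' r := by rw [TauExt.algebraMap_eq]; ext <;> simp

theorem TauExt.negTau_parity {A : Type*} [Ring A] [Algebra ℝ A] (𝒜 : ZMod 2 → Submodule ℝ A)
    [GradedAlgebra 𝒜] (x : TauExt (parity 𝒜)) :
    TauExt.negTau (parity 𝒜) (parity (TauExt.grading 𝒜) x) =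
      parity (TauExt.grading 𝒜) (TauExt.negTau (parity 𝒜) x) := by
  induction x using homogeneous_induction (TauExt.grading 𝒜) with
  | add a b ha hb => simp only [map_add, ha, hb]
  | hom i a ha =>
    have : TauExt.negTau (parity 𝒜) a ∈ TauExt.grading 𝒜 i := ⟨ha.1, neg_mem ha.2⟩
    rw [parity_of_mem ha, parity_of_mem this, map_units_smul]

/-- The projection `M × ℝ^{0|1} → M`. -/
noncomputable def SuperSpace.tauProj : Hom M.tau M where
  base := ContinuousMap.id M.carrier
  pull U := TauExt.incl (parity (M.par U))
  pull_par _ _ _ ha := ⟨ha, zero_mem _⟩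
  pull_res {U _} h _ :=
    TauExt.ext (σ := parity (M.par U)) rfl (map_zero (M.res h)).symm

/-- The embedding `M → M × ℝ^{0|1}`. -/
noncomputable def SuperSpace.tauZero : Hom M M.tau where
  base := ContinuousMap.id M.carrier
  pull (U : Opens M.carrier) := TauExt.fstHom (parity (M.par U))
  pull_par _ _ _ ha := ha.1
  pull_res _ _ := rfl

/-- The automorphism `τᵢ ↦ -τᵢ` on local sections of `M × ℝ^{0|2}`. -/
noncomputable def SuperSpace.tauNegPull (U : Opens M.carrier) :
    TauExt (parity (TauExt.grading (M.par U))) →ₐ[ℝ] TauExt (parity (TauExt.grading (M.par U))) :=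
  (TauExt.negTau _).comp
    (TauExt.map (TauExt.negTau (parity (M.par U))) (TauExt.negTau_parity (M.par U)))

theorem SuperSpace.tauNegPull_mem {U : Opens M.carrier} {i : ZMod 2}
    {a : TauExt (parity (TauExt.grading (M.par U)))}
    (ha : a ∈ TauExt.grading (TauExt.grading (M.par U)) i) :
    M.tauNegPull U a ∈ TauExt.grading (TauExt.grading (M.par U)) i :=
  ⟨⟨ha.1.1, neg_mem ha.1.2⟩, neg_mem ha.2.1, neg_mem (neg_mem ha.2.2)⟩

theorem SuperSpace.tauNegPull_res {U V : Opens M.carrier} (h : U ≤ V)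
    (a : TauExt (parity (TauExt.grading (M.par V)))) :
    M.tauNegPull U (TauExt.mk _ (TauExt.map (M.res h) (M.res_parity h) a.fst)
      (TauExt.map (M.res h) (M.res_parity h) a.snd)) =
      TauExt.mk _ (TauExt.map (M.res h) (M.res_parity h) (M.tauNegPull V a).fst)
        (TauExt.map (M.res h) (M.res_parity h) (M.tauNegPull V a).snd) :=
  TauExt.ext
    (TauExt.ext rfl (map_neg (M.res h) _).symm)
    (TauExt.ext (map_neg (M.res h) _).symm
      ((congrArg Neg.neg (map_neg (M.res h) _).symm).trans (map_neg (M.res h) _).symm))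

/-- The automorphism `τᵢ ↦ -τᵢ` of `M × ℝ^{0|2}`. -/
noncomputable def SuperSpace.tauNeg : Hom M.tau.tau M.tau.tau where
  base := ContinuousMap.id M.carrier
  pull := M.tauNegPull
  pull_par _ _ _ ha := M.tauNegPull_mem ha
  pull_res h a := M.tauNegPull_res h a

end Tau

/-! ### Lifting derivations to a product by its universal property -/

section Product

variable {M N M₁ : SuperManifold.{u}} {π₁ : Hom M₁.toSuperSpace M.toSuperSpace}
  {π₂ : Hom M₁.toSuperSpace N.toSuperSpace}

theorem IsProduct.symm (h : IsProduct π₁ π₂) : IsProduct π₂ π₁ := fun S f g => by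
  obtain ⟨k, hk, hu⟩ := h S g f
  exact ⟨k, hk.symm, fun k' hk' => hu k' hk'.symm⟩

theorem IsProduct.hom_ext (h : IsProduct π₁ π₂) {S : SuperManifold.{u}}
    {k k' : Hom S.toSuperSpace M₁.toSuperSpace} (h₁ : π₁.comp k = π₁.comp k')
    (h₂ : π₂.comp k = π₂.comp k') : k = k' :=
  (h S (π₁.comp k') (π₂.comp k')).unique ⟨h₁, h₂⟩ ⟨rfl, rfl⟩

/-- Equality of morphisms concerns local sections, whereas `h` speaks of global functions; germs of
global functions bridge the gap. -/
theorem IsDerAlong.loc_pull_eq_zero {B : M₁.Fn →ₗ[ℝ] M₁.Fn} {i : ZMod 2}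
    (hB : IsDerAlong (Hom.id M₁.toSuperSpace) i B) (h : ∀ F, B (π₁.star F) = 0)
    (U : Opens M.carrier) (f : M.sec U) : hB.loc (π₁.pull U f) = 0 := by
  refine M₁.eq_of_local fun s hs => ?_
  obtain ⟨V, hV, F, hsV, hF⟩ := M.exists_germ f (x := π₁.base s) hs
  refine ⟨π₁.pre V, hsV, π₁.pre_mono hV, ?_⟩
  have := hB.res_loc (π₁.pre_mono hV) (F := π₁.star F) (f := π₁.pull U f) (by
    rw [π₁.res_star, hF, π₁.pull_res])
  rw [h F, map_zero] at this
  rw [map_zero]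
  exact this

theorem SuperSpace.IsDer.along_id {i : ZMod 2} {B : M₁.Fn →ₗ[ℝ] M₁.Fn} (hB : M₁.IsDer i B) :
    IsDerAlong (Hom.id M₁.toSuperSpace) i B := hB.comp_star (Hom.id _)

theorem comp_oddFlow {B : M₁.Fn →ₗ[ℝ] M₁.Fn} (hB : M₁.IsDer 1 B) (h : ∀ F, B (π₁.star F) = 0) :
    π₁.comp hB.along_id.oddFlow = π₁.comp (IsDer.zero 1).along_id.oddFlow := by
  refine Hom.ext_of_pull (fun U f => ?_) _ _ _ _
  refine TauExt.ext (σ := parity (M₁.par (π₁.pre U))) rfl ?_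
  exact congrArg (parity (M₁.par (π₁.pre U))) ((hB.along_id.loc_pull_eq_zero h U f).trans
    ((IsDer.zero 1).along_id.loc_pull_eq_zero (π₁ := π₁) (fun _ => rfl) U f).symm)

theorem comp_evenFlow {B : M₁.Fn →ₗ[ℝ] M₁.Fn} (hB : M₁.IsDer 0 B) (h : ∀ F, B (π₁.star F) = 0) :
    π₁.comp hB.along_id.evenFlow = π₁.comp (IsDer.zero 0).along_id.evenFlow := by
  refine Hom.ext_of_pull (fun U f => ?_) _ _ _ _
  refine TauExt.ext (σ := parity (TauExt.grading (M₁.par (π₁.pre U)))) rfl ?_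
  refine TauExt.ext (σ := parity (M₁.par (π₁.pre U))) rfl ?_
  exact (hB.along_id.loc_pull_eq_zero h U f).trans
    ((IsDer.zero 0).along_id.loc_pull_eq_zero (π₁ := π₁) (fun _ => rfl) U f).symm

/-- The infinitesimal flows of `B` and of 0 have the same compositions with both projections, so
they coincide. Their top coefficients in the odd parameters are `B` (up to parity) and 0. -/
theorem IsProduct.isDer_eq_zero (h : IsProduct π₁ π₂) {i : ZMod 2} {B : M₁.Fn →ₗ[ℝ] M₁.Fn}
    (hB : M₁.IsDer i B) (h₁ : ∀ F, B (π₁.star F) = 0) (h₂ : ∀ F, B (π₂.star F) = 0) : B = 0 := by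
  ext F
  rcases zmod_two_cases i with rfl | rfl
  · have e := h.hom_ext (S := M₁.tau.tau) (comp_evenFlow hB h₁) (comp_evenFlow hB h₂)
    have e' := congrArg (fun k => TauExt.snd (TauExt.snd (tauTauStar k F))) e
    simpa [IsDerAlong.tauTauStar_evenFlow] using e'
  · have e := h.hom_ext (S := M₁.tau) (comp_oddFlow hB h₁) (comp_oddFlow hB h₂)
    have e' := congrArg (fun k => parity (M₁.par ⊤) (TauExt.snd (tauStar k F))) e
    simpa [IsDerAlong.tauStar_oddFlow, parity_parity] using e'

/-- The flow of `X` along π₁ and the constant flow along π₂ combine to a morphism k from M₁ ×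
ℝ^{0|1}. The τ-coefficient of k^* is the lift. -/
theorem IsProduct.exists_isDer_one (h : IsProduct π₁ π₂) {X : M.Fn →ₗ[ℝ] M.Fn}
    (hX : M.IsDer 1 X) : ∃ B : M₁.Fn →ₗ[ℝ] M₁.Fn, M₁.IsDer 1 B ∧
      (∀ F, B (π₁.star F) = π₁.star (X F)) ∧ ∀ F, B (π₂.star F) = 0 := by
  obtain ⟨k, ⟨hk₁, hk₂⟩, -⟩ := h M₁.tau (hX.comp_star π₁).oddFlow (π₂.comp M₁.tauProj)
  -- At τ = 0 both compositions with the projections are the projections themselves, so uniqueness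
  -- gives the identity.
  have hz : k.comp M₁.tauZero = Hom.id M₁.toSuperSpace := by
    refine h.hom_ext (S := M₁) ?_ ?_
    · change (π₁.comp k).comp M₁.tauZero = π₁
      rw [hk₁]; rfl
    · change (π₂.comp k).comp M₁.tauZero = π₂
      rw [hk₂]; rfl
  let K := tauStar k
  have hfst : ∀ F, (K F).fst = F := fun F =>
    congrArg (fun k : Hom M₁.toSuperSpace M₁.toSuperSpace => k.star F) hz
  have hK : ∀ i F, F ∈ M₁.FnDeg i → K F ∈ TauExt.grading (M₁.par ⊤) i := fun i F hF =>
    k.star_mem hF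
  let B : M₁.Fn →ₗ[ℝ] M₁.Fn :=
    { toFun := fun F => parity (M₁.par ⊤) (K F).snd
      map_add' := fun F G => by simp
      map_smul' := fun r F => by simp }
  have hB : ∀ F, B F = parity (M₁.par ⊤) (K F).snd := fun _ => rfl
  refine ⟨B, ⟨fun j a ha => ?_, fun j a b ha => ?_⟩, fun F => ?_, fun F => ?_⟩
  · rw [hB, parity_of_mem (hK j a ha).2, add_comm]
    exact units_smul_mem _ (hK j a ha).2
  · simp only [hB, map_mul, TauExt.snd_mul, hfst, map_add, parity_parity]
    rw [parity_of_mem ha, units_smul_mul_assoc, one_mul, add_comm]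
  · have e : K (π₁.star F) = tauStar (hX.comp_star π₁).oddFlow F :=
      congrArg (fun k => tauStar k F) hk₁
    rw [hB, e, IsDerAlong.tauStar_oddFlow, TauExt.snd_mk, parity_parity]
    rfl
  · have e : K (π₂.star F) = tauStar (π₂.comp M₁.tauProj) F := congrArg (fun k => tauStar k F) hk₂
    rw [hB, e]
    exact map_zero (parity (M₁.par ⊤))

theorem eq_zero_of_neg_eq {A : Type*} [AddCommGroup A] [Module ℝ A] {a : A} (h : -a = a) :
    a = 0 := by
  have : (2 : ℝ) • a = 0 := by rw [two_smul]; nth_rw 1 [← h]; simp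
  exact (smul_eq_zero.1 this).resolve_left two_ne_zero

/-- As in the odd case, the lift is now the τ₁τ₂-coefficient. It is a derivation only if the
coefficients of τ₁ and τ₂ alone do not interfere, so these are shown to vanish by symmetry. -/
theorem IsProduct.exists_isDer_zero (h : IsProduct π₁ π₂) {X : M.Fn →ₗ[ℝ] M.Fn}
    (hX : M.IsDer 0 X) : ∃ B : M₁.Fn →ₗ[ℝ] M₁.Fn, M₁.IsDer 0 B ∧
      (∀ F, B (π₁.star F) = π₁.star (X F)) ∧ ∀ F, B (π₂.star F) = 0 := by
  obtain ⟨k, ⟨hk₁, hk₂⟩, -⟩ := h M₁.tau.tau (hX.comp_star π₁).evenFlow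
    (π₂.comp (M₁.tauProj.comp M₁.tau.tauProj))
  have hz : k.comp (M₁.tau.tauZero.comp M₁.tauZero) = Hom.id M₁.toSuperSpace := by
    refine h.hom_ext (S := M₁) ?_ ?_
    · change (π₁.comp k).comp (M₁.tau.tauZero.comp M₁.tauZero) = π₁
      rw [hk₁]; rfl
    · change (π₂.comp k).comp (M₁.tau.tauZero.comp M₁.tauZero) = π₂
      rw [hk₂]; rfl
  -- The prescribed compositions involve only 1 and τ₁τ₂, so they are invariant under τᵢ ↦ −τᵢ. By
  -- uniqueness k is invariant too, which kills its linear terms in τ₁ and τ₂.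
  have hn : k.comp M₁.tauNeg = k := by
    refine h.hom_ext (S := M₁.tau.tau) ?_ ?_
    · change (π₁.comp k).comp M₁.tauNeg = π₁.comp k
      rw [hk₁]
      refine Hom.ext_of_pull (fun U f => ?_) _ _ _ _
      refine TauExt.ext (σ := parity (TauExt.grading (M₁.par (π₁.pre U))))
        (TauExt.ext (σ := parity (M₁.par (π₁.pre U))) rfl ?_)
        (TauExt.ext (σ := parity (M₁.par (π₁.pre U))) ?_ ?_)
      · exact neg_zero (G := M₁.sec (π₁.pre U))
      · exact neg_zero (G := M₁.sec (π₁.pre U))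
      · exact neg_neg (G := M₁.sec (π₁.pre U)) _
    · change (π₂.comp k).comp M₁.tauNeg = π₂.comp k
      rw [hk₂]
      refine Hom.ext_of_pull (fun U f => ?_) _ _ _ _
      refine TauExt.ext (σ := parity (TauExt.grading (M₁.par (π₂.pre U))))
        (TauExt.ext (σ := parity (M₁.par (π₂.pre U))) rfl ?_)
        (TauExt.ext (σ := parity (M₁.par (π₂.pre U))) ?_ ?_)
      · exact neg_zero (G := M₁.sec (π₂.pre U))
      · exact neg_zero (G := M₁.sec (π₂.pre U))
      · exact neg_neg (G := M₁.sec (π₂.pre U)) _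
  let K := tauTauStar k
  have hfst : ∀ F, (K F).fst.fst = F := fun F =>
    congrArg (fun k : Hom M₁.toSuperSpace M₁.toSuperSpace => k.star F) hz
  have hneg : ∀ F, M₁.tauNegPull ⊤ (K F) = K F := fun F =>
    congrArg (fun k : Hom M₁.tau.tau.toSuperSpace M₁.toSuperSpace => k.star F) hn
  have h₁ : ∀ F, (K F).fst = TauExt.mk _ F 0 := fun F => TauExt.ext (hfst F)
    (eq_zero_of_neg_eq (congrArg (fun x => TauExt.snd (TauExt.fst x)) (hneg F)))
  have h₂ : ∀ F, (K F).snd.fst = 0 := fun F =>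
    eq_zero_of_neg_eq (congrArg (fun x => TauExt.fst (TauExt.snd x)) (hneg F))
  have hK : ∀ i F, F ∈ M₁.FnDeg i → K F ∈ TauExt.grading (TauExt.grading (M₁.par ⊤)) i :=
    fun i F hF => k.star_mem hF
  let B : M₁.Fn →ₗ[ℝ] M₁.Fn :=
    { toFun := fun F => (K F).snd.snd
      map_add' := fun F G => by simp
      map_smul' := fun r F => by simp }
  have hB : ∀ F, B F = (K F).snd.snd := fun _ => rfl
  refine ⟨B, ⟨fun j a ha => ?_, fun j a b ha => ?_⟩, fun F => ?_, fun F => ?_⟩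
  · have := (hK j a ha).2.2
    rwa [add_assoc, show (1 : ZMod 2) + 1 = 0 from rfl, add_zero, ← zero_add j] at this
  · simp only [hB, map_mul, TauExt.snd_mul, TauExt.snd_add, h₁, h₂, TauExt.parity_grading_mk,
      TauExt.fst_mk, TauExt.snd_mk, parity_parity, zero_mul, mul_zero, map_zero, add_zero, zero_add,
      uzpow_zero, one_smul]
    rw [add_comm]
  · have e : K (π₁.star F) = tauTauStar (hX.comp_star π₁).evenFlow F :=
      congrArg (fun k => tauTauStar k F) hk₁
    rw [hB, e, IsDerAlong.tauTauStar_evenFlow]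
    rfl
  · have e : K (π₂.star F) = tauTauStar (π₂.comp (M₁.tauProj.comp M₁.tau.tauProj)) F :=
      congrArg (fun k => tauTauStar k F) hk₂
    rw [hB, e]
    rfl

theorem IsProduct.exists_isDer (h : IsProduct π₁ π₂) {i : ZMod 2} {X : M.Fn →ₗ[ℝ] M.Fn}
    (hX : M.IsDer i X) : ∃ B : M₁.Fn →ₗ[ℝ] M₁.Fn, M₁.IsDer i B ∧
      (∀ F, B (π₁.star F) = π₁.star (X F)) ∧ ∀ F, B (π₂.star F) = 0 := by
  rcases zmod_two_cases i with rfl | rfl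
  · exact h.exists_isDer_zero hX
  · exact h.exists_isDer_one hX

end Product

/-! ### Hadamard's lemma -/

section Hadamard

open MeasureTheory Set

/-- Smooth dependence on parameters of the integral over the unit interval. -/
theorem contDiff_integral_unit {P : Type*} [NormedAddCommGroup P] [NormedSpace ℝ P]
    {F : P × ℝ → ℝ} (hF : ContDiff ℝ ∞ F) :
    ContDiff ℝ ∞ fun p => ∫ t in (0 : ℝ)..1, F (p, t) := by
  -- The bump is 1 on [−1, 0], so the integral is the value at 0 of the convolution of the indicator
  -- of (0, 1] with κ(t) F(p, −t), and the latter has compact support in t.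
  let κ : ContDiffBump (0 : ℝ) := ⟨2, 3, by norm_num, by norm_num⟩
  have hκ : ContDiff ℝ ∞ κ := κ.contDiff
  have key := contDiffOn_convolution_right_with_param_comp (𝕜 := ℝ) (n := ⊤) (μ := volume)
    (ContinuousLinearMap.mul ℝ ℝ) (s := (univ : Set P)) (v := fun _ => (0 : ℝ)) contDiffOn_const
    (f := indicator (Ioc (0 : ℝ) 1) 1) (g := fun p t => κ t * F (p, -t))
    (k := Metric.closedBall 0 3) isOpen_univ (isCompact_closedBall _ _)
    (fun p t _ ht => by
      have : κ t = 0 := κ.zero_of_le_dist (by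
        rw [Metric.mem_closedBall, not_le] at ht
        exact ht.le)
      rw [this, zero_mul])
    ((integrable_indicator_iff measurableSet_Ioc).2
      (integrableOn_const (by simp) (by simp))).locallyIntegrable
    (by
      refine ContDiff.contDiffOn ?_
      exact (hκ.comp contDiff_snd).mul (hF.comp (contDiff_fst.prodMk contDiff_snd.neg)))
  rw [contDiffOn_univ] at key
  convert key using 2 with p
  rw [intervalIntegral.integral_of_le zero_le_one, ← integral_indicator measurableSet_Ioc]
  refine integral_congr_ae (Filter.Eventually.of_forall fun t => ?_)
  by_cases ht : t ∈ Ioc (0 : ℝ) 1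
  · have : κ (-t) = 1 := κ.one_of_mem_closedBall (by
      rw [Metric.mem_closedBall, dist_zero_right, norm_neg, Real.norm_eq_abs, abs_of_pos ht.1]
      exact ht.2.trans (by norm_num))
    simp [ht, this]
  · simp [ht]

/-- **Hadamard's lemma**. -/
theorem exists_hadamard {m : ℕ} {f : EuclideanSpace ℝ (Fin m) → ℝ} (hf : ContDiff ℝ ∞ f)
    (p : EuclideanSpace ℝ (Fin m)) :
    ∃ g : Fin m → EuclideanSpace ℝ (Fin m) → ℝ, (∀ i, ContDiff ℝ ∞ (g i)) ∧
      ∀ x, f x = f p + ∑ i, (x i - p i) * g i x := by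
  have hline : ∀ x : EuclideanSpace ℝ (Fin m), ∀ t : ℝ,
      HasDerivAt (fun t : ℝ => p + t • (x - p)) (x - p) t := fun x t => by
    simpa using ((hasDerivAt_id t).smul_const (x - p)).const_add p
  have hf' : ContDiff ℝ ∞ (fderiv ℝ f) := hf.fderiv_right (by simp)
  have hpath : ContDiff ℝ ∞ fun q : EuclideanSpace ℝ (Fin m) × ℝ => p + q.2 • (q.1 - p) :=
    contDiff_const.add (contDiff_snd.smul (contDiff_fst.sub contDiff_const))
  -- The coefficients are the partial derivatives averaged over the segment from `p` to `x`; the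
  -- identity is the fundamental theorem of calculus along that segment.
  refine ⟨fun i x => ∫ t in (0 : ℝ)..1,
    fderiv ℝ f (p + t • (x - p)) (EuclideanSpace.single i 1), fun i => ?_, fun x => ?_⟩
  · exact contDiff_integral_unit
      (F := fun q => fderiv ℝ f (p + q.2 • (q.1 - p)) (EuclideanSpace.single i 1))
      ((hf'.comp hpath).clm_apply contDiff_const)
  · have hcont : ∀ v, Continuous fun t : ℝ => fderiv ℝ f (p + t • (x - p)) v := fun v =>
      (((hf'.comp hpath).clm_apply contDiff_const).continuous).comp
        (continuous_const.prodMk continuous_id : Continuous fun t : ℝ => (x, t))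
    have hd : ∀ t ∈ uIcc (0 : ℝ) 1, HasDerivAt (fun t : ℝ => f (p + t • (x - p)))
        (fderiv ℝ f (p + t • (x - p)) (x - p)) t := fun t _ =>
      ((hf.differentiable (by simp)).differentiableAt.hasFDerivAt).comp_hasDerivAt t (hline x t)
    have h1 := intervalIntegral.integral_eq_sub_of_hasDerivAt hd
      ((hcont _).intervalIntegrable _ _)
    simp only [one_smul, zero_smul, add_zero, add_sub_cancel] at h1
    have hx : x - p = ∑ i, (x i - p i) • EuclideanSpace.single i (1 : ℝ) := by
      ext j
      simp [Finset.sum_apply, Pi.single_apply]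
    have h2 : ∫ t in (0 : ℝ)..1, fderiv ℝ f (p + t • (x - p)) (x - p) =
        ∑ i, (x i - p i) * ∫ t in (0 : ℝ)..1,
          fderiv ℝ f (p + t • (x - p)) (EuclideanSpace.single i 1) := by
      rw [← Finset.sum_congr rfl fun i _ => intervalIntegral.integral_const_mul _ _,
        ← intervalIntegral.integral_finsetSum]
      · refine intervalIntegral.integral_congr fun t _ => ?_
        have hL : ∀ L : EuclideanSpace ℝ (Fin m) →L[ℝ] ℝ,
            L (x - p) = ∑ i, (x i - p i) * L (EuclideanSpace.single i 1) := fun L => by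
          rw [hx, map_sum]
          simp
        exact hL _
      · intro i _
        exact ((hcont _).const_smul (x i - p i)).intervalIntegrable _ _
    rw [← h2, h1]
    ring

/-- A smooth function of one variable that equals `1 / (t - r)` near `0`. -/
theorem exists_smooth_inv_sub {r : ℝ} (hr : r ≠ 0) :
    ∃ q : ℝ → ℝ, ContDiff ℝ ∞ q ∧ ∀ᶠ t in nhds (0 : ℝ), (t - r) * q t = 1 := by
  have hr' : 0 < |r| := abs_pos.2 hr
  -- The radii are chosen so that κ is 1 near 0 and vanishes near the pole `r`.
  let κ : ContDiffBump (0 : ℝ) := ⟨|r| / 4, |r| / 2, by positivity, by linarith⟩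
  have hκ : ContDiff ℝ ∞ κ := κ.contDiff
  refine ⟨fun t => κ t / (t - r), contDiff_iff_contDiffAt.2 fun t => ?_, ?_⟩
  · by_cases ht : t = r
    · subst ht
      have : (fun s => κ s / (s - t)) =ᶠ[nhds t] fun _ => 0 := by
        filter_upwards [(isOpen_lt continuous_const continuous_abs : IsOpen {s : ℝ | |t| / 2 < |s|}
          ).mem_nhds (by change |t| / 2 < |t|; linarith)] with s hs
        rw [κ.zero_of_le_dist (by rw [dist_zero_right]; exact hs.le), zero_div]
      exact contDiffAt_const.congr_of_eventuallyEq this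
    · exact hκ.contDiffAt.div (contDiffAt_id.sub contDiffAt_const) (sub_ne_zero.2 ht)
  · filter_upwards [Metric.closedBall_mem_nhds (0 : ℝ) (show 0 < |r| / 4 by positivity)] with t ht
    rw [κ.one_of_mem_closedBall ht]
    refine mul_one_div_cancel (sub_ne_zero.2 ?_)
    rintro rfl
    rw [mem_closedBall_zero_iff, Real.norm_eq_abs] at ht
    linarith

end Hadamard

/-! ### Nilpotency of the augmentation ideal -/

section Nilpotent

/-- The augmentation ideal of an exterior algebra, as a subspace. -/
noncomputable def augIdeal (n : ℕ) : Submodule ℝ (ExteriorAlgebra ℝ (Fin n → ℝ)) :=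
  LinearMap.ker (ExteriorAlgebra.algebraMapInv (R := ℝ) (M := Fin n → ℝ)).toLinearMap

/-- The homomorphism `Λℝⁿ⁺¹ → Λℝⁿ` that sends the first generator to `0`. -/
noncomputable def exteriorTail (n : ℕ) :
    ExteriorAlgebra ℝ (Fin (n + 1) → ℝ) →ₐ[ℝ] ExteriorAlgebra ℝ (Fin n → ℝ) :=
  (TauExt.fstHom _).comp (exteriorEquivTau n).toAlgHom

/-- The kernel of the tail map consists of the multiples bτ, and τ² = 0. -/
theorem mul_eq_zero_of_exteriorTail {n : ℕ} {x y : ExteriorAlgebra ℝ (Fin (n + 1) → ℝ)}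
    (hx : exteriorTail n x = 0) (hy : exteriorTail n y = 0) : x * y = 0 := by
  have hx' : (exteriorEquivTau n x).fst = 0 := hx
  have hy' : (exteriorEquivTau n y).fst = 0 := hy
  apply (exteriorEquivTau n).injective
  rw [map_mul, map_zero]
  ext
  · simp [hx']
  · simp [hx', hy']

theorem algebraMapInv_exteriorTail {n : ℕ} (x : ExteriorAlgebra ℝ (Fin (n + 1) → ℝ)) :
    ExteriorAlgebra.algebraMapInv (exteriorTail n x) = ExteriorAlgebra.algebraMapInv x := by
  have : (ExteriorAlgebra.algebraMapInv.comp (exteriorTail n)) =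
      ExteriorAlgebra.algebraMapInv (R := ℝ) (M := Fin (n + 1) → ℝ) := by
    refine ExteriorAlgebra.hom_ext (LinearMap.ext fun v => ?_)
    have : exteriorTail n (ExteriorAlgebra.ι ℝ v) = ExteriorAlgebra.ι ℝ fun i => v i.succ :=
      congrArg TauExt.fst (exteriorToTau_ι n v)
    simp [this, ExteriorAlgebra.algebraMapInv]
  exact DFunLike.congr_fun this x

/-- The augmentation ideal of `Λℝⁿ` is nilpotent. -/
theorem exists_augIdeal_pow_eq_bot (n : ℕ) : ∃ N, augIdeal n ^ N = ⊥ := by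
  induction n with
  | zero =>
    refine ⟨1, ?_⟩
    rw [pow_one, eq_bot_iff]
    intro x hx
    have key : ∀ a : ExteriorAlgebra ℝ (Fin 0 → ℝ),
        a = algebraMap ℝ _ (ExteriorAlgebra.algebraMapInv a) := fun a => by
      induction a using ExteriorAlgebra.induction with
      | algebraMap r => simp
      | ι v => rw [show v = 0 from Subsingleton.elim _ _, map_zero, map_zero, map_zero]
      | mul a b ha hb => rw [map_mul, map_mul, ← ha, ← hb]
      | add a b ha hb => rw [map_add, map_add, ← ha, ← hb]
    have hx' : ExteriorAlgebra.algebraMapInv x = 0 := hx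
    rw [Submodule.mem_bot, key x, hx', map_zero]
  | succ n ih =>
    obtain ⟨N, hN⟩ := ih
    refine ⟨N + N, ?_⟩
    have hle : (augIdeal (n + 1)).map (exteriorTail n).toLinearMap ≤ augIdeal n := by
      rintro _ ⟨x, hx, rfl⟩
      exact (algebraMapInv_exteriorTail x).trans hx
    have h0 : ∀ x ∈ augIdeal (n + 1) ^ N, exteriorTail n x = 0 := fun x hx => by
      have h := Submodule.mem_map_of_mem (f := (exteriorTail n).toLinearMap) hx
      rw [Submodule.map_pow] at h
      have h' := pow_le_pow_left' hle N h
      rw [hN] at h'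
      exact h'
    -- The N-th power lands in the kernel of the tail map, where products of two elements vanish;
    -- hence the exponent doubles.
    rw [pow_add, eq_bot_iff, Submodule.mul_le]
    intro x hx y hy
    rw [mul_eq_zero_of_exteriorTail (h0 x hx) (h0 y hy)]
    exact zero_mem _

end Nilpotent

/-! ### Evaluation of superfunctions at points -/

section Eval

variable {m n : ℕ} {W : Opens (EuclideanSpace ℝ (Fin m))}

/-- Evaluation of the coefficients of a section of the standard superdomain at a point. -/
noncomputable def modelEval (q : W) : ModelSec m n W →ₐ[ℝ] ExteriorAlgebra ℝ (Fin n → ℝ) :=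
  Algebra.TensorProduct.lift
    ((Algebra.ofId ℝ (ExteriorAlgebra ℝ (Fin n → ℝ))).comp
      ((Pi.evalAlgHom ℝ (fun _ : W => ℝ) q).comp ContMDiffMap.coeFnAlgHom))
    (AlgHom.id ℝ _) fun c a => show Commute (algebraMap ℝ _ (c q)) a from Algebra.commutes (c q) a

theorem modelEval_tmul (q : W) (c : SmoothSec m W) (a : ExteriorAlgebra ℝ (Fin n → ℝ)) :
    modelEval q (c ⊗ₜ a) = c q • a := by
  rw [Algebra.smul_def]
  rfl

/-- The coefficients in a basis of the exterior algebra are ordinary smooth functions, which are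
determined by their values. -/
theorem eq_zero_of_modelEval {x : ModelSec m n W} (h : ∀ q : W, modelEval q x = 0) : x = 0 := by
  let B := Module.Free.chooseBasis ℝ (ExteriorAlgebra ℝ (Fin n → ℝ))
  have key : ∀ (x : ModelSec m n W) (q : W) i,
      (Algebra.TensorProduct.basis (SmoothSec m W) B).repr x i q = B.repr (modelEval q x) i := by
    intro x q i
    induction x using ModelSec.induction with
    | zero => simp
    | tmul c a =>
      rw [modelEval_tmul, Algebra.TensorProduct.basis_repr_tmul]
      simp only [Finsupp.smul_apply, map_smul, smul_eq_mul]
      rfl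
    | add x y hx hy =>
      rw [map_add, map_add, map_add, Finsupp.add_apply, Finsupp.add_apply, ← hx, ← hy]
      rfl
  apply (Algebra.TensorProduct.basis (SmoothSec m W) B).repr.injective
  ext i q
  rw [key, h q]
  simp

theorem modelEval_modelRes {V : Opens (EuclideanSpace ℝ (Fin m))} (h : V ≤ W) (q : V)
    (x : ModelSec m n W) : modelEval q (modelRes n h x) = modelEval ⟨q, h q.2⟩ x := by
  induction x using ModelSec.induction with
  | zero => simp
  | tmul c a =>
    rw [modelEval_tmul]
    exact modelEval_tmul q _ a
  | add x y hx hy => simp only [map_add, hx, hy]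

end Eval

/-! ### Partial derivatives on open sets -/

section Partial

variable {m : ℕ} {W : Opens (EuclideanSpace ℝ (Fin m))}

open Classical in
/-- The extension by zero of a function on an open subset of `ℝᵐ`. -/
noncomputable def zeroExt (f : SmoothSec m W) (x : EuclideanSpace ℝ (Fin m)) : ℝ :=
  if h : x ∈ W then f ⟨x, h⟩ else 0

theorem zeroExt_coe (f : SmoothSec m W) (x : W) : zeroExt f x = f x := by
  simp [zeroExt, x.2]

theorem contDiffAt_zeroExt (f : SmoothSec m W) {x : EuclideanSpace ℝ (Fin m)} (hx : x ∈ W) :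
    ContDiffAt ℝ ∞ (zeroExt f) x := by
  rw [← contMDiffAt_iff_contDiffAt]
  refine (contMDiffAt_subtype_iff (x := (⟨x, hx⟩ : W))).1 ?_
  have : (fun y : W => zeroExt f y) = f := funext fun y => zeroExt_coe f y
  rw [this]
  exact f.contMDiff.contMDiffAt

/-- The smooth section given by a function that is smooth at the points of `W`. -/
noncomputable def smoothOfAt (F : EuclideanSpace ℝ (Fin m) → ℝ)
    (hF : ∀ x ∈ W, ContDiffAt ℝ ∞ F x) : SmoothSec m W :=
  ⟨fun x => F x, fun x => contMDiffAt_subtype_iff.2 (hF x x.2).contMDiffAt⟩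

theorem contDiffAt_fderiv_zeroExt (f : SmoothSec m W) (j : Fin m)
    {x : EuclideanSpace ℝ (Fin m)} (hx : x ∈ W) :
    ContDiffAt ℝ ∞ (fun y => fderiv ℝ (zeroExt f) y (EuclideanSpace.single j 1)) x :=
  ((contDiffAt_zeroExt f hx).fderiv_right (by simp)).clm_apply contDiffAt_const

/-- The partial derivative of smooth functions on an open subset of `ℝᵐ`. -/
noncomputable def partialDeriv (j : Fin m) : SmoothSec m W →ₗ[ℝ] SmoothSec m W where
  toFun f := smoothOfAt _ fun _ hx => contDiffAt_fderiv_zeroExt f j hx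
  map_add' f g := by
    ext x
    have e : zeroExt (f + g) = zeroExt f + zeroExt g := by
      ext y
      by_cases hy : y ∈ W <;> simp [zeroExt, hy]
    change fderiv ℝ (zeroExt (f + g)) x _ = fderiv ℝ (zeroExt f) x _ + fderiv ℝ (zeroExt g) x _
    rw [e, fderiv_add ((contDiffAt_zeroExt f x.2).differentiableAt (by simp))
      ((contDiffAt_zeroExt g x.2).differentiableAt (by simp))]
    rfl
  map_smul' r f := by
    ext x
    have e : zeroExt (r • f) = r • zeroExt f := by
      ext y
      by_cases hy : y ∈ W <;> simp [zeroExt, hy]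
    change fderiv ℝ (zeroExt (r • f)) x _ = r • fderiv ℝ (zeroExt f) x _
    rw [e, fderiv_const_smul ((contDiffAt_zeroExt f x.2).differentiableAt (by simp))]
    rfl

theorem partialDeriv_mul (j : Fin m) (f g : SmoothSec m W) :
    partialDeriv j (f * g) = partialDeriv j f * g + f * partialDeriv j g := by
  ext x
  have e : zeroExt (f * g) = zeroExt f * zeroExt g := by
    ext y
    by_cases hy : y ∈ W <;> simp [zeroExt, hy]
  change fderiv ℝ (zeroExt (f * g)) x _ = fderiv ℝ (zeroExt f) x _ * g x +
    f x * fderiv ℝ (zeroExt g) x _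
  rw [e, fderiv_mul ((contDiffAt_zeroExt f x.2).differentiableAt (by simp))
    ((contDiffAt_zeroExt g x.2).differentiableAt (by simp))]
  simp only [add_apply, smul_apply, smul_eq_mul,
    zeroExt_coe]
  ring

theorem contDiff_coord (j : Fin m) : ContDiff ℝ ∞ fun x : EuclideanSpace ℝ (Fin m) => x j :=
  (EuclideanSpace.proj (𝕜 := ℝ) j).contDiff

theorem partialDeriv_coord (i j : Fin m) :
    partialDeriv i (smoothOf W (fun x => x j) (contDiff_coord j)) = if i = j then 1 else 0 := by
  ext x
  have e : zeroExt (smoothOf W (fun x => x j) (contDiff_coord j)) =ᶠ[nhds x.1]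
      EuclideanSpace.proj (𝕜 := ℝ) j := by
    filter_upwards [W.2.mem_nhds x.2] with y hy
    exact zeroExt_coe _ ⟨y, hy⟩
  change fderiv ℝ (zeroExt _) x.1 _ = _
  rw [e.fderiv_eq, ContinuousLinearMap.fderiv]
  split_ifs with h
  · subst h; simp
  · simp [Ne.symm h]

end Partial

/-! ### Coordinate derivations of the standard superdomain -/

section ModelDer

open CliffordAlgebra

variable {m n : ℕ} {W : Opens (EuclideanSpace ℝ (Fin m))}

/-- `Δ` is a derivation of degree `k` of the algebra `C^∞(W) ⊗ Λ ℝⁿ`. -/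
structure IsModelDer (k : ZMod 2) (Δ : ModelSec m n W →ₗ[ℝ] ModelSec m n W) : Prop where
  deg : ∀ (j : ZMod 2) (a : ModelSec m n W), a ∈ modelPar m n W j → Δ a ∈ modelPar m n W (k + j)
  leibniz : ∀ (j : ZMod 2) (a b : ModelSec m n W), a ∈ modelPar m n W j →
    Δ (a * b) = Δ a * b + sgn (k * j) • (a * Δ b)

/-- The even coordinate derivations of the standard superdomain. -/
noncomputable def evenPartial (j : Fin m) : ModelSec m n W →ₗ[ℝ] ModelSec m n W :=
  TensorProduct.map (partialDeriv j) LinearMap.id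

theorem isModelDer_evenPartial (j : Fin m) :
    IsModelDer 0 (evenPartial j : ModelSec m n W →ₗ[ℝ] ModelSec m n W) where
  deg k a ha := by
    rw [zero_add, mem_modelPar_iff, ← map_units_smul, ← modelParity_of_mem ha]
    clear ha
    induction a using ModelSec.induction with
    | zero => simp
    | tmul c a => rfl
    | add x y hx hy => simp only [map_add, hx, hy]
  leibniz k a b ha := by
    clear ha
    rw [zero_mul, sgn_zero, one_smul]
    induction a using ModelSec.induction with
    | zero => simp
    | add x y hx hy => simp only [map_add, add_mul, hx, hy]; abel
    | tmul c a =>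
      induction b using ModelSec.induction with
      | zero => simp
      | add x y hx hy => simp only [map_add, mul_add, hx, hy]; abel
      | tmul c' a' =>
        have e : ∀ (c : SmoothSec m W) (a : ExteriorAlgebra ℝ (Fin n → ℝ)),
          evenPartial j (c ⊗ₜ a) = partialDeriv j c ⊗ₜ a := fun _ _ => rfl
        simp only [Algebra.TensorProduct.tmul_mul_tmul, e, partialDeriv_mul, TensorProduct.add_tmul]

/-- Contraction is an antiderivation by its rule on generators and induction. This is the Leibniz
rule of the odd coordinate derivations. -/
theorem contractLeft_mul (d : Module.Dual ℝ (Fin n → ℝ)) (a b : ExteriorAlgebra ℝ (Fin n → ℝ)) :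
    contractLeft (Q := (0 : QuadraticForm ℝ (Fin n → ℝ))) d (a * b) =
      contractLeft (Q := (0 : QuadraticForm ℝ (Fin n → ℝ))) d a * b +
        involute a * contractLeft (Q := (0 : QuadraticForm ℝ (Fin n → ℝ))) d b := by
  induction a using ExteriorAlgebra.induction generalizing b with
  | algebraMap r =>
    rw [contractLeft_algebraMap_mul, contractLeft_algebraMap]
    simp
  | ι v =>
    have h : involute (ExteriorAlgebra.ι ℝ v) = -(ExteriorAlgebra.ι ℝ v) := involute_ι _
    have h' : contractLeft (Q := (0 : QuadraticForm ℝ (Fin n → ℝ))) d (ExteriorAlgebra.ι ℝ v) =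
      algebraMap ℝ _ (d v) := contractLeft_ι _ _ _
    rw [h, h', ← Algebra.smul_def, neg_mul, ← sub_eq_add_neg]
    exact contractLeft_ι_mul _ _ _
  | mul a a' ha ha' =>
    rw [mul_assoc, ha, ha', ha, map_mul]
    simp only [mul_add, add_mul, mul_assoc, add_assoc]
  | add a a' ha ha' =>
    rw [add_mul, map_add, ha, ha', map_add, map_add, add_mul, add_mul]
    abel

theorem involute_contractLeft (d : Module.Dual ℝ (Fin n → ℝ))
    (a : ExteriorAlgebra ℝ (Fin n → ℝ)) :
    involute (contractLeft (Q := (0 : QuadraticForm ℝ (Fin n → ℝ))) d a) =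
      -contractLeft (Q := (0 : QuadraticForm ℝ (Fin n → ℝ))) d (involute a) := by
  induction a using ExteriorAlgebra.induction with
  | algebraMap r =>
    rw [contractLeft_algebraMap, AlgHom.commutes, contractLeft_algebraMap]
    simp
  | ι v =>
    have h : involute (ExteriorAlgebra.ι ℝ v) = -(ExteriorAlgebra.ι ℝ v) := involute_ι _
    have h' : contractLeft (Q := (0 : QuadraticForm ℝ (Fin n → ℝ))) d (ExteriorAlgebra.ι ℝ v) =
      algebraMap ℝ _ (d v) := contractLeft_ι _ _ _
    rw [h, map_neg, h', neg_neg]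
    exact AlgHom.commutes _ _
  | mul a b ha hb =>
    rw [contractLeft_mul, map_add, map_mul, map_mul, map_mul, contractLeft_mul, ha, hb]
    simp [add_comm]
  | add a b ha hb => simp only [map_add, ha, hb, neg_add]

/-- The odd coordinate derivations of the standard superdomain. -/
noncomputable def oddPartial (j : Fin n) : ModelSec m n W →ₗ[ℝ] ModelSec m n W :=
  TensorProduct.map LinearMap.id
    (contractLeft (Q := (0 : QuadraticForm ℝ (Fin n → ℝ))) (LinearMap.proj j))

theorem isModelDer_oddPartial (j : Fin n) :
    IsModelDer 1 (oddPartial j : ModelSec m n W →ₗ[ℝ] ModelSec m n W) where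
  deg k a ha := by
    rw [mem_modelPar_iff, sgn_add, mul_smul, ← map_units_smul, ← modelParity_of_mem ha, sgn_one]
    clear ha
    induction a using ModelSec.induction with
    | zero => simp
    | tmul c a =>
      have := congrArg (fun x => c ⊗ₜ[ℝ] x) (involute_contractLeft (LinearMap.proj j) a)
      refine Eq.trans this ?_
      simp only [TensorProduct.tmul_neg, Units.smul_def, Units.val_neg, Units.val_one, neg_smul,
        one_smul]
      rfl
    | add x y hx hy => simp only [map_add, hx, hy, smul_add]
  leibniz k a b ha := by
    rw [one_mul, ← units_smul_mul_assoc, ← modelParity_of_mem ha]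
    clear ha
    induction a using ModelSec.induction with
    | zero => simp
    | add x y hx hy => simp only [map_add, add_mul, hx, hy]; abel
    | tmul c a =>
      induction b using ModelSec.induction with
      | zero => simp
      | add x y hx hy => simp only [map_add, mul_add, hx, hy]; abel
      | tmul c' a' =>
        have e : ∀ (c : SmoothSec m W) (a : ExteriorAlgebra ℝ (Fin n → ℝ)),
          oddPartial j (c ⊗ₜ a) = c ⊗ₜ
            contractLeft (Q := (0 : QuadraticForm ℝ (Fin n → ℝ))) (LinearMap.proj j) a :=
            fun _ _ => rfl
        simp only [Algebra.TensorProduct.tmul_mul_tmul, e, contractLeft_mul,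
          TensorProduct.tmul_add, modelParity_tmul]

end ModelDer

/-! ### Globalizing coordinate functions and derivations by a cutoff -/

section Transport

variable {M : SuperSpace.{u}} {m n : ℕ} {c : SuperChart M m n}

/-- The domain of a chart. -/
def SuperChart.dom (c : SuperChart M m n) : Opens M.carrier := chartPre c.φ (chartTarget c.φ)

/-- The isomorphism of the sections over the whole domain of a chart. -/
noncomputable def SuperChart.isoTop (c : SuperChart M m n) :
    M.sec c.dom ≃ₐ[ℝ] ModelSec m n (chartTarget c.φ) := c.iso _ subset_rfl

variable (b : Cutoff M c.dom)

/-- The global function obtained from a function of the coordinates by means of a cutoff. -/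
noncomputable def coordMap : ModelSec m n (chartTarget c.φ) →ₗ[ℝ] M.Fn :=
  b.extend ∘ₗ c.isoTop.symm.toLinearMap

/-- The global endomorphism obtained from an endomorphism in coordinates by means of a cutoff. -/
noncomputable def transport
    (Δ : ModelSec m n (chartTarget c.φ) →ₗ[ℝ] ModelSec m n (chartTarget c.φ)) :
    M.Fn →ₗ[ℝ] M.Fn :=
  coordMap b ∘ₗ Δ ∘ₗ c.isoTop.toLinearMap ∘ₗ (M.res (le_top : c.dom ≤ ⊤)).toLinearMap

theorem transport_apply
    (Δ : ModelSec m n (chartTarget c.φ) →ₗ[ℝ] ModelSec m n (chartTarget c.φ)) (f : M.Fn) :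
    transport b Δ f = b.extend (c.isoTop.symm (Δ (c.isoTop (M.res le_top f)))) := rfl

theorem coordMap_apply (x : ModelSec m n (chartTarget c.φ)) :
    coordMap b x = b.extend (c.isoTop.symm x) := rfl

variable {b}

theorem coordMap_mem {i : ZMod 2} {x : ModelSec m n (chartTarget c.φ)}
    (hx : x ∈ modelPar m n _ i) : coordMap b x ∈ M.FnDeg i := by
  refine b.extend_mem ((c.mem_par_iff subset_rfl).2 ?_)
  change c.isoTop (c.isoTop.symm x) ∈ _
  rwa [AlgEquiv.apply_symm_apply]

theorem commute_even {U : Opens M.carrier} {a : M.sec U} (ha : a ∈ M.par U 0) (f : M.sec U) :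
    a * f = f * a := by
  induction f using homogeneous_induction (M.par U) with
  | add f g hf hg => rw [mul_add, add_mul, hf, hg]
  | hom j f hf => rw [M.supercomm U 0 j a f ha hf, zero_mul, uzpow_zero, one_smul]

/-- On the chart the cutoff enters each term of the Leibniz rule exactly once and commutes with
everything, being even. On `b.off` all terms vanish. -/
theorem isDer_transport {k : ZMod 2}
    {Δ : ModelSec m n (chartTarget c.φ) →ₗ[ℝ] ModelSec m n (chartTarget c.φ)}
    (hΔ : IsModelDer k Δ) : M.IsDer k (transport b Δ) := by
  refine ⟨fun j a ha => ?_, fun j f g hf => ?_⟩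
  · exact coordMap_mem (hΔ.deg j _ (c.iso_par _ _ _ _ (M.res_par _ _ _ ha)))
  · refine M.eq_of_pair b.cover ?_ ?_
    · simp only [transport_apply, map_add, map_units_smul, map_mul, b.res_extend]
      have hf' : c.isoTop (M.res le_top f) ∈ modelPar m n _ j :=
        c.iso_par _ _ _ _ (M.res_par _ _ _ hf)
      rw [hΔ.leibniz j _ _ hf']
      simp only [map_add, map_units_smul, map_mul, mul_add, AlgEquiv.symm_apply_apply,
        units_mul_smul_comm]
      rw [← mul_assoc (M.res _ f), ← commute_even (M.res_par (le_top : c.dom ≤ ⊤) 0 _ b.even)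
        (M.res _ f)]
      simp only [mul_assoc]
    · simp only [transport_apply, map_add, map_units_smul, map_mul, b.res_off_extend, zero_mul,
        mul_zero, smul_zero, add_zero]

variable {V : Opens M.carrier}

theorem res_coordMap (hV : V ≤ c.dom) (h : M.res (le_top : V ≤ ⊤) b.χ = 1)
    (x : ModelSec m n (chartTarget c.φ)) :
    M.res (le_top : V ≤ ⊤) (coordMap b x) = M.res hV (c.isoTop.symm x) :=
  b.res_extend_of_le hV h _

theorem res_coordMap_mul (hV : V ≤ c.dom) (h : M.res (le_top : V ≤ ⊤) b.χ = 1)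
    (x y : ModelSec m n (chartTarget c.φ)) :
    M.res (le_top : V ≤ ⊤) (coordMap b (x * y)) =
      M.res le_top (coordMap b x * coordMap b y) := by
  simp only [map_mul, res_coordMap hV h]

theorem res_coordMap_one (hV : V ≤ c.dom) (h : M.res (le_top : V ≤ ⊤) b.χ = 1) :
    M.res (le_top : V ≤ ⊤) (coordMap b 1) = 1 := by
  rw [res_coordMap hV h, map_one, map_one]

theorem res_coordMap_eq (hV : V ≤ c.dom) (h : M.res (le_top : V ≤ ⊤) b.χ = 1)
    {W : Opens (EuclideanSpace ℝ (Fin m))} (hW : W ≤ chartTarget c.φ)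
    {x y : ModelSec m n (chartTarget c.φ)} (hxy : modelRes n hW x = modelRes n hW y) :
    M.res (le_top : V ⊓ chartPre c.φ W ≤ ⊤) (coordMap b x) = M.res le_top (coordMap b y) := by
  have e : ∀ z, c.iso W hW (M.res (chartPre_mono c.φ hW) (c.isoTop.symm z)) = modelRes n hW z :=
    fun z => (c.iso_res hW (chartPre_mono c.φ hW) hW subset_rfl _).trans
      (congrArg _ (c.isoTop.apply_symm_apply z))
  have hd : chartPre c.φ W ≤ c.dom := chartPre_mono c.φ hW
  have key : M.res hd (c.isoTop.symm x) = M.res hd (c.isoTop.symm y) :=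
    (c.iso W hW).injective ((e x).trans (hxy.trans (e y).symm))
  have key' := congrArg (M.res (inf_le_right : V ⊓ chartPre c.φ W ≤ chartPre c.φ W)) key
  rw [M.res_res, M.res_res] at key'
  rw [← M.res_res (inf_le_left : V ⊓ chartPre c.φ W ≤ V) le_top, res_coordMap hV h,
    ← M.res_res (inf_le_left : V ⊓ chartPre c.φ W ≤ V) le_top, res_coordMap hV h, M.res_res,
    M.res_res, key']

end Transport

/-! ### Point derivations are determined by their values on coordinates -/

/-- An algebra-valued point `ψ` of `M` concentrated at `p`, together with a derivation `e` along
`ψ`, twisted by `τ`. -/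
structure PointDer (M : SuperSpace.{u}) (p : M.carrier) (A : Type*) [Ring A] [Algebra ℝ A] where
  ψ : M.Fn →ₐ[ℝ] A
  e : M.Fn →ₗ[ℝ] A
  τ : M.Fn → M.Fn
  τ_even : ∀ f ∈ M.FnDeg 0, τ f = f
  leibniz : ∀ f g, e (f * g) = e f * ψ g + ψ (τ f) * e g
  ψ_local : ∀ V : Opens M.carrier, p ∈ V → ∀ f, M.res (le_top : V ≤ ⊤) f = 0 → ψ f = 0
  e_local : ∀ V : Opens M.carrier, p ∈ V → ∀ f, M.res (le_top : V ≤ ⊤) f = 0 → e f = 0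

section Coord

variable {m n : ℕ}

/-- The even coordinates of the standard superdomain. -/
noncomputable def evenCoord (W : Opens (EuclideanSpace ℝ (Fin m))) (j : Fin m) : ModelSec m n W :=
  smoothOf W (fun x => x j) (contDiff_coord j) ⊗ₜ 1

/-- The odd coordinates of the standard superdomain. -/
noncomputable def oddCoord (W : Opens (EuclideanSpace ℝ (Fin m))) (j : Fin n) : ModelSec m n W :=
  1 ⊗ₜ ExteriorAlgebra.ι ℝ (Pi.single j 1)

theorem tmul_one_mem (W : Opens (EuclideanSpace ℝ (Fin m))) (f : SmoothSec m W) :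
    (f ⊗ₜ 1 : ModelSec m n W) ∈ modelPar m n W 0 :=
  tmul_mem_modelPar f (SetLike.one_mem_graded
    (CliffordAlgebra.evenOdd (0 : QuadraticForm ℝ (Fin n → ℝ))))

theorem oddCoord_mem (W : Opens (EuclideanSpace ℝ (Fin m))) (j : Fin n) :
    (oddCoord W j : ModelSec m n W) ∈ modelPar m n W 1 :=
  tmul_mem_modelPar 1 (CliffordAlgebra.ι_mem_evenOdd_one _ _)

end Coord

namespace PointDer

variable {M : SuperSpace.{u}} {p : M.carrier} {A : Type*} [Ring A] [Algebra ℝ A]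
  (P : PointDer M p A) {m n : ℕ} {c : SuperChart M m n} {b : Cutoff M c.dom} {V : Opens M.carrier}

theorem ψ_congr {V : Opens M.carrier} (hp : p ∈ V) {f g : M.Fn}
    (h : M.res (le_top : V ≤ ⊤) f = M.res le_top g) : P.ψ f = P.ψ g := by
  rw [← sub_eq_zero, ← map_sub]
  exact P.ψ_local V hp _ (by rw [map_sub, h, sub_self])

theorem e_congr {V : Opens M.carrier} (hp : p ∈ V) {f g : M.Fn}
    (h : M.res (le_top : V ≤ ⊤) f = M.res le_top g) : P.e f = P.e g := by
  rw [← sub_eq_zero, ← map_sub]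
  exact P.e_local V hp _ (by rw [map_sub, h, sub_self])

theorem ψ_coordMap_one (hp : p ∈ V) (hV : V ≤ c.dom) (h : M.res (le_top : V ≤ ⊤) b.χ = 1) :
    P.ψ (coordMap b 1) = 1 := by
  rw [P.ψ_congr hp (g := 1) (by rw [res_coordMap_one hV h, map_one]), map_one]

theorem ψ_coordMap_mul (hp : p ∈ V) (hV : V ≤ c.dom) (h : M.res (le_top : V ≤ ⊤) b.χ = 1)
    (x y : ModelSec m n (chartTarget c.φ)) :
    P.ψ (coordMap b (x * y)) = P.ψ (coordMap b x) * P.ψ (coordMap b y) := by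
  rw [P.ψ_congr hp (res_coordMap_mul hV h x y), map_mul]

theorem e_coordMap_mul (hp : p ∈ V) (hV : V ≤ c.dom) (h : M.res (le_top : V ≤ ⊤) b.χ = 1)
    (x y : ModelSec m n (chartTarget c.φ)) :
    P.e (coordMap b (x * y)) =
      P.e (coordMap b x) * P.ψ (coordMap b y) + P.ψ (P.τ (coordMap b x)) * P.e (coordMap b y) := by
  rw [P.e_congr hp (res_coordMap_mul hV h x y), P.leibniz]

theorem e_coordMap_one (hp : p ∈ V) (hV : V ≤ c.dom) (h : M.res (le_top : V ≤ ⊤) b.χ = 1) :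
    P.e (coordMap b 1) = 0 := by
  have e := P.e_coordMap_mul hp hV h 1 1
  rw [P.τ_even _ (coordMap_mem (by
    rw [Algebra.TensorProduct.one_def]; exact tmul_one_mem _ _)),
    P.ψ_coordMap_one hp hV h, mul_one, mul_one, one_mul] at e
  exact left_eq_add.1 e

/-- Constants and odd coordinates are killed, and the Leibniz rule extends this to the algebra that
they generate. -/
theorem e_coordMap_exterior (hp : p ∈ V) (hV : V ≤ c.dom) (h : M.res (le_top : V ≤ ⊤) b.χ = 1)
    (hodd : ∀ j : Fin n, P.e (coordMap b (oddCoord _ j)) = 0)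
    (a : ExteriorAlgebra ℝ (Fin n → ℝ)) : P.e (coordMap b (1 ⊗ₜ a)) = 0 := by
  induction a using ExteriorAlgebra.induction with
  | algebraMap r =>
    have : ((1 : SmoothSec m (chartTarget c.φ)) ⊗ₜ[ℝ] algebraMap ℝ (ExteriorAlgebra ℝ (Fin n → ℝ)) r)
        = r • (1 : ModelSec m n (chartTarget c.φ)) := by
      rw [Algebra.algebraMap_eq_smul_one, TensorProduct.tmul_smul]
      rfl
    rw [this, map_smul, map_smul, P.e_coordMap_one hp hV h, smul_zero]
  | ι v =>
    have : v = ∑ j, v j • Pi.single j (1 : ℝ) := by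
      ext i
      simp [Finset.sum_apply, Pi.single_apply]
    rw [this, map_sum, TensorProduct.tmul_sum, map_sum, map_sum]
    refine Finset.sum_eq_zero fun j _ => ?_
    rw [map_smul, TensorProduct.tmul_smul, map_smul, map_smul]
    exact (congrArg _ (hodd j)).trans (smul_zero _)
  | mul a a' ha ha' =>
    have : ((1 : SmoothSec m (chartTarget c.φ)) ⊗ₜ[ℝ] (a * a')) =
      (1 ⊗ₜ[ℝ] a) * (1 ⊗ₜ[ℝ] a') := by
      rw [Algebra.TensorProduct.tmul_mul_tmul, one_mul]
    rw [this, P.e_coordMap_mul hp hV h, ha, ha', zero_mul, mul_zero, add_zero]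
  | add a a' ha ha' => rw [TensorProduct.tmul_add, map_add, map_add, ha, ha', add_zero]

variable (ε : A →ₐ[ℝ] ℝ)

/-- The global function given in coordinates by a smooth function on `ℝᵐ`. -/
noncomputable def bodyFn (b : Cutoff M c.dom) (f : EuclideanSpace ℝ (Fin m) → ℝ)
    (hf : ContDiff ℝ ∞ f) : M.Fn :=
  coordMap b (smoothOf (chartTarget c.φ) f hf ⊗ₜ 1)

theorem bodyFn_mem (b : Cutoff M c.dom) (f : EuclideanSpace ℝ (Fin m) → ℝ)
    (hf : ContDiff ℝ ∞ f) : bodyFn b f hf ∈ M.FnDeg 0 := coordMap_mem (tmul_one_mem _ _)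

theorem res_bodyFn_eq (hV : V ≤ c.dom) (h : M.res (le_top : V ≤ ⊤) b.χ = 1)
    {W : Opens (EuclideanSpace ℝ (Fin m))} (hW : W ≤ chartTarget c.φ)
    {f g : SmoothSec m (chartTarget c.φ)} (hfg : ∀ x (hx : x ∈ W), f ⟨x, hW hx⟩ = g ⟨x, hW hx⟩) :
    M.res (le_top : V ⊓ chartPre c.φ W ≤ ⊤) (coordMap b (f ⊗ₜ 1)) =
      M.res le_top (coordMap b (g ⊗ₜ 1)) := by
  refine res_coordMap_eq hV h hW ?_
  have : smoothRes hW f = smoothRes hW g := by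
    ext x
    exact hfg x x.2
  change smoothRes hW f ⊗ₜ _ = smoothRes hW g ⊗ₜ _
  rw [this]

theorem smoothOf_mul (W : Opens (EuclideanSpace ℝ (Fin m))) {f g : EuclideanSpace ℝ (Fin m) → ℝ}
    (hf : ContDiff ℝ ∞ f) (hg : ContDiff ℝ ∞ g) :
    (smoothOf W (fun x => f x * g x) (hf.mul hg) ⊗ₜ 1 : ModelSec m n W) =
      (smoothOf W f hf ⊗ₜ 1) * (smoothOf W g hg ⊗ₜ 1) := by
  rw [Algebra.TensorProduct.tmul_mul_tmul, mul_one]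
  rfl

theorem smoothOf_const (W : Opens (EuclideanSpace ℝ (Fin m))) (r : ℝ) :
    (smoothOf W (fun _ => r) contDiff_const ⊗ₜ 1 : ModelSec m n W) = r • 1 := by
  rw [Algebra.TensorProduct.one_def, TensorProduct.smul_tmul']
  congr 1
  ext x
  exact (mul_one r).symm

theorem contDiff_coord_sub (j : Fin m) (r : ℝ) :
    ContDiff ℝ ∞ fun x : EuclideanSpace ℝ (Fin m) => x j - r :=
  (contDiff_coord j).sub contDiff_const

/-- The body of the image of a coordinate under a point is its value at the base point. -/
theorem body_coord (hp : p ∈ V) (hV : V ≤ c.dom) (h : M.res (le_top : V ≤ ⊤) b.χ = 1)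
    (j : Fin m) :
    ε (P.ψ (bodyFn b (fun x => x j - c.φ p j) (contDiff_coord_sub j _))) = 0 := by
  -- If the body r were nonzero, then xⱼ − pⱼ − r would be invertible near p, with inverse q(xⱼ −
  -- pⱼ). Its image under ψ would be a unit, although its body is r − r = 0.
  by_contra hr
  set r := ε (P.ψ (bodyFn b (fun x => x j - c.φ p j) (contDiff_coord_sub j _))) with hrdef
  obtain ⟨q, hq, hq1⟩ := exists_smooth_inv_sub hr
  have hcomp : ContDiff ℝ ∞ fun x : EuclideanSpace ℝ (Fin m) => q (x j - c.φ p j) :=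
    hq.comp (contDiff_coord_sub j _)
  have hsub : ContDiff ℝ ∞ fun x : EuclideanSpace ℝ (Fin m) => x j - c.φ p j - r :=
    (contDiff_coord_sub j _).sub contDiff_const
  have hev : ∀ᶠ x in nhds (c.φ p), (x j - c.φ p j - r) * q (x j - c.φ p j) = 1 := by
    have ht : Filter.Tendsto (fun x : EuclideanSpace ℝ (Fin m) => x j - c.φ p j) (nhds (c.φ p))
        (nhds 0) := by
      have := (contDiff_coord_sub j (c.φ p j)).continuous.tendsto (c.φ p)
      rwa [sub_self] at this
    exact ht.eventually hq1
  obtain ⟨O, hO, hOo, hpO⟩ := mem_nhds_iff.1 hev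
  let W : Opens (EuclideanSpace ℝ (Fin m)) := ⟨c.φ.target ∩ O, c.φ.open_target.inter hOo⟩
  have hW : W ≤ chartTarget c.φ := fun x hx => hx.1
  have hpW : p ∈ V ⊓ chartPre c.φ W := ⟨hp, (hV hp).1, (hV hp).2, hpO⟩
  have e1 : P.ψ (bodyFn b _ (hsub.mul hcomp)) = P.ψ (coordMap b 1) := by
    refine P.ψ_congr hpW ?_
    rw [Algebra.TensorProduct.one_def]
    exact res_bodyFn_eq hV h hW fun x hx => hO hx.2
  have e2 : P.ψ (bodyFn b _ (hsub.mul hcomp)) = P.ψ (bodyFn b _ hsub) * P.ψ (bodyFn b _ hcomp) := by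
    rw [bodyFn, smoothOf_mul, P.ψ_coordMap_mul hp hV h]
    rfl
  have e3 : bodyFn b _ hsub = bodyFn b (fun x => x j - c.φ p j) (contDiff_coord_sub j _) -
      r • coordMap b 1 := by
    rw [← map_smul, ← smoothOf_const, bodyFn, bodyFn, ← map_sub, ← TensorProduct.sub_tmul]
    rfl
  have e4 := congrArg ε (e1.symm.trans e2)
  rw [P.ψ_coordMap_one hp hV h, e3, map_sub, map_smul, P.ψ_coordMap_one hp hV h, map_mul, map_sub,
    map_smul, map_one, ← hrdef] at e4
  simp at e4

/-- By Hadamard's lemma f = f(p) + Σ (xⱼ − pⱼ) gⱼ. As `P.e` kills constants and coordinates, e(f) =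
Σ ψ(xⱼ − pⱼ) e(gⱼ), where the first factors have body zero by `body_coord`. Iterating this for the
gⱼ gains one power of the ideal at each stage. -/
theorem e_bodyFn_mem_pow (hp : p ∈ V) (hV : V ≤ c.dom) (h : M.res (le_top : V ≤ ⊤) b.χ = 1)
    (heven : ∀ j : Fin m, P.e (coordMap b (evenCoord _ j)) = 0) (N : ℕ)
    (f : EuclideanSpace ℝ (Fin m) → ℝ) (hf : ContDiff ℝ ∞ f) :
    P.e (bodyFn b f hf) ∈ LinearMap.ker ε.toLinearMap ^ N * ⊤ := by
  induction N generalizing f with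
  | zero =>
    rw [pow_zero, one_mul]
    trivial
  | succ N ih =>
    obtain ⟨g, hg, hfg⟩ := exists_hadamard hf (c.φ p)
    have hlin : ∀ j, ContDiff ℝ ∞ fun x : EuclideanSpace ℝ (Fin m) => x j - c.φ p j :=
      fun j => contDiff_coord_sub j _
    have e1 : bodyFn b f hf = f (c.φ p) • coordMap b 1 +
        ∑ j, bodyFn b _ ((hlin j).mul (hg j)) := by
      rw [← map_smul, ← smoothOf_const]
      simp only [bodyFn]
      rw [← map_sum, ← TensorProduct.sum_tmul, ← map_add, ← TensorProduct.add_tmul]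
      congr 2
      ext x
      change f x = f (c.φ p) + (∑ j, smoothOf _ _ ((hlin j).mul (hg j)) : SmoothSec m _) x
      rw [hfg x]
      congr 1
      rw [← ContMDiffMap.coeFnAddMonoidHom_apply, map_sum, Finset.sum_apply]
      rfl
    have e2 : ∀ j, P.e (bodyFn b _ (hlin j)) = 0 := fun j => by
      have : bodyFn b _ (hlin j) = coordMap b (evenCoord _ j) - c.φ p j • coordMap b 1 := by
        rw [← map_smul, ← smoothOf_const, bodyFn, evenCoord, ← map_sub, ← TensorProduct.sub_tmul]
        rfl
      rw [this, map_sub, map_smul, heven, P.e_coordMap_one hp hV h, smul_zero, sub_zero]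
    rw [e1, map_add, map_smul, P.e_coordMap_one hp hV h, smul_zero, zero_add, map_sum]
    refine Submodule.sum_mem _ fun j _ => ?_
    have e3 : P.e (bodyFn b _ ((hlin j).mul (hg j))) =
        P.ψ (bodyFn b _ (hlin j)) * P.e (bodyFn b _ (hg j)) := by
      rw [bodyFn, smoothOf_mul, P.e_coordMap_mul hp hV h]
      change P.e (bodyFn b _ (hlin j)) * _ + P.ψ (P.τ (bodyFn b _ (hlin j))) * _ = _
      rw [e2, zero_mul, zero_add, P.τ_even _ (bodyFn_mem b _ _)]
      rfl
    rw [e3, pow_succ', mul_assoc]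
    exact Submodule.mul_mem_mul (P.body_coord ε hp hV h j) (ih _ (hg j))

/-- Hadamard's lemma is applied to functions on all of ℝᵐ. Multiplication by a bump function
supported in the chart produces one without changing the germ. -/
theorem exists_bodyFn_germ (hp : p ∈ V) (hV : V ≤ c.dom) (h : M.res (le_top : V ≤ ⊤) b.χ = 1)
    (f : SmoothSec m (chartTarget c.φ)) :
    ∃ (g : EuclideanSpace ℝ (Fin m) → ℝ) (hg : ContDiff ℝ ∞ g) (V' : Opens M.carrier), p ∈ V' ∧
      M.res (le_top : V' ≤ ⊤) (coordMap b (f ⊗ₜ 1)) = M.res le_top (bodyFn b g hg) := by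
  obtain ⟨ε, hε, hball⟩ := Metric.nhds_basis_closedBall.mem_iff.1
    ((chartTarget c.φ).2.mem_nhds (hV hp).2)
  let κ : ContDiffBump (c.φ p) := ⟨ε / 2, ε, by positivity, by linarith⟩
  have hκ : ContDiff ℝ ∞ κ := κ.contDiff
  have hg : ContDiff ℝ ∞ fun x => κ x * zeroExt f x := contDiff_iff_contDiffAt.2 fun x => by
    by_cases hx : x ∈ chartTarget c.φ
    · exact hκ.contDiffAt.mul (contDiffAt_zeroExt f hx)
    · have : (fun y => κ y * zeroExt f y) =ᶠ[nhds x] fun _ => 0 := by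
        filter_upwards [Metric.isClosed_closedBall.isOpen_compl.mem_nhds
          (fun hx' => hx (hball hx') : x ∈ (Metric.closedBall (c.φ p) ε)ᶜ)] with y hy
        rw [κ.zero_of_le_dist (not_le.1 fun h => hy (Metric.mem_closedBall.2 h)).le, zero_mul]
      exact contDiffAt_const.congr_of_eventuallyEq this
  let W : Opens (EuclideanSpace ℝ (Fin m)) :=
    ⟨c.φ.target ∩ Metric.ball (c.φ p) (ε / 2), c.φ.open_target.inter Metric.isOpen_ball⟩
  have hW : W ≤ chartTarget c.φ := fun x hx => hx.1
  refine ⟨_, hg, V ⊓ chartPre c.φ W, ⟨hp, (hV hp).1, (hV hp).2,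
    Metric.mem_ball_self (by positivity)⟩, res_bodyFn_eq hV h hW fun x hx => ?_⟩
  change f _ = κ x * zeroExt f x
  rw [κ.one_of_mem_closedBall (Metric.ball_subset_closedBall hx.2), one_mul]
  exact (zeroExt_coe f ⟨x, hW hx⟩).symm

/-- A derivation along a point that kills the coordinates vanishes. -/
theorem e_eq_zero (hp : p ∈ V) (hV : V ≤ c.dom) (h : M.res (le_top : V ≤ ⊤) b.χ = 1)
    {N : ℕ} (hN : LinearMap.ker ε.toLinearMap ^ N = ⊥)
    (heven : ∀ j : Fin m, P.e (coordMap b (evenCoord _ j)) = 0)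
    (hodd : ∀ j : Fin n, P.e (coordMap b (oddCoord _ j)) = 0) (f : M.Fn) : P.e f = 0 := by
  -- By locality `f` may be replaced by its coordinate expression; then the even and odd variables
  -- are separated by s ⊗ a = (s ⊗ 1)(1 ⊗ a).
  have hf : P.e f = P.e (coordMap b (c.isoTop (M.res le_top f))) := by
    refine P.e_congr hp ?_
    rw [res_coordMap hV h, AlgEquiv.symm_apply_apply, M.res_res]
  rw [hf]
  induction c.isoTop (M.res le_top f) using ModelSec.induction with
  | zero => simp
  | add x y hx hy => rw [map_add, map_add, hx, hy, add_zero]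
  | tmul s a =>
    have e1 : (s ⊗ₜ a : ModelSec m n (chartTarget c.φ)) = (s ⊗ₜ 1) * (1 ⊗ₜ a) := by
      rw [Algebra.TensorProduct.tmul_mul_tmul, mul_one, one_mul]
    have e2 : P.e (coordMap b (s ⊗ₜ 1)) = 0 := by
      obtain ⟨g, hg, V', hp', e⟩ := exists_bodyFn_germ hp hV h s
      rw [P.e_congr hp' e]
      -- The exponent N is taken where the power of the augmentation ideal is zero.
      have := P.e_bodyFn_mem_pow ε hp hV h heven N g hg
      rw [hN, Submodule.bot_mul] at this
      exact this
    rw [e1, P.e_coordMap_mul hp hV h, e2, P.e_coordMap_exterior hp hV h hodd, zero_mul, mul_zero,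
      add_zero]

end PointDer

/-! ### Values of coordinate derivations on coordinates -/

section Coordinates

variable {M : SuperManifold.{u}} {m n : ℕ} {c : SuperChart M.toSuperSpace m n}
  {b : Cutoff M.toSuperSpace c.dom} {V : Opens M.carrier} {k : ZMod 2}
  {Δ : ModelSec m n (chartTarget c.φ) →ₗ[ℝ] ModelSec m n (chartTarget c.φ)}

theorem SuperSpace.IsDer.map_one {M : SuperSpace.{u}} {X : M.Fn →ₗ[ℝ] M.Fn} (hX : M.IsDer k X) :
    X 1 = 0 := by
  have e := hX.2 0 1 1 (SetLike.one_mem_graded _)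
  rw [mul_zero, uzpow_zero, one_smul, mul_one, mul_one, one_mul] at e
  exact left_eq_add.1 e

theorem res_transport (hV : V ≤ c.dom) (h : M.res (le_top : V ≤ ⊤) b.χ = 1) (f : M.Fn) :
    M.res (le_top : V ≤ ⊤) (transport b Δ f) =
      M.res hV (c.isoTop.symm (Δ (c.isoTop (M.res le_top f)))) :=
  b.res_extend_of_le hV h _

/-- The coordinate function z is globalized as χz. On `V` one has χ = 1, so by locality the
derivative of χ vanishes there and the cutoff drops out of Δ(χz). -/
theorem res_transport_coordMap (hV : V ≤ c.dom) (h : M.res (le_top : V ≤ ⊤) b.χ = 1)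
    (hΔ : IsModelDer k Δ) (z : ModelSec m n (chartTarget c.φ)) :
    M.res (le_top : V ≤ ⊤) (transport b Δ (coordMap b z)) = M.res le_top (coordMap b (Δ z)) := by
  have hχ : M.res hV (c.isoTop.symm (Δ (c.isoTop (M.res le_top b.χ)))) = 0 := by
    rw [← res_transport hV h]
    have hd := isDer_transport (b := b) hΔ
    have e := hd.along_id.res_eq (U := V) (f := b.χ) (g := 1) (by rw [h, _root_.map_one])
    rw [hd.map_one, map_zero] at e
    exact e
  have hmem : c.isoTop (M.res le_top b.χ) ∈ modelPar m n _ 0 :=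
    c.iso_par _ _ _ _ (M.res_par _ _ _ b.even)
  rw [res_transport hV h, res_coordMap hV h, coordMap_apply, b.res_extend, map_mul,
    AlgEquiv.apply_symm_apply, hΔ.leibniz 0 _ _ hmem, mul_zero, sgn_zero, one_smul, map_add, map_mul,
    map_mul, AlgEquiv.symm_apply_apply, map_add, map_mul, map_mul, hχ, zero_mul, zero_add,
    M.res_res, h, one_mul]

theorem evenPartial_evenCoord (W : Opens (EuclideanSpace ℝ (Fin m))) (i j : Fin m) :
    evenPartial i (evenCoord W j : ModelSec m n W) = if i = j then 1 else 0 := by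
  change partialDeriv i _ ⊗ₜ[ℝ] _ = _
  rw [partialDeriv_coord]
  split_ifs
  · rfl
  · exact TensorProduct.zero_tmul _ _

theorem evenPartial_oddCoord (W : Opens (EuclideanSpace ℝ (Fin m))) (i : Fin m) (j : Fin n) :
    evenPartial i (oddCoord W j : ModelSec m n W) = 0 := by
  change partialDeriv i 1 ⊗ₜ[ℝ] _ = _
  have e := partialDeriv_mul (W := W) i 1 1
  rw [mul_one, mul_one, one_mul] at e
  rw [left_eq_add.1 e, TensorProduct.zero_tmul]

theorem oddPartial_evenCoord (W : Opens (EuclideanSpace ℝ (Fin m))) (i : Fin n) (j : Fin m) :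
    oddPartial i (evenCoord W j : ModelSec m n W) = 0 := by
  change _ ⊗ₜ[ℝ] CliffordAlgebra.contractLeft (Q := (0 : QuadraticForm ℝ (Fin n → ℝ))) _ 1 = _
  rw [CliffordAlgebra.contractLeft_one, TensorProduct.tmul_zero]

theorem oddPartial_oddCoord (W : Opens (EuclideanSpace ℝ (Fin m))) (i j : Fin n) :
    oddPartial i (oddCoord W j : ModelSec m n W) = if i = j then 1 else 0 := by
  change _ ⊗ₜ[ℝ] CliffordAlgebra.contractLeft (Q := (0 : QuadraticForm ℝ (Fin n → ℝ))) _
    (CliffordAlgebra.ι _ _) = _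
  rw [CliffordAlgebra.contractLeft_ι, LinearMap.proj_apply, Pi.single_apply]
  split_ifs
  · rw [(algebraMap ℝ _).map_one]
    rfl
  · rw [map_zero, TensorProduct.tmul_zero]

end Coordinates

/-! ### Linear operations on derivations along a morphism -/

namespace IsDerAlong

variable {S M : SuperSpace.{u}} {φ : Hom S M} {i : ZMod 2} {D D' : M.Fn →ₗ[ℝ] S.Fn}

theorem sub (h : IsDerAlong φ i D) (h' : IsDerAlong φ i D') : IsDerAlong φ i (D - D') where
  deg j a ha := sub_mem (h.deg j a ha) (h'.deg j a ha)
  leibniz j a b ha := by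
    simp only [LinearMap.sub_apply, h.leibniz j a b ha, h'.leibniz j a b ha, sub_mul, mul_sub,
      smul_sub]
    abel

theorem add (h : IsDerAlong φ i D) (h' : IsDerAlong φ i D') : IsDerAlong φ i (D + D') where
  deg j a ha := add_mem (h.deg j a ha) (h'.deg j a ha)
  leibniz j a b ha := by
    simp only [LinearMap.add_apply, h.leibniz j a b ha, h'.leibniz j a b ha, add_mul, mul_add,
      smul_add]
    abel

theorem zero : IsDerAlong φ i (0 : M.Fn →ₗ[ℝ] S.Fn) where
  deg j a _ := zero_mem _
  leibniz j a b _ := by simp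

theorem sum {ι : Type*} (s : Finset ι) {D : ι → M.Fn →ₗ[ℝ] S.Fn}
    (h : ∀ l ∈ s, IsDerAlong φ i (D l)) : IsDerAlong φ i (∑ l ∈ s, D l) := by
  classical
  induction s using Finset.induction_on with
  | empty => exact zero
  | insert a s ha ih =>
    rw [Finset.sum_insert ha]
    exact (h a (Finset.mem_insert_self a s)).add
      (ih fun l hl => h l (Finset.mem_insert_of_mem hl))

theorem fn_smul {k : ZMod 2} {f : S.Fn} (hf : f ∈ S.FnDeg k) (h : IsDerAlong φ i D) :
    IsDerAlong φ (k + i) (f • D) where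
  deg j a ha := by
    have := SetLike.GradedMul.mul_mem hf (h.deg j a ha)
    rwa [← add_assoc] at this
  leibniz j a b ha := by
    have h1 := S.supercomm ⊤ k j f (φ.star a) hf (φ.star_mem ha)
    simp only [LinearMap.smul_apply, smul_eq_mul, h.leibniz j a b ha, mul_add, mul_smul_comm]
    rw [← mul_assoc f (φ.star a), h1, add_mul (R := ZMod 2), sgn_add, mul_comm (sgn (k * j)),
      smul_mul_assoc, mul_smul]
    simp only [mul_assoc]

end IsDerAlong

/-- Splitting `f` into components moves the sign into a twist of `f`, so that the rule holds for
inhomogeneous functions. This is the twist τ of a `PointDer`. -/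
theorem fn_leibniz {S M : SuperSpace.{u}} {φ : Hom S M} {i : ZMod 2} {D : M.Fn →ₗ[ℝ] S.Fn}
    (h : IsDerAlong φ i D) (f g : M.Fn) :
    D (f * g) = D f * φ.star g + φ.star (M.fnComp 0 f + sgn i • M.fnComp 1 f) * D g := by
  have e₀ := h.leibniz 0 _ g (fnComp_mem 0 f)
  have e₁ := h.leibniz 1 _ g (fnComp_mem 1 f)
  rw [mul_zero, sgn_zero, one_smul] at e₀
  rw [mul_one] at e₁
  conv_lhs => rw [← fn_eq_sum f]
  rw [add_mul, map_add, e₀, e₁, map_add, add_mul, map_units_smul, units_smul_mul_assoc]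
  have e : D f = D (M.fnComp 0 f) + D (M.fnComp 1 f) := by rw [← map_add, fn_eq_sum]
  rw [e, add_mul]
  abel

/-! ### Local frames for derivations along a morphism -/

section Representation

variable {S M : SuperManifold.{u}}

/-- Evaluation at a point of a chart. -/
noncomputable def chartEval {S : SuperSpace.{u}} {m n : ℕ} (c : SuperChart S m n)
    {W : Opens (EuclideanSpace ℝ (Fin m))}
    (hW : (W : Set _) ⊆ c.φ.target) (q : W) : S.Fn →ₐ[ℝ] ExteriorAlgebra ℝ (Fin n → ℝ) :=
  ((modelEval q).comp (c.iso W hW).toAlgHom).comp (S.res le_top)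

/-- Evaluation at a point may be carried out after restriction to any chart neighbourhood of it
inside `V`. -/
theorem chartEval_eq_zero {S : SuperSpace.{u}} {m n : ℕ} (c : SuperChart S m n)
    {W : Opens (EuclideanSpace ℝ (Fin m))}
    (hW : (W : Set _) ⊆ c.φ.target) (q : W) {V : Opens S.carrier} (hV : c.φ.symm q ∈ V) {f : S.Fn}
    (hf : S.res (le_top : V ≤ ⊤) f = 0) : chartEval c hW q f = 0 := by
  let W' : Opens (EuclideanSpace ℝ (Fin m)) :=
    W ⊓ ⟨c.φ.symm.source ∩ c.φ.symm ⁻¹' V, c.φ.symm.isOpen_inter_preimage V.2⟩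
  have hW' : W' ≤ W := inf_le_left
  have hle : chartPre c.φ W' ≤ V := fun x hx => by
    have := hx.2.2.2
    rwa [Set.mem_preimage, c.φ.left_inv hx.1] at this
  have hq : q.1 ∈ W' := ⟨q.2, hW q.2, hV⟩
  have e := modelEval_modelRes hW' ⟨q, hq⟩ (c.iso W hW (S.res le_top f))
  rw [← c.iso_res hW' (chartPre_mono _ hW') (fun x hx => hW (hW' hx)) hW, S.res_res, ← S.res_res hle le_top,
    hf, map_zero, map_zero, map_zero] at e
  exact e.symm

/-- Derivations along a morphism are locally combinations of derivations of the target, with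
coefficients their values on coordinates. -/
theorem exists_local_frame (φ : Hom S.toSuperSpace M.toSuperSpace) (s : S.carrier) :
    ∃ (V : Opens S.carrier) (r : ℕ) (X : Fin r → M.Vect) (y : Fin r → M.Fn) (i : Fin r → ZMod 2),
      s ∈ V ∧ (∀ l, (X l).HasDeg (i l)) ∧ (∀ l, y l ∈ M.FnDeg (i l)) ∧
      ∀ (k : ZMod 2) (D : M.Fn →ₗ[ℝ] S.Fn), IsDerAlong φ k D → ∀ f : M.Fn,
        S.res (le_top : V ≤ ⊤) (D f) =
          S.res le_top (∑ l, D (y l) * φ.star ((X l).app f)) := by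
  obtain ⟨c, hc⟩ := M.exists_chart (φ.base s)
  obtain ⟨cS, hcS⟩ := S.exists_chart s
  obtain ⟨b, V₀, hsV₀, hV₀, hχ⟩ := M.exists_cutoff (U := c.dom) (mem_chartPre_target c.φ hc)
  -- These are the coordinate points of S whose image in M lies where the cutoff equals 1.
  let W : Opens (EuclideanSpace ℝ (Fin S.m)) :=
    ⟨cS.φ.symm.source ∩ cS.φ.symm ⁻¹' (φ.pre V₀), cS.φ.symm.isOpen_inter_preimage (φ.pre V₀).2⟩
  have hW : (W : Set _) ⊆ cS.φ.target := fun x hx => hx.1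
  let X : Fin M.m ⊕ Fin M.n → M.Vect := Sum.elim
    (fun j => ⟨_, (isDer_transport (b := b) (isModelDer_evenPartial j)).mem⟩)
    (fun j => ⟨_, (isDer_transport (b := b) (isModelDer_oddPartial j)).mem⟩)
  let y : Fin M.m ⊕ Fin M.n → M.Fn := Sum.elim (fun j => coordMap b (evenCoord _ j))
    (fun j => coordMap b (oddCoord _ j))
  let i : Fin M.m ⊕ Fin M.n → ZMod 2 := Sum.elim (fun _ => 0) (fun _ => 1)
  have hX : ∀ l, (X l).HasDeg (i l) := by
    rintro (j | j)
    · exact isDer_transport (isModelDer_evenPartial j)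
    · exact isDer_transport (isModelDer_oddPartial j)
  have hy : ∀ l, y l ∈ M.FnDeg (i l) := by
    rintro (j | j)
    · exact coordMap_mem (tmul_one_mem _ _)
    · exact coordMap_mem (oddCoord_mem _ _)
  -- The globalized coordinate fields are dual to the globalized coordinates on `V₀`.
  have hδ : ∀ l l', M.res (le_top : V₀ ≤ ⊤) ((X l).app (y l')) = if l = l' then 1 else 0 := by
    rintro (j | j) (j' | j')
    · refine (res_transport_coordMap hV₀ hχ (isModelDer_evenPartial j) _).trans ?_
      rw [evenPartial_evenCoord]
      by_cases h : j = j'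
      · simp only [h, if_true, res_coordMap_one hV₀ hχ]
      · simp only [h, Sum.inl.injEq, if_false, map_zero]
    · refine (res_transport_coordMap hV₀ hχ (isModelDer_evenPartial j) _).trans ?_
      rw [evenPartial_oddCoord, map_zero, map_zero, if_neg Sum.inl_ne_inr]
    · refine (res_transport_coordMap hV₀ hχ (isModelDer_oddPartial j) _).trans ?_
      rw [oddPartial_evenCoord, map_zero, map_zero, if_neg Sum.inr_ne_inl]
    · refine (res_transport_coordMap hV₀ hχ (isModelDer_oddPartial j) _).trans ?_
      rw [oddPartial_oddCoord]
      by_cases h : j = j'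
      · simp only [h, if_true, res_coordMap_one hV₀ hχ]
      · simp only [h, Sum.inr.injEq, if_false, map_zero]
  have main : ∀ (k : ZMod 2) (D : M.Fn →ₗ[ℝ] S.Fn), IsDerAlong φ k D → ∀ f : M.Fn,
      S.res (le_top : chartPre cS.φ W ≤ ⊤) (D f) =
        S.res le_top (∑ l, D (y l) * φ.star ((X l).app f)) := by
    intro k D hD f
    -- The remainder after subtracting the coordinate part is again a derivation of degree `k` along
    -- φ, and by duality it kills the coordinates over `V₀`.
    let D' : M.Fn →ₗ[ℝ] S.Fn := D - ∑ l, D (y l) • (φ.star.toLinearMap ∘ₗ (X l).1)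
    have hD'a : ∀ f, D' f = D f - ∑ l, D (y l) * φ.star ((X l).app f) := fun f => by
      simp only [D', LinearMap.sub_apply, LinearMap.sum_apply]
      rfl
    have hD' : IsDerAlong φ k D' := hD.sub (IsDerAlong.sum _ fun l _ => by
      have := ((hX l).comp_star φ).fn_smul (hD.deg _ _ (hy l))
      rwa [add_assoc, CharTwo.add_self_eq_zero, add_zero] at this)
    rw [← sub_eq_zero, ← map_sub, ← hD'a]
    -- It suffices to evaluate at each point q. Evaluation after `D'` is a point derivation with
    -- values in an exterior algebra, whose augmentation ideal is nilpotent, so `PointDer.e_eq_zero`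
    -- applies.
    refine (cS.iso W hW).injective (Eq.trans (eq_zero_of_modelEval fun q => ?_) (map_zero _).symm)
    have hq : φ.base (cS.φ.symm q) ∈ V₀ := q.2.2
    let P : PointDer M.toSuperSpace (φ.base (cS.φ.symm q)) (ExteriorAlgebra ℝ (Fin S.n → ℝ)) :=
      { ψ := (chartEval cS hW q).comp φ.star
        e := (chartEval cS hW q).toLinearMap ∘ₗ D'
        τ := fun f => M.fnComp 0 f + sgn k • M.fnComp 1 f
        τ_even := fun f hf => by
          rw [fnComp_of_mem hf, fnComp_of_mem hf]
          simp
        leibniz := fun f g => by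
          simp only [LinearMap.comp_apply, AlgHom.toLinearMap_apply, fn_leibniz hD' f g, map_add,
            map_mul]
          rfl
        ψ_local := fun V hV f hf => chartEval_eq_zero cS hW q (V := φ.pre V) hV
          ((φ.res_star V f).trans (by rw [hf, map_zero]))
        e_local := fun V hV f hf => chartEval_eq_zero cS hW q (V := φ.pre V) hV
          (hD'.res_eq_zero hf) }
    have hPy : ∀ l, P.e (y l) = 0 := fun l => by
      refine chartEval_eq_zero cS hW q (V := φ.pre V₀) hq ?_
      rw [hD'a, map_sub, map_sum, sub_eq_zero, Finset.sum_eq_single l]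
      · rw [map_mul, φ.res_star, hδ, if_pos rfl, map_one, mul_one]
      · intro l' _ hne
        rw [map_mul, φ.res_star, hδ, if_neg hne, map_zero, mul_zero]
      · intro h
        exact absurd (Finset.mem_univ l) h
    obtain ⟨N, hN⟩ := exists_augIdeal_pow_eq_bot S.n
    exact P.e_eq_zero ExteriorAlgebra.algebraMapInv hq hV₀ hχ hN (fun j => hPy (Sum.inl j))
      (fun j => hPy (Sum.inr j)) f
  refine ⟨chartPre cS.φ W, M.m + M.n, X ∘ finSumFinEquiv.symm, y ∘ finSumFinEquiv.symm,
    i ∘ finSumFinEquiv.symm, ⟨hcS, cS.φ.map_source hcS, ?_⟩, fun l => hX _, fun l => hy _,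
    fun k D hD f => ?_⟩
  · change φ.base (cS.φ.symm (cS.φ s)) ∈ V₀
    rwa [cS.φ.left_inv hcS]
  · rw [main k D hD f]
    congr 1
    exact (finSumFinEquiv.symm.sum_comp fun l => D (y l) * φ.star ((X l).app f)).symm

end Representation

/-! ### Algebra of homogeneous vector fields -/

namespace SuperSpace

section VectorFields

variable {M : SuperSpace.{u}} {i j k : ZMod 2} {X Y Z : M.Vect} {f g : M.Fn}

@[ext]
theorem Vect.ext (h : ∀ f, X.app f = Y.app f) : X = Y := Subtype.ext (LinearMap.ext h)

@[simp] theorem Vect.add_app (X Y : M.Vect) (f : M.Fn) : (X + Y).app f = X.app f + Y.app f := rfl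
@[simp] theorem Vect.sub_app (X Y : M.Vect) (f : M.Fn) : (X - Y).app f = X.app f - Y.app f := rfl
@[simp] theorem Vect.neg_app (X : M.Vect) (f : M.Fn) : (-X).app f = -X.app f := rfl
@[simp] theorem Vect.zero_app (f : M.Fn) : (0 : M.Vect).app f = 0 := rfl
@[simp] theorem Vect.smul_app (a : M.Fn) (X : M.Vect) (f : M.Fn) :
    (a • X).app f = a * X.app f := rfl
@[simp] theorem Vect.app_add (X : M.Vect) (f g : M.Fn) : X.app (f + g) = X.app f + X.app g :=
  map_add X.1 f g
@[simp] theorem Vect.app_zero (X : M.Vect) : X.app 0 = 0 := map_zero X.1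
theorem Vect.sub_eq_add_neg (X Y : M.Vect) : X - Y = X + -Y := _root_.sub_eq_add_neg X Y

theorem Vect.sub_eq_zero {X Y : M.Vect} : X - Y = 0 ↔ X = Y := @_root_.sub_eq_zero M.Vect _ X Y

theorem Vect.sub_self (X : M.Vect) : X - X = 0 := _root_.sub_self X

theorem Vect.sub_zero (X : M.Vect) : X - 0 = X := _root_.sub_zero X

theorem Vect.fn_smul_sub (f : M.Fn) (X Y : M.Vect) : f • (X - Y) = f • X - f • Y := smul_sub f X Y

theorem Vect.units_smul_sub (s : ℤˣ) (X Y : M.Vect) : s • (X - Y) = s • X - s • Y :=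
  smul_sub s X Y

theorem Vect.sub_smul (f g : M.Fn) (X : M.Vect) : (f - g) • X = f • X - g • X :=
  _root_.sub_smul f g X

theorem Vect.neg_smul (f : M.Fn) (X : M.Vect) : (-f) • X = -(f • X) := _root_.neg_smul f X

theorem Vect.map_sub {B : Type*} [AddCommGroup B] (F : M.Vect →+ B) (X Y : M.Vect) :
    F (X - Y) = F X - F Y := _root_.map_sub F X Y

theorem Vect.map_units_smul {B : Type*} [AddCommGroup B] (F : M.Vect →+ B) (s : ℤˣ) (X : M.Vect) :
    F (s • X) = s • F X := SuperGeometry.map_units_smul F s X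

theorem neg_one_units_smul (X : M.Vect) : (-1 : ℤˣ) • X = -X := neg_one_zsmul X

@[simp] theorem Vect.units_smul_app (s : ℤˣ) (X : M.Vect) (f : M.Fn) :
    (s • X).app f = s • X.app f := by
  rcases Int.units_eq_one_or s with rfl | rfl
  · simp
  · rw [neg_one_units_smul, Vect.neg_app]
    exact (neg_one_zsmul _).symm

theorem Vect.app_sum {ι : Type*} (s : Finset ι) (X : ι → M.Vect) (f : M.Fn) :
    (∑ l ∈ s, X l).app f = ∑ l ∈ s, (X l).app f := by
  classical
  induction s using Finset.induction_on with
  | empty => rfl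
  | insert a s ha ih => rw [Finset.sum_insert ha, Finset.sum_insert ha, Vect.add_app, ih]

theorem Vect.HasDeg.app_mem (hX : X.HasDeg i) (hf : f ∈ M.FnDeg j) : X.app f ∈ M.FnDeg (i + j) :=
  hX.1 j f hf

theorem Vect.HasDeg.app_mul (hX : X.HasDeg i) (hf : f ∈ M.FnDeg j) (g : M.Fn) :
    X.app (f * g) = X.app f * g + sgn (i * j) • (f * X.app g) := hX.2 j f g hf

theorem Vect.HasDeg.zero : (0 : M.Vect).HasDeg i := IsDer.zero i

theorem Vect.HasDeg.add (hX : X.HasDeg i) (hY : Y.HasDeg i) : (X + Y).HasDeg i := IsDer.add hX hY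

theorem units_smul_val (s : ℤˣ) (X : M.Vect) : (s • X).1 = s • X.1 :=
  LinearMap.ext (Vect.units_smul_app s X)

theorem Vect.HasDeg.units_smul (hX : X.HasDeg i) (s : ℤˣ) : (s • X).HasDeg i := by
  have := IsDer.sgn_smul hX s
  rwa [← units_smul_val] at this

theorem Vect.HasDeg.neg (hX : X.HasDeg i) : (-X).HasDeg i := by
  have := hX.units_smul (-1)
  rwa [neg_one_units_smul] at this

theorem Vect.HasDeg.sub (hX : X.HasDeg i) (hY : Y.HasDeg i) : (X - Y).HasDeg i := by
  rw [Vect.sub_eq_add_neg]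
  exact hX.add hY.neg

theorem Vect.HasDeg.fn_smul (hX : X.HasDeg i) (hf : f ∈ M.FnDeg k) : (f • X).HasDeg (k + i) :=
  IsDer.fn_smul hf hX

theorem Vect.hasDeg_comp (i : ZMod 2) (X : M.Vect) : (X.comp i).HasDeg i := isDer_endComp X i

theorem Vect.HasDeg.comp_eq (hX : X.HasDeg i) (k : ZMod 2) : X.comp k = if i = k then X else 0 := by
  refine Subtype.ext ((endComp_of_isDer hX k).trans ?_)
  split_ifs <;> rfl

theorem Vect.comp_zero_add_comp_one (X : M.Vect) : X.comp 0 + X.comp 1 = X := by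
  obtain ⟨X₀, X₁, h₀, h₁, h⟩ := X.2
  refine Subtype.ext ?_
  change endComp 0 X.1 + endComp 1 X.1 = X.1
  rw [h, endComp_add, endComp_add, endComp_of_isDer h₀, endComp_of_isDer h₁, endComp_of_isDer h₀,
    endComp_of_isDer h₁]
  simp

theorem Vect.homogeneous_induction {p : M.Vect → Prop} (X : M.Vect)
    (hom : ∀ i (X : M.Vect), X.HasDeg i → p X) (add : ∀ X Y, p X → p Y → p (X + Y)) : p X := by
  rw [← X.comp_zero_add_comp_one]
  exact add _ _ (hom 0 _ (X.hasDeg_comp 0)) (hom 1 _ (X.hasDeg_comp 1))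

theorem Vect.comp_app (k : ZMod 2) (X : M.Vect) (f : M.Fn) :
    (X.comp k).app f = ∑ j : ZMod 2, M.fnComp (k + j) (X.app (M.fnComp j f)) := by
  change (∑ j : ZMod 2, M.fnComp (k + j) ∘ₗ X.1 ∘ₗ M.fnComp j) f = _
  rw [LinearMap.sum_apply]
  rfl

theorem Vect.comp_zero (k : ZMod 2) : (0 : M.Vect).comp k = 0 := by
  rw [HasDeg.zero.comp_eq (i := 0)]
  split_ifs <;> rfl

theorem Vect.comp_add (k : ZMod 2) (X Y : M.Vect) : (X + Y).comp k = X.comp k + Y.comp k :=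
  Subtype.ext (endComp_add k X.1 Y.1)

theorem Vect.HasDeg.bracket_app (hX : X.HasDeg i) (hY : Y.HasDeg j) (f : M.Fn) :
    (X.bracket Y).app f = X.app (Y.app f) - sgn (i * j) • Y.app (X.app f) := by
  have e : ∀ a b : ZMod 2, Vect.app ⟨(X.comp a).1 ∘ₗ (Y.comp b).1 -
      (-1 : ℤˣ) ^ (a * b) • ((Y.comp b).1 ∘ₗ (X.comp a).1),
      (isDer_bracket (isDer_endComp X a) (isDer_endComp Y b)).mem⟩ f =
      (X.comp a).app ((Y.comp b).app f) - sgn (a * b) • (Y.comp b).app ((X.comp a).app f) :=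
    fun a b => rfl
  rw [Vect.bracket, Vect.app_sum]
  simp only [Vect.app_sum, e]
  simp only [hX.comp_eq, hY.comp_eq]
  rw [Finset.sum_eq_single i, Finset.sum_eq_single j]
  · simp
  · intro b _ hb
    simp [hb.symm]
  · simp
  · intro a _ ha
    simp [ha.symm]
  · simp

theorem Vect.HasDeg.bracket (hX : X.HasDeg i) (hY : Y.HasDeg j) : (X.bracket Y).HasDeg (i + j) := by
  have e : X.bracket Y = ⟨_, (isDer_bracket hX hY).mem⟩ := by
    ext f
    rw [hX.bracket_app hY]
    rfl
  rw [e]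
  exact isDer_bracket hX hY

theorem Vect.HasDeg.rmul_eq (hX : X.HasDeg i) (hf : f ∈ M.FnDeg k) :
    X.rmul f = sgn (i * k) • (f • X) := by
  rw [Vect.rmul]
  simp only [hX.comp_eq, fnComp_of_mem hf]
  rw [Finset.sum_eq_single i, Finset.sum_eq_single k]
  · simp
  · intro b _ hb
    simp [hb.symm]
  · simp
  · intro a _ ha
    simp [ha.symm]
  · simp

theorem Vect.rmul_add (X : M.Vect) (f g : M.Fn) : X.rmul (f + g) = X.rmul f + X.rmul g := by
  simp only [Vect.rmul, map_add, add_smul, smul_add, Finset.sum_add_distrib]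

theorem Vect.add_rmul (X Y : M.Vect) (f : M.Fn) : (X + Y).rmul f = X.rmul f + Y.rmul f := by
  simp only [Vect.rmul, Vect.comp_add, smul_add, Finset.sum_add_distrib]

theorem units_smul_fn_smul (s : ℤˣ) (f : M.Fn) (X : M.Vect) : (s • f) • X = s • (f • X) := by
  ext a
  simp only [Vect.smul_app, Vect.units_smul_app, units_smul_mul_assoc]

theorem fn_smul_units_smul (s : ℤˣ) (f : M.Fn) (X : M.Vect) : f • (s • X) = s • (f • X) := by
  ext a
  simp only [Vect.smul_app, Vect.units_smul_app, units_mul_smul_comm]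

theorem map_units_smul_left {A B C : Type*} [AddCommGroup A] [AddCommGroup B] [AddCommGroup C]
    (F : A →+ B →+ C) (s : ℤˣ) (a : A) (b : B) : F (s • a) b = s • F a b := by
  rcases Int.units_eq_one_or s with rfl | rfl <;> simp [Units.smul_def]

end VectorFields

/-! ### Forms and gradients -/

section Forms

variable {M : SuperSpace.{u}} {d : ZMod 2} {i j k : ZMod 2} {X Y : M.Vect} {f : M.Fn}

theorem SymmForm.smul_right (g : SymmForm M d) (hX : X.HasDeg i)
    (hY : Y.HasDeg j) (hf : f ∈ M.FnDeg k) :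
    g.form X (f • Y) = sgn (i * k) • (f * g.form X Y) := by
  rw [g.symm i (k + j) _ _ hX (hY.fn_smul hf), g.smul_left, g.symm j i _ _ hY hX,
    units_mul_smul_comm, smul_smul, mul_comm j i, mul_add, uzpow_add, mul_assoc, sgn_mul_self,
    mul_one]

theorem SymmForm.smul_right_of_even (g : SymmForm M d) (hf : f ∈ M.FnDeg 0) (X Y : M.Vect) :
    g.form X (f • Y) = f * g.form X Y := by
  induction X using Vect.homogeneous_induction with
  | add X X' hX hX' => simp only [map_add, AddMonoidHom.add_apply, hX, hX', mul_add]
  | hom i X hX =>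
    induction Y using Vect.homogeneous_induction with
    | add Y Y' hY hY' => simp only [smul_add, map_add, hY, hY', mul_add]
    | hom j Y hY => rw [g.smul_right hX hY hf, mul_zero, sgn_zero, one_smul]

theorem SymmForm.eq_zero_symm (g : SymmForm M d) (hY : Y.HasDeg j)
    (h : ∀ i (X : M.Vect), X.HasDeg i → g.form X Y = 0) (X : M.Vect) : g.form Y X = 0 := by
  induction X using Vect.homogeneous_induction with
  | add X X' hX hX' => rw [map_add, hX, hX', add_zero]
  | hom i X hX => rw [g.symm j i _ _ hY hX, h i X hX, smul_zero]

theorem isGradient_iff (g : SymmForm M d) (hf : f ∈ M.FnDeg k) (G : M.Vect) :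
    IsGradient g f G ↔ ∀ X : M.Vect, sgn (k * d) • X.app f = g.form X G := by
  refine forall_congr' fun X => ?_
  rw [Finset.sum_eq_single k]
  · rw [fnComp_of_mem hf, if_pos rfl]
  · intro b _ hb
    rw [fnComp_of_mem hf, if_neg hb.symm, Vect.app_zero, smul_zero]
  · simp

/-- For degree reasons a component of `G` of another degree is orthogonal to all vector fields, so
it vanishes by nondegeneracy. -/
theorem IsGradient.hasDeg {g : Metric M d} (hf : f ∈ M.FnDeg k) {G : M.Vect}
    (hG : IsGradient g.toSymmForm f G) : G.HasDeg (k + d) := by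
  rw [isGradient_iff _ hf] at hG
  have key : ∀ l, l ≠ k + d → G.comp l = 0 := by
    intro l hl
    refine g.nondeg_inj _ (g.eq_zero_symm (G.hasDeg_comp l) fun i X hX => ?_)
    have h1 : M.fnComp (i + l + d) (g.form X G) = g.form X (G.comp l) := by
      have h2 : ∀ l', M.fnComp (i + l + d) (g.form X (G.comp l')) =
          if l' = l then g.form X (G.comp l') else 0 := fun l' => by
        rw [fnComp_of_mem (g.deg i l' _ _ hX (G.hasDeg_comp l'))]
        simp
      conv_lhs => rw [← G.comp_zero_add_comp_one]
      rw [map_add, map_add, h2, h2]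
      rcases zmod_two_cases l with rfl | rfl <;> simp
    rw [← h1, ← hG X, map_units_smul, fnComp_of_mem (hX.app_mem hf), if_neg, smul_zero]
    intro h
    apply hl
    rw [add_assoc] at h
    have := add_left_cancel h
    rw [this, add_assoc, CharTwo.add_self_eq_zero, add_zero]
  have h := G.comp_zero_add_comp_one
  rcases zmod_two_cases (k + d) with e | e
  · rw [key 1 (by rw [e]; decide), add_zero] at h
    rw [e, ← h]
    exact G.hasDeg_comp 0
  · rw [key 0 (by rw [e]; decide), zero_add] at h
    rw [e, ← h]
    exact G.hasDeg_comp 1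

theorem isGradient_grad (g : Metric M d) (f : M.Fn) : IsGradient g.toSymmForm f (grad g f) :=
  (exists_gradient g f).choose_spec

end Forms

section Curvature

variable {M : SuperSpace.{u}} {i j : ZMod 2} {X Y : M.Vect}

theorem curvature_of_hasDeg {D : M.Vect → M.Vect → M.Vect} (h₁ : ∀ Z, D 0 Z = 0)
    (h₂ : ∀ Y, D Y 0 = 0) (hX : X.HasDeg i) (hY : Y.HasDeg j) (Z : M.Vect) :
    curvature D X Y Z = D X (D Y Z) - sgn (i * j) • D Y (D X Z) - D (X.bracket Y) Z := by
  rw [curvature, Finset.sum_eq_single i, Finset.sum_eq_single j]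
  · rw [hX.comp_eq, hY.comp_eq, if_pos rfl, if_pos rfl]
  · intro b _ hb
    rw [hY.comp_eq, if_neg hb.symm, h₁, smul_zero]
  · simp
  · intro a _ ha
    refine Finset.sum_eq_zero fun b _ => ?_
    rw [hX.comp_eq, if_neg ha.symm, h₁, h₂, smul_zero]
  · simp

end Curvature

end SuperSpace

/-! ### Related vector fields and pullback forms -/

section Related

variable {S M : SuperSpace.{u}} {φ : Hom S M} {A B : S.Vect} {X Y : M.Vect} {i j : ZMod 2}

theorem Hom.star_fnComp (φ : Hom S M) (i : ZMod 2) (f : M.Fn) :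
    S.fnComp i (φ.star f) = φ.star (M.fnComp i f) := by
  conv_lhs => rw [← fn_eq_sum f]
  rw [map_add, map_add, fnComp_of_mem (φ.star_mem (fnComp_mem 0 f)),
    fnComp_of_mem (φ.star_mem (fnComp_mem 1 f))]
  rcases zmod_two_cases i with rfl | rfl <;> simp

theorem Related.add (h : Related φ A X) (h' : Related φ B Y) : Related φ (A + B) (X + Y) :=
  fun f => by rw [Vect.add_app, Vect.add_app, map_add, h, h']

theorem Related.smul (h : Related φ A X) (f : M.Fn) : Related φ (φ.star f • A) (f • X) :=
  fun g => by rw [Vect.smul_app, Vect.smul_app, map_mul, h]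

theorem Related.smul_zero (h : Related φ A 0) (f : S.Fn) : Related φ (f • A) 0 :=
  fun g => by rw [Vect.smul_app, h, Vect.zero_app, map_zero, mul_zero]

theorem Related.comp (h : Related φ A X) (k : ZMod 2) : Related φ (A.comp k) (X.comp k) :=
  fun f => by
    rw [Vect.comp_app, Vect.comp_app, map_sum]
    exact Finset.sum_congr rfl fun j _ => by
      rw [φ.star_fnComp, h, φ.star_fnComp]

theorem Related.bracket (h : Related φ A X) (h' : Related φ B Y) (hA : A.HasDeg i)
    (hX : X.HasDeg i) (hB : B.HasDeg j) (hY : Y.HasDeg j) :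
    Related φ (A.bracket B) (X.bracket Y) := fun f => by
  rw [hA.bracket_app hB, hX.bracket_app hY, h', h, h, h', map_sub, map_units_smul]

/-- The pullback of a form on related vector fields. -/
theorem IsPullback.form_eq {d : ZMod 2} {g : SymmForm M d} {G : SymmForm S d}
    (hG : IsPullback φ g G) (h : Related φ A X) (h' : Related φ B Y) :
    G.form A B = φ.star (g.form X Y) := by
  -- One-term expansions with coefficient 1. The pullback formula asks only the field in the first
  -- slot to be homogeneous, so `Y` need not be split.
  have key : ∀ i (A : S.Vect) (X : M.Vect), Related φ A X → X.HasDeg i →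
      G.form A B = φ.star (g.form X Y) := fun i A X h hX => by
    have := hG A B 1 1 (fun _ => 1) (fun _ => X) (fun _ => 1) (fun _ => Y) (fun _ => i)
      (fun _ => 0) (fun _ => hX) (fun _ => SetLike.one_mem_graded _)
      (fun f => by simpa using h f) (fun f => by simpa using h' f)
    simpa using this
  have h0 := key 0 _ _ (h.comp 0) (X.hasDeg_comp 0)
  have h1 := key 1 _ _ (h.comp 1) (X.hasDeg_comp 1)
  rw [← A.comp_zero_add_comp_one, ← X.comp_zero_add_comp_one, map_add, map_add,
    AddMonoidHom.add_apply, AddMonoidHom.add_apply, map_add, h0, h1]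

theorem IsPullback.form_eq_zero {d : ZMod 2} {g : SymmForm M d} {G : SymmForm S d}
    (hG : IsPullback φ g G) (h : Related φ A 0) (h' : Related φ B Y) : G.form A B = 0 := by
  rw [hG.form_eq h h', map_zero, AddMonoidHom.zero_apply, map_zero]

end Related

/-! ### Pullback forms on arbitrary vector fields -/

section LocalFrames

variable {S M : SuperManifold.{u}} {φ : Hom S.toSuperSpace M.toSuperSpace} {d k : ZMod 2}
  {g : SymmForm M.toSuperSpace d} {G : SymmForm S.toSuperSpace d} {C : S.Vect}

/-- Near each point a vector field on the source of a morphism agrees with one whose image has a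
finite expansion. -/
theorem exists_expansion (φ : Hom S.toSuperSpace M.toSuperSpace) (hC : C.HasDeg k) (s : S.carrier) :
    ∃ (V : Opens S.carrier) (ρ : S.Fn) (r : ℕ) (X : Fin r → M.Vect) (a : Fin r → S.Fn)
      (i : Fin r → ZMod 2), s ∈ V ∧ ρ ∈ S.FnDeg 0 ∧ S.res (le_top : V ≤ ⊤) ρ = 1 ∧
      (∀ l, (X l).HasDeg (i l)) ∧ (∀ l, a l ∈ S.FnDeg (k + i l)) ∧
      ∀ f, (ρ • C).app (φ.star f) = ∑ l, a l * φ.star ((X l).app f) := by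
  obtain ⟨U, r, X, y, i, hsU, hX, hy, hU⟩ := exists_local_frame φ s
  obtain ⟨b, V, hsV, hVU, hV⟩ := S.exists_cutoff hsU
  refine ⟨V, b.χ, r, X, fun l => b.χ * C.app (φ.star (y l)), i, hsV, b.even, hV, hX, fun l => ?_,
    fun f => ?_⟩
  · have := SetLike.mul_mem_graded b.even (hC.app_mem (φ.star_mem (hy l)))
    rwa [zero_add] at this
  -- Multiplication by the cutoff turns the expansion valid on `U` into a global identity, as
  -- `IsPullback` demands.
  · have e := hU k _ (SuperSpace.IsDer.star_comp hC φ) f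
    simp only [mul_assoc]
    rw [Vect.smul_app, ← Finset.mul_sum]
    refine S.eq_of_pair b.cover ?_ ?_
    · rw [map_mul, map_mul]
      exact congrArg _ e
    · rw [map_mul, map_mul, b.res_off, zero_mul, zero_mul]

/-- The field `A` has the empty expansion, so the pullback formula is an empty sum as soon as the
other argument has some finite expansion; locally it has one. -/
theorem IsPullback.form_eq_zero_of_related (hG : IsPullback φ g G) {A : S.Vect}
    (h : Related φ A 0) (C : S.Vect) : G.form A C = 0 := by
  have key : ∀ k (C : S.Vect), C.HasDeg k → G.form A C = 0 := by
    intro k C hC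
    refine S.eq_of_local fun s _ => ?_
    obtain ⟨V, ρ, r, X, a, i, hsV, hρ, hV, hX, ha, he⟩ := exists_expansion φ hC s
    refine ⟨V, hsV, le_top, ?_⟩
    have e := hG A (ρ • C) 0 r Fin.elim0 Fin.elim0 a X Fin.elim0 (fun l => k + i l)
      (fun l => l.elim0) ha (fun f => by rw [h f]; simp) he
    rw [G.smul_right_of_even hρ, Finset.univ_eq_empty, Finset.sum_empty] at e
    have := congrArg (S.res (le_top : V ≤ ⊤)) e
    rw [map_mul, hV, one_mul] at this
    exact this
  rw [← C.comp_zero_add_comp_one, map_add, key 0 _ (C.hasDeg_comp 0), key 1 _ (C.hasDeg_comp 1),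
    add_zero]

/-- A vector field that is orthogonal to lifts of all homogeneous vector fields on the target is
vertical. -/
theorem IsPullback.app_star_eq_zero {g : Metric M.toSuperSpace d} (hG : IsPullback φ g.toSymmForm G)
    (hC : C.HasDeg k)
    (h : ∀ i (X : M.Vect), X.HasDeg i → ∃ A, Related φ A X ∧ G.form A C = 0) (f : M.Fn) :
    C.app (φ.star f) = 0 := by
  induction f using homogeneous_induction (M.par ⊤) with
  | add f f' hf hf' => rw [map_add, Vect.app_add, hf, hf', add_zero]
  | hom m f hf =>
    have sg : ∀ m d k z : ZMod 2, sgn ((m + d) * (k + z)) * (-1) ^ ((m + d) * z) =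
        sgn ((m + d) * k) * sgn (m * d) * sgn (m * d) := by decide
    have hgr := isGradient_grad g f
    have hdeg := hgr.hasDeg hf
    rw [isGradient_iff _ hf] at hgr
    set Γ := grad g f
    -- Expand C locally as Σ aₗ Xₗ. Pairing the lift of Γ = grad f with C then gives, up to a global
    -- sign, Σ aₗ Xₗ(f) = C(f), while the pairing is zero.
    obtain ⟨A, hA, hAC⟩ := h _ Γ hdeg
    refine S.eq_of_local fun s _ => ?_
    obtain ⟨V, ρ, r, X, a, i, hsV, hρ, hV, hX, ha, he⟩ := exists_expansion φ hC s
    refine ⟨V, hsV, le_top, ?_⟩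
    have e := hG A (ρ • C) 1 r (fun _ => 1) (fun _ => Γ) a X (fun _ => m + d) (fun l => k + i l)
      (fun _ => hdeg) ha (fun f => by simpa using hA f) he
    rw [G.smul_right_of_even hρ, hAC, mul_zero, Fin.sum_univ_one] at e
    have e' : ∀ l, sgn ((m + d) * (k + i l)) • (1 * a l * φ.star (g.form Γ (X l))) =
        (sgn ((m + d) * k) * sgn (m * d)) • (a l * φ.star ((X l).app f)) := fun l => by
      have h2 : (X l).app f = sgn (m * d) • g.form (X l) Γ := by
        rw [← hgr, smul_smul, sgn_mul_self, one_smul]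
      rw [h2, g.symm _ _ _ _ hdeg (hX l), one_mul, map_units_smul, map_units_smul,
        units_mul_smul_comm, units_mul_smul_comm, smul_smul, smul_smul]
      congr 1
      exact sg m d k (i l)
    have e2 : ∀ l, (-1 : ℤˣ) ^ ((m + d) * (k + i l)) • (1 * a l * φ.star (g.form Γ (X l))) =
        (sgn ((m + d) * k) * sgn (m * d)) • (a l * φ.star ((X l).app f)) := e'
    simp only [e2] at e
    rw [← Finset.smul_sum, ← he, Vect.smul_app] at e
    have e3 := congrArg (S.res (le_top : V ≤ ⊤)) e
    rw [map_zero, map_units_smul, map_mul, hV, one_mul] at e3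
    rw [map_zero]
    exact ((smul_eq_zero_iff_eq _).1 e3.symm)

end LocalFrames

/-! ### Lifts of vector fields to the product -/

section Lifts

variable {M N M₁ : SuperManifold.{u}} {π₁ : Hom M₁.toSuperSpace M.toSuperSpace}
  {π₂ : Hom M₁.toSuperSpace N.toSuperSpace}

/-- The factors play symmetric roles, so the statements on fields from N are those on fields from M
for the swapped product. -/
theorem lift₂_eq_lift₁ (U : N.Vect) : lift₂ π₁ π₂ U = lift₁ π₂ π₁ U := by
  unfold lift₂ lift₁
  congr 1
  ext A
  exact and_comm

namespace IsProduct

variable (hp : IsProduct π₁ π₂) {A B : M₁.Vect} {X Y : M.Vect} {i j : ZMod 2}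

include hp

/-- A vector field on a product is determined by its action on the functions of the factors. -/
theorem vect_ext (h₁ : ∀ f, A.app (π₁.star f) = B.app (π₁.star f))
    (h₂ : ∀ f, A.app (π₂.star f) = B.app (π₂.star f)) : A = B := by
  have r₁ : Related π₁ (A - B) 0 := fun f => by
    rw [Vect.sub_app, h₁, sub_self, Vect.zero_app, map_zero]
  have r₂ : Related π₂ (A - B) 0 := fun f => by
    rw [Vect.sub_app, h₂, sub_self, Vect.zero_app, map_zero]
  have key : ∀ k, (A - B).comp k = 0 := fun k => by
    have k₁ := r₁.comp k
    have k₂ := r₂.comp k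
    rw [Vect.comp_zero] at k₁ k₂
    refine Subtype.ext (hp.isDer_eq_zero ((A - B).hasDeg_comp k)
      (fun F => (k₁ F).trans (map_zero π₁.star)) fun F => (k₂ F).trans (map_zero π₂.star))
  rw [← sub_eq_zero, ← (A - B).comp_zero_add_comp_one, key, key, add_zero]

theorem exists_lift (X : M.Vect) : ∃ A : M₁.Vect, Related π₁ A X ∧ Related π₂ A 0 := by
  induction X using Vect.homogeneous_induction with
  | add X Y hX hY =>
    obtain ⟨A, hA, hA'⟩ := hX
    obtain ⟨B, hB, hB'⟩ := hY
    refine ⟨A + B, hA.add hB, ?_⟩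
    have := hA'.add hB'
    rwa [add_zero] at this
  | hom i X hX =>
    obtain ⟨B, hB, h₁, h₂⟩ := hp.exists_isDer hX
    exact ⟨⟨B, hB.mem⟩, h₁, fun f => (h₂ f).trans (map_zero π₂.star).symm⟩

theorem related_lift₁ (X : M.Vect) : Related π₁ (lift₁ π₁ π₂ X) X :=
  (Classical.epsilon_spec (hp.exists_lift X)).1

theorem related_lift₁' (X : M.Vect) : Related π₂ (lift₁ π₁ π₂ X) 0 :=
  (Classical.epsilon_spec (hp.exists_lift X)).2

theorem lift₁_app (X : M.Vect) (f : M.Fn) :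
    (lift₁ π₁ π₂ X).app (π₁.star f) = π₁.star (X.app f) := hp.related_lift₁ X f

theorem lift₁_app' (X : M.Vect) (f : N.Fn) : (lift₁ π₁ π₂ X).app (π₂.star f) = 0 := by
  rw [hp.related_lift₁' X f, Vect.zero_app, map_zero]

theorem eq_lift₁ (h₁ : Related π₁ A X) (h₂ : Related π₂ A 0) : A = lift₁ π₁ π₂ X :=
  hp.vect_ext (fun f => by rw [h₁, hp.lift₁_app])
    fun f => by rw [h₂, hp.lift₁_app', Vect.zero_app, map_zero]

theorem lift₁_add (X Y : M.Vect) : lift₁ π₁ π₂ (X + Y) = lift₁ π₁ π₂ X + lift₁ π₁ π₂ Y :=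
  (hp.eq_lift₁ ((hp.related_lift₁ X).add (hp.related_lift₁ Y)) (by
    have := (hp.related_lift₁' X).add (hp.related_lift₁' Y)
    rwa [add_zero] at this)).symm

/-- The lift of vector fields on the first factor, as a homomorphism. -/
noncomputable def lift₁Hom : M.Vect →+ M₁.Vect :=
  AddMonoidHom.mk' (lift₁ π₁ π₂) hp.lift₁_add

theorem lift₁_sub (X Y : M.Vect) : lift₁ π₁ π₂ (X - Y) = lift₁ π₁ π₂ X - lift₁ π₁ π₂ Y :=
  map_sub hp.lift₁Hom X Y

theorem lift₁_units_smul (s : ℤˣ) (X : M.Vect) :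
    lift₁ π₁ π₂ (s • X) = s • lift₁ π₁ π₂ X :=
  map_units_smul hp.lift₁Hom s X

theorem lift₁_smul (f : M.Fn) (X : M.Vect) :
    lift₁ π₁ π₂ (f • X) = π₁.star f • lift₁ π₁ π₂ X :=
  (hp.eq_lift₁ ((hp.related_lift₁ X).smul f) ((hp.related_lift₁' X).smul_zero _)).symm

theorem lift₁_comp (X : M.Vect) (k : ZMod 2) :
    (lift₁ π₁ π₂ X).comp k = lift₁ π₁ π₂ (X.comp k) :=
  hp.eq_lift₁ ((hp.related_lift₁ X).comp k) (by
    have := (hp.related_lift₁' X).comp k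
    rwa [Vect.comp_zero] at this)

theorem hasDeg_lift₁ (hX : X.HasDeg i) : (lift₁ π₁ π₂ X).HasDeg i := by
  have := hp.lift₁_comp X i
  rw [hX.comp_eq, if_pos rfl] at this
  rw [← this]
  exact Vect.hasDeg_comp _ _

theorem bracket_lift₁ (hX : X.HasDeg i) (hY : Y.HasDeg j) :
    (lift₁ π₁ π₂ X).bracket (lift₁ π₁ π₂ Y) = lift₁ π₁ π₂ (X.bracket Y) := by
  have hX' := hp.hasDeg_lift₁ hX
  have hY' := hp.hasDeg_lift₁ hY
  refine hp.eq_lift₁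
    ((hp.related_lift₁ X).bracket (hp.related_lift₁ Y) hX' hX hY' hY) fun f => ?_
  rw [hX'.bracket_app hY', hp.lift₁_app', hp.lift₁_app', Vect.app_zero, Vect.app_zero, smul_zero,
    sub_zero, Vect.zero_app, map_zero]

theorem related_lift₂ (U : N.Vect) : Related π₂ (lift₂ π₁ π₂ U) U := by
  rw [lift₂_eq_lift₁]
  exact hp.symm.related_lift₁ U

theorem related_lift₂' (U : N.Vect) : Related π₁ (lift₂ π₁ π₂ U) 0 := by
  rw [lift₂_eq_lift₁]
  exact hp.symm.related_lift₁' U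

theorem lift₂_app (U : N.Vect) (f : N.Fn) :
    (lift₂ π₁ π₂ U).app (π₂.star f) = π₂.star (U.app f) := hp.related_lift₂ U f

theorem lift₂_app' (U : N.Vect) (f : M.Fn) : (lift₂ π₁ π₂ U).app (π₁.star f) = 0 := by
  rw [hp.related_lift₂' U f, Vect.zero_app, map_zero]

theorem lift₂_units_smul (s : ℤˣ) (U : N.Vect) :
    lift₂ π₁ π₂ (s • U) = s • lift₂ π₁ π₂ U := by
  rw [lift₂_eq_lift₁, lift₂_eq_lift₁, hp.symm.lift₁_units_smul]

theorem lift₂_add (U V : N.Vect) : lift₂ π₁ π₂ (U + V) = lift₂ π₁ π₂ U + lift₂ π₁ π₂ V := by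
  rw [lift₂_eq_lift₁, lift₂_eq_lift₁, lift₂_eq_lift₁, hp.symm.lift₁_add]

theorem lift₂_sub (U V : N.Vect) : lift₂ π₁ π₂ (U - V) = lift₂ π₁ π₂ U - lift₂ π₁ π₂ V := by
  rw [lift₂_eq_lift₁, lift₂_eq_lift₁, lift₂_eq_lift₁, hp.symm.lift₁_sub]

theorem hasDeg_lift₂ {U : N.Vect} (hU : U.HasDeg i) : (lift₂ π₁ π₂ U).HasDeg i := by
  rw [lift₂_eq_lift₁]
  exact hp.symm.hasDeg_lift₁ hU

theorem bracket_lift₂ {U V : N.Vect} (hU : U.HasDeg i) (hV : V.HasDeg j) :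
    (lift₂ π₁ π₂ U).bracket (lift₂ π₁ π₂ V) = lift₂ π₁ π₂ (U.bracket V) := by
  rw [lift₂_eq_lift₁, lift₂_eq_lift₁, lift₂_eq_lift₁, hp.symm.bracket_lift₁ hU hV]

theorem bracket_lift₁_lift₂ {U : N.Vect} (hX : X.HasDeg i) (hU : U.HasDeg j) :
    (lift₁ π₁ π₂ X).bracket (lift₂ π₁ π₂ U) = 0 := by
  have hX' := hp.hasDeg_lift₁ hX
  have hU' := hp.hasDeg_lift₂ hU
  refine hp.vect_ext (fun f => ?_) fun f => ?_
  · rw [hX'.bracket_app hU', hp.lift₂_app', hp.lift₁_app, hp.lift₂_app', Vect.app_zero, smul_zero,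
      sub_zero, Vect.zero_app]
  · rw [hX'.bracket_app hU', hp.lift₂_app, hp.lift₁_app', hp.lift₁_app', Vect.app_zero, smul_zero,
      sub_zero, Vect.zero_app]

theorem bracket_lift₂_lift₁ {U : N.Vect} (hX : X.HasDeg i) (hU : U.HasDeg j) :
    (lift₂ π₁ π₂ U).bracket (lift₁ π₁ π₂ X) = 0 := by
  have := hp.symm.bracket_lift₁_lift₂ hU hX
  rwa [lift₂_eq_lift₁ (π₁ := π₂), ← lift₂_eq_lift₁] at this

end IsProduct

/-! ### The warped form on lifts -/

section Warped

variable {d : ZMod 2} {g₁ : Metric M.toSuperSpace d} {g₂ : Metric N.toSuperSpace d} {μ : M.Fn}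
  {G : SymmForm M₁.toSuperSpace d} (hp : IsProduct π₁ π₂)
  (hG : IsWarped π₁ π₂ g₁.toSymmForm g₂.toSymmForm μ G)

include hp hG

theorem IsWarped.form_lift₁_lift₁ (X Y : M.Vect) :
    G.form (lift₁ π₁ π₂ X) (lift₁ π₁ π₂ Y) = π₁.star (g₁.form X Y) := by
  obtain ⟨G₁, G₂, h₁, h₂, h⟩ := hG
  rw [h, h₁.form_eq (hp.related_lift₁ X) (hp.related_lift₁ Y),
    h₂.form_eq_zero (hp.related_lift₁' X) (hp.related_lift₁' Y), mul_zero, add_zero]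

theorem IsWarped.form_lift₁_lift₂ (X : M.Vect) (U : N.Vect) :
    G.form (lift₁ π₁ π₂ X) (lift₂ π₁ π₂ U) = 0 := by
  obtain ⟨G₁, G₂, h₁, h₂, h⟩ := hG
  rw [h, h₁.form_eq (hp.related_lift₁ X) (hp.related_lift₂' U),
    h₂.form_eq_zero (hp.related_lift₁' X) (hp.related_lift₂ U), mul_zero, add_zero, map_zero,
    map_zero]

theorem IsWarped.form_lift₂_lift₁ (X : M.Vect) (U : N.Vect) :
    G.form (lift₂ π₁ π₂ U) (lift₁ π₁ π₂ X) = 0 := by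
  obtain ⟨G₁, G₂, h₁, h₂, h⟩ := hG
  rw [h, h₁.form_eq_zero (hp.related_lift₂' U) (hp.related_lift₁ X),
    h₂.form_eq (hp.related_lift₂ U) (hp.related_lift₁' X), zero_add, map_zero, map_zero, mul_zero]

theorem IsWarped.form_lift₂_lift₂ (U V : N.Vect) :
    G.form (lift₂ π₁ π₂ U) (lift₂ π₁ π₂ V) = π₁.star μ * π₂.star (g₂.form U V) := by
  obtain ⟨G₁, G₂, h₁, h₂, h⟩ := hG
  rw [h, h₁.form_eq_zero (hp.related_lift₂' U) (hp.related_lift₂' V),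
    h₂.form_eq (hp.related_lift₂ U) (hp.related_lift₂ V), zero_add]

/-- The warped metric is nondegenerate on lifts. -/
theorem IsWarped.eq_zero (hμ : IsUnit μ) {k : ZMod 2} {C : M₁.Vect} (hC : C.HasDeg k)
    (h₁ : ∀ i (X : M.Vect), X.HasDeg i → G.form (lift₁ π₁ π₂ X) C = 0)
    (h₂ : ∀ i (U : N.Vect), U.HasDeg i → G.form (lift₂ π₁ π₂ U) C = 0) : C = 0 := by
  obtain ⟨G₁, G₂, hG₁, hG₂, h⟩ := hG
  refine hp.vect_ext (fun f => ?_) fun f => ?_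
  -- A lift from one factor is vertical for the other projection, so only one pullback summand
  -- contributes. For lifts from N the factor μ remains and is cancelled because it is invertible.
  · rw [Vect.zero_app]
    refine hG₁.app_star_eq_zero hC (fun i X hX => ⟨_, hp.related_lift₁ X, ?_⟩) f
    have := h₁ i X hX
    rwa [h, hG₂.form_eq_zero_of_related (hp.related_lift₁' X), mul_zero, add_zero] at this
  · rw [Vect.zero_app]
    refine hG₂.app_star_eq_zero hC (fun i U hU => ⟨_, hp.related_lift₂ U, ?_⟩) f
    have := h₂ i U hU
    rw [h, hG₁.form_eq_zero_of_related (hp.related_lift₂' U), zero_add] at this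
    exact (hμ.map π₁.star).mul_right_eq_zero.1 this

end Warped

end Lifts

/-! ### Uniqueness of the Levi-Civita connection on a family of fields -/

namespace SuperSpace

variable {M : SuperSpace.{u}} {d : ZMod 2}

/-- A Levi-Civita connection is determined on a family of vector fields on which the form is
nondegenerate. -/
theorem IsLeviCivita.cov_eq {g : SymmForm M d} {L : Connection M} (hL : IsLeviCivita g L)
    {ι : Type*} {A : ι → M.Vect} {a : ι → ZMod 2} (hA : ∀ i, (A i).HasDeg (a i))
    {K : ι → ι → M.Vect} (hK : ∀ i j, (K i j).HasDeg (a i + a j))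
    (hg : ∀ k (C : M.Vect), C.HasDeg k → (∀ i, g.form (A i) C = 0) → C = 0)
    (htorsion : ∀ i j, K i j - sgn (a i * a j) • K j i = (A i).bracket (A j))
    (hmetric : ∀ i j k, (A i).app (g.form (A j) (A k)) =
      g.form (K i j) (A k) + sgn (a i * a j) • g.form (A j) (K i k)) (i j : ι) :
    L.cov (A i) (A j) = K i j := by
  -- The difference tensor: torsion-freeness makes `T` graded symmetric, and compatibility with the
  -- form makes g(T i j, A k) graded skew in j and k.
  set T : ι → ι → M.Vect := fun i j => L.cov (A i) (A j) - K i j with hT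
  have hTdeg : ∀ i j, (T i j).HasDeg (a i + a j) := fun i j =>
    (L.deg _ _ _ _ (hA i) (hA j)).sub (hK i j)
  have h₁ : ∀ i j, T i j = sgn (a i * a j) • T j i := fun i j => by
    have e := hL.torsion_free _ _ _ _ (hA i) (hA j)
    rw [← htorsion i j] at e
    rw [← Vect.sub_eq_zero, ← e]
    simp only [hT, Vect.units_smul_sub]
    abel
  have h₂ : ∀ i j k, g.form (T i j) (A k) = -(sgn (a i * a j) • g.form (A j) (T i k)) :=
    fun i j k => by
      have e := hL.metric _ _ _ _ (A k) (hA i) (hA j)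
      rw [hmetric i j k] at e
      simp only [hT, Vect.map_sub, AddMonoidHom.sub_apply, smul_sub]
      rw [eq_neg_iff_add_eq_zero]
      have e' := sub_eq_zero.2 e.symm
      rw [← e']
      abel
  set t : ι → ι → ι → M.Fn := fun i j k => g.form (T i j) (A k) with ht
  have t₁ : ∀ i j k, t i j k = sgn (a i * a j) • t j i k := fun i j k => by
    simp only [ht]
    rw [h₁ i j, map_units_smul_left]
  have s₂ : ∀ x y z : ZMod 2, sgn (x * y) * (-1 : ℤˣ) ^ (y * (x + z)) = sgn (y * z) := by decide
  have t₂ : ∀ i j k, t i j k = -(sgn (a j * a k) • t i k j) := fun i j k => by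
    simp only [ht]
    rw [h₂ i j k, g.symm _ _ _ _ (hA j) (hTdeg i k), smul_smul, s₂]
  -- The indices i and k can be exchanged in two ways, with one or with two uses of skewness. The
  -- parity signs agree, so t = −t.
  have t₀ : ∀ i j k, t i j k = 0 := fun i j k => by
    have e₁ : t i j k = -(sgn (a i * a j) • sgn (a i * a k) • sgn (a k * a j) • t k j i) := by
      rw [t₁ i j k, t₂ j i k, t₁ j k i, smul_neg, mul_comm (a j) (a k)]
    have e₂ : t i j k = sgn (a j * a k) • sgn (a i * a k) • sgn (a i * a j) • t k j i := by
      rw [t₂ i j k, t₁ i k j, t₂ k i j]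
      simp only [smul_neg, neg_neg]
    have e₃ : t i j k = -t i j k := by
      conv_lhs => rw [e₁]
      conv_rhs => rw [e₂]
      congr 1
      simp only [smul_smul]
      congr 1
      rw [mul_comm (a k) (a j)]
      generalize sgn (a i * a j) = x
      generalize sgn (a i * a k) = y
      generalize sgn (a j * a k) = z
      rw [mul_left_comm, mul_comm x z, mul_left_comm y]
    exact eq_zero_of_neg_eq e₃.symm
  have : T i j = 0 := hg _ _ (hTdeg i j) fun k => by
    rw [g.symm _ _ _ _ (hA k) (hTdeg i j)]
    exact (congrArg _ (t₀ i j k)).trans (smul_zero _)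
  exact Vect.sub_eq_zero.1 this

/-! ### General properties of the semi-symmetric connection -/

section SemiSymm

variable {g : SymmForm M d} {L : Connection M} {P X Y : M.Vect} {i j k : ZMod 2} {f : M.Fn}

theorem semiSymm_add_left (X X' Y : M.Vect) :
    semiSymm g L P (X + X') Y = semiSymm g L P X Y + semiSymm g L P X' Y := by
  simp only [semiSymm, map_add, AddMonoidHom.add_apply, Vect.add_rmul, add_smul]
  abel

theorem semiSymm_add_right (X Y Y' : M.Vect) :
    semiSymm g L P X (Y + Y') = semiSymm g L P X Y + semiSymm g L P X Y' := by
  simp only [semiSymm, map_add, AddMonoidHom.add_apply, Vect.rmul_add, add_smul]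
  abel

theorem semiSymm_zero_left (Y : M.Vect) : semiSymm g L P 0 Y = 0 :=
  map_zero (AddMonoidHom.mk' (fun X => semiSymm g L P X Y) fun X X' => semiSymm_add_left X X' Y)

theorem semiSymm_zero_right (X : M.Vect) : semiSymm g L P X 0 = 0 :=
  map_zero (AddMonoidHom.mk' (semiSymm g L P X) (semiSymm_add_right X))

theorem semiSymm_sub_right (X Y Y' : M.Vect) :
    semiSymm g L P X (Y - Y') = semiSymm g L P X Y - semiSymm g L P X Y' :=
  map_sub (AddMonoidHom.mk' (semiSymm g L P X) (semiSymm_add_right X)) Y Y'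

theorem semiSymm_units_smul_right (s : ℤˣ) (X Y : M.Vect) :
    semiSymm g L P X (s • Y) = s • semiSymm g L P X Y :=
  map_units_smul (AddMonoidHom.mk' (semiSymm g L P X) (semiSymm_add_right X)) s Y

theorem form_mem (hX : X.HasDeg i) (hP : P.HasDeg d) : g.form X P ∈ M.FnDeg i := by
  have := g.deg i d X P hX hP
  rwa [add_assoc, CharTwo.add_self_eq_zero, add_zero] at this

theorem hasDeg_semiSymm (hP : P.HasDeg d) (hX : X.HasDeg i) (hY : Y.HasDeg j) :
    (semiSymm g L P X Y).HasDeg (i + j) := by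
  refine ((L.deg _ _ _ _ hX hY).add ?_).sub ?_
  · rw [hX.rmul_eq (form_mem hY hP), add_comm i j]
    exact (hX.fn_smul (form_mem hY hP)).units_smul _
  · have := hP.fn_smul (g.deg i j X Y hX hY)
    rwa [add_assoc, CharTwo.add_self_eq_zero, add_zero] at this

/-- Since |P| = |g|, the two added terms are linear in Y up to the sign of moving f past X, so the
Leibniz rule is that of the Levi-Civita connection. -/
theorem semiSymm_leibniz (hP : P.HasDeg d) (hX : X.HasDeg i) (hY : Y.HasDeg j)
    (hf : f ∈ M.FnDeg k) :
    semiSymm g L P X (f • Y) = X.app f • Y + sgn (i * k) • (f • semiSymm g L P X Y) := by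
  have h1 : f * g.form Y P ∈ M.FnDeg (k + j) := SetLike.mul_mem_graded hf (form_mem hY hP)
  rw [semiSymm, semiSymm, L.leibniz i k X Y f hX hf, g.smul_left, hX.rmul_eq h1,
    hX.rmul_eq (form_mem hY hP), g.smul_right hX hY hf, units_smul_fn_smul, mul_smul, mul_smul,
    mul_add, sgn_add, Vect.fn_smul_sub, smul_add f, fn_smul_units_smul, Vect.units_smul_sub,
    smul_add]
  simp only [mul_smul]
  abel

theorem semiSymmCurvature_eq (hX : X.HasDeg i) (hY : Y.HasDeg j) (Z : M.Vect) :
    semiSymmCurvature g L P X Y Z = semiSymm g L P X (semiSymm g L P Y Z) -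
      sgn (i * j) • semiSymm g L P Y (semiSymm g L P X Z) - semiSymm g L P (X.bracket Y) Z :=
  curvature_of_hasDeg semiSymm_zero_left semiSymm_zero_right hX hY Z

theorem Connection.curv_eq (hX : X.HasDeg i) (hY : Y.HasDeg j) (Z : M.Vect) :
    L.curv X Y Z = L.cov X (L.cov Y Z) - sgn (i * j) • L.cov Y (L.cov X Z) -
      L.cov (X.bracket Y) Z :=
  curvature_of_hasDeg (fun Z => by rw [map_zero, AddMonoidHom.zero_apply])
    (fun Y => map_zero _) hX hY Z

end SemiSymm

end SuperSpace

/-! ### The logarithmic derivative of the warping function -/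

section LogDerivative

variable {M : SuperSpace.{u}} {h : M.Fnˣ} {i j d : ZMod 2} {X Y : M.Vect}

/-- The odd part of h · h⁻¹ = 1 is h times the odd part of h⁻¹, and h can be cancelled. -/
theorem inv_mem_even (hh : (h : M.Fn) ∈ M.FnDeg 0) : h⁻¹.val ∈ M.FnDeg 0 := by
  have e : (h : M.Fn) * M.fnComp 1 h⁻¹.val = 0 := by
    have h1 : (h : M.Fn) * M.fnComp 0 h⁻¹.val + h * M.fnComp 1 h⁻¹.val = 1 := by
      rw [← mul_add, fn_eq_sum, h.mul_inv]
    have h2 := congrArg (M.fnComp 1) h1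
    rwa [map_add, fnComp_of_mem (SetLike.mul_mem_graded hh (fnComp_mem 0 _)),
      fnComp_of_mem (SetLike.mul_mem_graded hh (fnComp_mem 1 _)),
      fnComp_of_mem (SetLike.one_mem_graded (M.par ⊤)), if_neg (by decide), if_pos (by decide),
      if_neg (by decide), zero_add] at h2
  have e' : M.fnComp 1 h⁻¹.val = 0 := (Units.mul_right_eq_zero h).1 e
  rw [← fn_eq_sum h⁻¹.val, e', add_zero]
  exact fnComp_mem 0 _

/-- The logarithmic derivative `X(h) / h`. -/
def logDer (h : M.Fnˣ) (X : M.Vect) : M.Fn := X.app h * h⁻¹.val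

theorem logDer_mem (hh : (h : M.Fn) ∈ M.FnDeg 0) (hX : X.HasDeg i) : logDer h X ∈ M.FnDeg i := by
  have := SetLike.mul_mem_graded (hX.app_mem hh) (inv_mem_even hh)
  rwa [add_zero, add_zero] at this

theorem logDer_add (X Y : M.Vect) : logDer h (X + Y) = logDer h X + logDer h Y := by
  rw [logDer, Vect.add_app, add_mul, logDer, logDer]

theorem logDer_sub (X Y : M.Vect) : logDer h (X - Y) = logDer h X - logDer h Y := by
  rw [logDer, Vect.sub_app, sub_mul, logDer, logDer]

theorem logDer_smul (f : M.Fn) (X : M.Vect) : logDer h (f • X) = f * logDer h X := by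
  rw [logDer, Vect.smul_app, mul_assoc, logDer]

theorem logDer_units_smul (s : ℤˣ) (X : M.Vect) : logDer h (s • X) = s • logDer h X := by
  rw [logDer, Vect.units_smul_app, units_smul_mul_assoc, logDer]

theorem logDer_mul_self (h : M.Fnˣ) (X : M.Vect) : logDer h X * h = X.app h := by
  rw [logDer, mul_assoc, h.inv_mul, mul_one]

theorem app_sq (hh : (h : M.Fn) ∈ M.FnDeg 0) (hX : X.HasDeg i) :
    X.app ((h : M.Fn) ^ 2) = logDer h X * h ^ 2 + logDer h X * h ^ 2 := by
  rw [pow_two, hX.app_mul hh, mul_zero, sgn_zero, one_smul, commute_even hh, ← mul_assoc,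
    logDer_mul_self]

theorem app_inv (hh : (h : M.Fn) ∈ M.FnDeg 0) (hX : X.HasDeg i) :
    X.app h⁻¹.val = -(logDer h X * h⁻¹.val) := by
  have e := hX.app_mul hh h⁻¹.val
  have h1 : X.app 1 = 0 := SuperSpace.IsDer.map_one hX
  rw [h.mul_inv, h1, mul_zero, sgn_zero, one_smul] at e
  have e' := congrArg (h⁻¹.val * ·) e.symm
  simp only [mul_add, mul_zero] at e'
  rw [← mul_assoc, ← mul_assoc, h.inv_mul, one_mul, commute_even (inv_mem_even hh)] at e'
  exact eq_neg_of_add_eq_zero_right e'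

/-- In the curvature computations the quadratic term cancels against the one produced by applying X
to the vector field in (Y(h)/h) V. -/
theorem app_logDer (hh : (h : M.Fn) ∈ M.FnDeg 0) (hX : X.HasDeg i) (hY : Y.HasDeg j) :
    X.app (logDer h Y) =
      X.app (Y.app h) * h⁻¹.val - sgn (i * j) • (logDer h Y * logDer h X) := by
  have e := hX.app_mul (hY.app_mem hh) h⁻¹.val
  rw [app_inv hh hX, add_zero, mul_neg, smul_neg, ← sub_eq_add_neg] at e
  rw [logDer, e]
  congr 2
  rw [← commute_even (inv_mem_even hh) (logDer h X), ← mul_assoc]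

theorem grad_form {g : Metric M d} (hh : (h : M.Fn) ∈ M.FnDeg 0) (X : M.Vect) :
    g.form X (grad g h) = X.app h := by
  have := (isGradient_iff _ hh _).1 (isGradient_grad g h) X
  rwa [zero_mul, sgn_zero, one_smul, eq_comm] at this

theorem hasDeg_grad {g : Metric M d} (hh : (h : M.Fn) ∈ M.FnDeg 0) : (grad g h.val).HasDeg d := by
  have := (isGradient_grad g h.val).hasDeg hh
  rwa [zero_add] at this

theorem form_inv_smul_grad {g : Metric M d} (hh : (h : M.Fn) ∈ M.FnDeg 0) (X : M.Vect) :
    g.form X (h⁻¹.val • grad g h.val) = logDer h X := by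
  rw [g.smul_right_of_even (inv_mem_even hh), grad_form hh, commute_even (inv_mem_even hh)]
  rfl

theorem hasDeg_inv_smul_grad {g : Metric M d} (hh : (h : M.Fn) ∈ M.FnDeg 0) :
    (h⁻¹.val • grad g h.val).HasDeg d := by
  have := (hasDeg_grad (g := g) hh).fn_smul (inv_mem_even hh)
  rwa [zero_add] at this

end LogDerivative

/-! ### The Levi-Civita connection of the warped product -/

section WarpedConnection

variable {M N M₁ : SuperManifold.{u}} {π₁ : Hom M₁.toSuperSpace M.toSuperSpace}
  {π₂ : Hom M₁.toSuperSpace N.toSuperSpace} {d : ZMod 2} {g₁ : Metric M.toSuperSpace d}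
  {g₂ : Metric N.toSuperSpace d} {h : M.Fnˣ} {G : SymmForm M₁.toSuperSpace d}
  {LM : Connection M.toSuperSpace} {LN : Connection N.toSuperSpace}
  {Lμ : Connection M₁.toSuperSpace} {i j k : ZMod 2} {X Y : M.Vect} {U V W : N.Vect}

/-- Here X kills functions from N, and X(h²) = 2 (X(h)/h) h². The two copies are kept apart because
they match the two terms of metric compatibility. -/
theorem lift₁_app_form (hp : IsProduct π₁ π₂) (hh : (h : M.Fn) ∈ M.FnDeg 0)
    (hG : IsWarped π₁ π₂ g₁.toSymmForm g₂.toSymmForm ((h : M.Fn) ^ 2) G) (hX : X.HasDeg i)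
    (U V : N.Vect) :
    (lift₁ π₁ π₂ X).app (G.form (lift₂ π₁ π₂ U) (lift₂ π₁ π₂ V)) =
      π₁.star (logDer h X) * G.form (lift₂ π₁ π₂ U) (lift₂ π₁ π₂ V) +
      π₁.star (logDer h X) * G.form (lift₂ π₁ π₂ U) (lift₂ π₁ π₂ V) := by
  have h2 : (h : M.Fn) ^ 2 ∈ M.FnDeg 0 := by
    have := SetLike.mul_mem_graded hh hh
    rwa [add_zero, ← pow_two] at this
  rw [hG.form_lift₂_lift₂ hp, (hp.hasDeg_lift₁ hX).app_mul (π₁.star_mem h2), hp.lift₁_app',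
    mul_zero, mul_zero, smul_zero, add_zero, hp.lift₁_app, app_sq hh hX, map_add, map_mul, add_mul,
    mul_assoc]

/-- As U kills the factor h², this is the metric property of `LN` scaled by h². -/
theorem lift₂_app_form (hp : IsProduct π₁ π₂) (hh : (h : M.Fn) ∈ M.FnDeg 0)
    (hG : IsWarped π₁ π₂ g₁.toSymmForm g₂.toSymmForm ((h : M.Fn) ^ 2) G)
    (hLN : IsLeviCivita g₂.toSymmForm LN) (hU : U.HasDeg i) (hV : V.HasDeg j) (W : N.Vect) :
    (lift₂ π₁ π₂ U).app (G.form (lift₂ π₁ π₂ V) (lift₂ π₁ π₂ W)) =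
      G.form (lift₂ π₁ π₂ (LN.cov U V)) (lift₂ π₁ π₂ W) +
      sgn (i * j) • G.form (lift₂ π₁ π₂ V) (lift₂ π₁ π₂ (LN.cov U W)) := by
  have h2 : (h : M.Fn) ^ 2 ∈ M.FnDeg 0 := by
    have := SetLike.mul_mem_graded hh hh
    rwa [add_zero, ← pow_two] at this
  rw [hG.form_lift₂_lift₂ hp, hG.form_lift₂_lift₂ hp, hG.form_lift₂_lift₂ hp,
    (hp.hasDeg_lift₂ hU).app_mul (π₁.star_mem h2), hp.lift₂_app', zero_mul, zero_add, mul_zero,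
    sgn_zero, one_smul, hp.lift₂_app, hLN.metric _ _ _ _ _ hU hV, map_add, map_units_smul, mul_add,
    units_mul_smul_comm]

/-- Homogeneous vector fields together with their degrees. -/
abbrev HomogeneousVect (M : SuperSpace.{u}) : Type u :=
  {p : ZMod 2 × M.Vect // p.2.HasDeg p.1}

/-- The values of the Levi-Civita connection of a warped product on lifts. -/
noncomputable def warpedCov (π₁ : Hom M₁.toSuperSpace M.toSuperSpace)
    (π₂ : Hom M₁.toSuperSpace N.toSuperSpace) (g₁ : Metric M.toSuperSpace d) (h : M.Fnˣ)
    (G : SymmForm M₁.toSuperSpace d) (LM : Connection M.toSuperSpace)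
    (LN : Connection N.toSuperSpace) :
    HomogeneousVect M.toSuperSpace ⊕ HomogeneousVect N.toSuperSpace →
      HomogeneousVect M.toSuperSpace ⊕ HomogeneousVect N.toSuperSpace → M₁.Vect
  | .inl X, .inl Y => lift₁ π₁ π₂ (LM.cov X.1.2 Y.1.2)
  | .inl X, .inr U => π₁.star (logDer h X.1.2) • lift₂ π₁ π₂ U.1.2
  | .inr U, .inl X => sgn (U.1.1 * X.1.1) • π₁.star (logDer h X.1.2) • lift₂ π₁ π₂ U.1.2
  | .inr U, .inr V => lift₂ π₁ π₂ (LN.cov U.1.2 V.1.2) -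
      G.form (lift₂ π₁ π₂ U.1.2) (lift₂ π₁ π₂ V.1.2) • lift₁ π₁ π₂ (h⁻¹.val • grad g₁ h)

/-- The Levi-Civita connection of a warped product on lifts. -/
theorem cov_lift (hp : IsProduct π₁ π₂) (hh : (h : M.Fn) ∈ M.FnDeg 0)
    (hG : IsWarped π₁ π₂ g₁.toSymmForm g₂.toSymmForm ((h : M.Fn) ^ 2) G)
    (hLM : IsLeviCivita g₁.toSymmForm LM) (hLN : IsLeviCivita g₂.toSymmForm LN)
    (hLμ : IsLeviCivita G Lμ)
    (a b : HomogeneousVect M.toSuperSpace ⊕ HomogeneousVect N.toSuperSpace) :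
    Lμ.cov (Sum.elim (fun X => lift₁ π₁ π₂ X.1.2) (fun U => lift₂ π₁ π₂ U.1.2) a)
      (Sum.elim (fun X => lift₁ π₁ π₂ X.1.2) (fun U => lift₂ π₁ π₂ U.1.2) b) =
      warpedCov π₁ π₂ g₁ h G LM LN a b := by
  have hQ : (lift₁ π₁ π₂ (h⁻¹.val • grad g₁ h.val)).HasDeg d :=
    hp.hasDeg_lift₁ (hasDeg_inv_smul_grad hh)
  -- What remains is to check degrees, nondegeneracy, torsion and metric compatibility of the
  -- candidate values, according to the factors from which the arguments come.
  refine hLμ.cov_eq (a := Sum.elim (fun X => X.1.1) (fun U => U.1.1)) ?_ ?_ ?_ ?_ ?_ a b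
  · rintro (⟨⟨x, X⟩, hX⟩ | ⟨⟨u, U⟩, hU⟩)
    · exact hp.hasDeg_lift₁ hX
    · exact hp.hasDeg_lift₂ hU
  · rintro (⟨⟨x, X⟩, hX⟩ | ⟨⟨u, U⟩, hU⟩) (⟨⟨y, Y⟩, hY⟩ | ⟨⟨v, V⟩, hV⟩)
    · exact hp.hasDeg_lift₁ (LM.deg _ _ _ _ hX hY)
    · exact (hp.hasDeg_lift₂ hV).fn_smul (π₁.star_mem (logDer_mem hh hX))
    · have := (hp.hasDeg_lift₂ hU).fn_smul (π₁.star_mem (logDer_mem hh hY))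
      rw [add_comm] at this
      exact this.units_smul _
    · refine (hp.hasDeg_lift₂ (LN.deg _ _ _ _ hU hV)).sub ?_
      have := hQ.fn_smul (G.deg u v _ _ (hp.hasDeg_lift₂ hU) (hp.hasDeg_lift₂ hV))
      rwa [add_assoc, CharTwo.add_self_eq_zero, add_zero] at this
  · intro k C hC h'
    exact hG.eq_zero hp (h.isUnit.pow 2) hC (fun i X hX => h' (.inl ⟨(i, X), hX⟩))
      fun i U hU => h' (.inr ⟨(i, U), hU⟩)
  · rintro (⟨⟨x, X⟩, hX⟩ | ⟨⟨u, U⟩, hU⟩) (⟨⟨y, Y⟩, hY⟩ | ⟨⟨v, V⟩, hV⟩)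
    · change lift₁ π₁ π₂ (LM.cov X Y) - sgn (x * y) • lift₁ π₁ π₂ (LM.cov Y X) =
        (lift₁ π₁ π₂ X).bracket (lift₁ π₁ π₂ Y)
      rw [hp.bracket_lift₁ hX hY, ← hp.lift₁_units_smul, ← hp.lift₁_sub]
      exact congrArg _ (Vect.sub_eq_zero.1 (hLM.torsion_free _ _ _ _ hX hY))
    · change π₁.star (logDer h X) • lift₂ π₁ π₂ V -
        sgn (x * v) • sgn (v * x) • π₁.star (logDer h X) • lift₂ π₁ π₂ V =
        (lift₁ π₁ π₂ X).bracket (lift₂ π₁ π₂ V)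
      rw [hp.bracket_lift₁_lift₂ hX hV, smul_smul, mul_comm v, sgn_mul_self, one_smul,
        Vect.sub_self]
    · change sgn (u * y) • π₁.star (logDer h Y) • lift₂ π₁ π₂ U -
        sgn (u * y) • π₁.star (logDer h Y) • lift₂ π₁ π₂ U =
        (lift₂ π₁ π₂ U).bracket (lift₁ π₁ π₂ Y)
      rw [hp.bracket_lift₂_lift₁ hY hU, Vect.sub_self]
    · change lift₂ π₁ π₂ (LN.cov U V) - G.form (lift₂ π₁ π₂ U) (lift₂ π₁ π₂ V) • _ -
        sgn (u * v) • (lift₂ π₁ π₂ (LN.cov V U) - G.form (lift₂ π₁ π₂ V) (lift₂ π₁ π₂ U) • _) =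
        (lift₂ π₁ π₂ U).bracket (lift₂ π₁ π₂ V)
      rw [hp.bracket_lift₂ hU hV, ← Vect.sub_eq_zero.1 (hLN.torsion_free _ _ _ _ hU hV),
        hp.lift₂_sub, hp.lift₂_units_smul, Vect.units_smul_sub,
        G.symm _ _ _ _ (hp.hasDeg_lift₂ hU) (hp.hasDeg_lift₂ hV), units_smul_fn_smul]
      abel
  · rintro (⟨⟨x, X⟩, hX⟩ | ⟨⟨u, U⟩, hU⟩) (⟨⟨y, Y⟩, hY⟩ | ⟨⟨v, V⟩, hV⟩)
      (⟨⟨z, Z⟩, hZ⟩ | ⟨⟨w, W⟩, hW⟩)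
    · change (lift₁ π₁ π₂ X).app (G.form (lift₁ π₁ π₂ Y) (lift₁ π₁ π₂ Z)) =
        G.form (lift₁ π₁ π₂ (LM.cov X Y)) (lift₁ π₁ π₂ Z) +
          sgn (x * y) • G.form (lift₁ π₁ π₂ Y) (lift₁ π₁ π₂ (LM.cov X Z))
      rw [hG.form_lift₁_lift₁ hp, hG.form_lift₁_lift₁ hp, hG.form_lift₁_lift₁ hp, hp.lift₁_app,
        hLM.metric _ _ _ _ _ hX hY, map_add, map_units_smul]
    · change (lift₁ π₁ π₂ X).app (G.form (lift₁ π₁ π₂ Y) (lift₂ π₁ π₂ W)) =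
        G.form (lift₁ π₁ π₂ (LM.cov X Y)) (lift₂ π₁ π₂ W) +
          sgn (x * y) • G.form (lift₁ π₁ π₂ Y) (π₁.star (logDer h X) • lift₂ π₁ π₂ W)
      rw [G.smul_right (hp.hasDeg_lift₁ hY) (hp.hasDeg_lift₂ hW) (π₁.star_mem (logDer_mem hh hX)),
        hG.form_lift₁_lift₂ hp, hG.form_lift₁_lift₂ hp]
      simp
    · change (lift₁ π₁ π₂ X).app (G.form (lift₂ π₁ π₂ V) (lift₁ π₁ π₂ Z)) =
        G.form (π₁.star (logDer h X) • lift₂ π₁ π₂ V) (lift₁ π₁ π₂ Z) +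
          sgn (x * v) • G.form (lift₂ π₁ π₂ V) (lift₁ π₁ π₂ (LM.cov X Z))
      rw [G.smul_left, hG.form_lift₂_lift₁ hp, hG.form_lift₂_lift₁ hp]
      simp
    · change (lift₁ π₁ π₂ X).app (G.form (lift₂ π₁ π₂ V) (lift₂ π₁ π₂ W)) =
        G.form (π₁.star (logDer h X) • lift₂ π₁ π₂ V) (lift₂ π₁ π₂ W) +
          sgn (x * v) • G.form (lift₂ π₁ π₂ V) (π₁.star (logDer h X) • lift₂ π₁ π₂ W)
      rw [lift₁_app_form hp hh hG hX, G.smul_left, G.smul_right (hp.hasDeg_lift₂ hV)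
        (hp.hasDeg_lift₂ hW) (π₁.star_mem (logDer_mem hh hX)), smul_smul, mul_comm v,
        sgn_mul_self, one_smul]
    · change (lift₂ π₁ π₂ U).app (G.form (lift₁ π₁ π₂ Y) (lift₁ π₁ π₂ Z)) =
        G.form (sgn (u * y) • π₁.star (logDer h Y) • lift₂ π₁ π₂ U) (lift₁ π₁ π₂ Z) +
          sgn (u * y) • G.form (lift₁ π₁ π₂ Y)
            (sgn (u * z) • π₁.star (logDer h Z) • lift₂ π₁ π₂ U)
      rw [hG.form_lift₁_lift₁ hp, hp.lift₂_app', map_units_smul_left, G.smul_left,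
        hG.form_lift₂_lift₁ hp, Vect.map_units_smul, G.smul_right (hp.hasDeg_lift₁ hY)
        (hp.hasDeg_lift₂ hU) (π₁.star_mem (logDer_mem hh hZ)), hG.form_lift₁_lift₂ hp]
      simp
    · change (lift₂ π₁ π₂ U).app (G.form (lift₁ π₁ π₂ Y) (lift₂ π₁ π₂ W)) =
        G.form (sgn (u * y) • π₁.star (logDer h Y) • lift₂ π₁ π₂ U) (lift₂ π₁ π₂ W) +
          sgn (u * y) • G.form (lift₁ π₁ π₂ Y) (lift₂ π₁ π₂ (LN.cov U W) -
            G.form (lift₂ π₁ π₂ U) (lift₂ π₁ π₂ W) • lift₁ π₁ π₂ (h⁻¹.val • grad g₁ h))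
      have hUW := G.deg u w _ _ (hp.hasDeg_lift₂ hU) (hp.hasDeg_lift₂ hW)
      have hc := M₁.supercomm ⊤ _ _ _ _ (π₁.star_mem (logDer_mem hh hY)) hUW
      rw [hG.form_lift₁_lift₂ hp, Vect.app_zero, map_units_smul_left, G.smul_left, Vect.map_sub,
        hG.form_lift₁_lift₂ hp, zero_sub, G.smul_right (hp.hasDeg_lift₁ hY) hQ hUW,
        hG.form_lift₁_lift₁ hp, form_inv_smul_grad hh, hc, smul_neg, add_neg_cancel]
    · change (lift₂ π₁ π₂ U).app (G.form (lift₂ π₁ π₂ V) (lift₁ π₁ π₂ Z)) =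
        G.form (lift₂ π₁ π₂ (LN.cov U V) - G.form (lift₂ π₁ π₂ U) (lift₂ π₁ π₂ V) •
          lift₁ π₁ π₂ (h⁻¹.val • grad g₁ h)) (lift₁ π₁ π₂ Z) +
          sgn (u * v) • G.form (lift₂ π₁ π₂ V)
            (sgn (u * z) • π₁.star (logDer h Z) • lift₂ π₁ π₂ U)
      replace hU : U.HasDeg u := hU
      replace hV : V.HasDeg v := hV
      replace hZ : Z.HasDeg z := hZ
      have hUV := G.deg u v _ _ (hp.hasDeg_lift₂ hU) (hp.hasDeg_lift₂ hV)
      have hc := M₁.supercomm ⊤ _ _ _ _ (π₁.star_mem (logDer_mem hh hZ)) hUV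
      rw [hG.form_lift₂_lift₁ hp, Vect.app_zero, Vect.map_sub, AddMonoidHom.sub_apply, G.smul_left,
        hG.form_lift₂_lift₁ hp, zero_sub, hG.form_lift₁_lift₁ hp,
        g₁.symm _ _ _ _ (hasDeg_inv_smul_grad hh) hZ, form_inv_smul_grad hh, Vect.map_units_smul,
        G.smul_right (hp.hasDeg_lift₂ hV)
        (hp.hasDeg_lift₂ hU) (π₁.star_mem (logDer_mem hh hZ)), map_units_smul,
        units_mul_smul_comm, G.symm _ _ _ _ (hp.hasDeg_lift₂ hV) (hp.hasDeg_lift₂ hU),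
        units_mul_smul_comm, hc, smul_smul, smul_smul, smul_smul, smul_smul]
      -- Exchanging U and V in the form and moving Z(h)/h past it leaves exactly the sign of
      -- g₁(grad(h)/h, Z) against Z(h)/h.
      have sg : ∀ u v z d : ZMod 2, sgn (u * v) * sgn (u * z) * (-1) ^ (v * z) * (-1) ^ (v * u) *
          (-1) ^ (z * (u + v + d)) = sgn (d * z) := by decide
      rw [sg, neg_add_cancel]
    · change (lift₂ π₁ π₂ U).app (G.form (lift₂ π₁ π₂ V) (lift₂ π₁ π₂ W)) =
        G.form (lift₂ π₁ π₂ (LN.cov U V) - G.form (lift₂ π₁ π₂ U) (lift₂ π₁ π₂ V) •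
          lift₁ π₁ π₂ (h⁻¹.val • grad g₁ h)) (lift₂ π₁ π₂ W) +
          sgn (u * v) • G.form (lift₂ π₁ π₂ V) (lift₂ π₁ π₂ (LN.cov U W) -
            G.form (lift₂ π₁ π₂ U) (lift₂ π₁ π₂ W) • lift₁ π₁ π₂ (h⁻¹.val • grad g₁ h))
      rw [lift₂_app_form hp hh hG hLN hU hV, Vect.map_sub, Vect.map_sub, AddMonoidHom.sub_apply,
        G.smul_left, hG.form_lift₁_lift₂ hp, G.smul_right (hp.hasDeg_lift₂ hV) hQ
        (G.deg u w _ _ (hp.hasDeg_lift₂ hU) (hp.hasDeg_lift₂ hW)), hG.form_lift₂_lift₁ hp]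
      simp

section

variable (hp : IsProduct π₁ π₂) (hh : (h : M.Fn) ∈ M.FnDeg 0)
    (hG : IsWarped π₁ π₂ g₁.toSymmForm g₂.toSymmForm ((h : M.Fn) ^ 2) G)
    (hLM : IsLeviCivita g₁.toSymmForm LM) (hLN : IsLeviCivita g₂.toSymmForm LN)
    (hLμ : IsLeviCivita G Lμ)

include hp hh hG hLM hLN hLμ

theorem cov_lift₁_lift₁ (hX : X.HasDeg i) (hY : Y.HasDeg j) :
    Lμ.cov (lift₁ π₁ π₂ X) (lift₁ π₁ π₂ Y) = lift₁ π₁ π₂ (LM.cov X Y) :=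
  cov_lift hp hh hG hLM hLN hLμ (.inl ⟨(i, X), hX⟩) (.inl ⟨(j, Y), hY⟩)

theorem cov_lift₁_lift₂ (hX : X.HasDeg i) (hU : U.HasDeg j) :
    Lμ.cov (lift₁ π₁ π₂ X) (lift₂ π₁ π₂ U) = π₁.star (logDer h X) • lift₂ π₁ π₂ U :=
  cov_lift hp hh hG hLM hLN hLμ (.inl ⟨(i, X), hX⟩) (.inr ⟨(j, U), hU⟩)

theorem cov_lift₂_lift₁ (hU : U.HasDeg i) (hX : X.HasDeg j) :
    Lμ.cov (lift₂ π₁ π₂ U) (lift₁ π₁ π₂ X) =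
      sgn (i * j) • π₁.star (logDer h X) • lift₂ π₁ π₂ U :=
  cov_lift hp hh hG hLM hLN hLμ (.inr ⟨(i, U), hU⟩) (.inl ⟨(j, X), hX⟩)

theorem cov_lift₂_lift₂ (hU : U.HasDeg i) (hV : V.HasDeg j) :
    Lμ.cov (lift₂ π₁ π₂ U) (lift₂ π₁ π₂ V) = lift₂ π₁ π₂ (LN.cov U V) -
      G.form (lift₂ π₁ π₂ U) (lift₂ π₁ π₂ V) • lift₁ π₁ π₂ (h⁻¹.val • grad g₁ h) :=
  cov_lift hp hh hG hLM hLN hLμ (.inr ⟨(i, U), hU⟩) (.inr ⟨(j, V), hV⟩)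

end

end WarpedConnection

/-! ### Identities on the base for β and Q -/

section Base

variable {M : SuperSpace.{u}} {h : M.Fnˣ} {i j d : ZMod 2} {P X Y : M.Vect} {g : Metric M d}
  {L : Connection M}

/-- The one-form `X ↦ X(h) / h + g(X, P)`. -/
def logForm (g : Metric M d) (h : M.Fnˣ) (P X : M.Vect) : M.Fn := logDer h X + g.form X P

theorem logForm_mem (hh : (h : M.Fn) ∈ M.FnDeg 0) (hP : P.HasDeg d) (hX : X.HasDeg i) :
    logForm g h P X ∈ M.FnDeg i := add_mem (logDer_mem hh hX) (form_mem hX hP)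

/-- The vector field `(grad h) / h + P`. -/
noncomputable def logField (g : Metric M d) (h : M.Fnˣ) (P : M.Vect) : M.Vect :=
  h⁻¹.val • grad g h.val + P

theorem hasDeg_logField (hh : (h : M.Fn) ∈ M.FnDeg 0) (hP : P.HasDeg d) :
    (logField g h P).HasDeg d := (hasDeg_inv_smul_grad hh).add hP

theorem logDer_bracket (hX : X.HasDeg i) (hY : Y.HasDeg j) :
    logDer h (X.bracket Y) =
      X.app (Y.app h) * h⁻¹.val - sgn (i * j) • (Y.app (X.app h) * h⁻¹.val) := by
  rw [logDer, hX.bracket_app hY, sub_mul, units_smul_mul_assoc]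

/-- This is the coefficient in R(V,X)Y. Metric compatibility expands X(g(Y,P)). Then g(∇^L_X Y, P),
the quadratic term in d log h, and g(Y,P) X(h)/h, which reappears through X · g(Y,P), all cancel. -/
theorem app_logForm (hh : (h : M.Fn) ∈ M.FnDeg 0) (hL : IsLeviCivita g.toSymmForm L)
    (hP : P.HasDeg d) (hX : X.HasDeg i) (hY : Y.HasDeg j) :
    X.app (logForm g h P Y) + sgn (i * j) • (logForm g h P Y * logDer h X) -
        logForm g h P (semiSymm g.toSymmForm L P X Y) =
      hessian L h X Y * h⁻¹.val + sgn (i * j) • g.form Y (L.cov X P)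
        + g.form X Y * (P.app h * h⁻¹.val) + g.form X Y * g.form P P
        - g.form X P * g.form Y P := by
  have hc : g.form X P * g.form Y P = sgn (i * j) • (g.form Y P * g.form X P) :=
    M.supercomm ⊤ i j _ _ (form_mem hX hP) (form_mem hY hP)
  have e : logForm g h P (semiSymm g.toSymmForm L P X Y) =
      logForm g h P (L.cov X Y) + sgn (i * j) • (g.form Y P * logForm g h P X) -
        g.form X Y * logForm g h P P := by
    simp only [logForm, semiSymm, hX.rmul_eq (form_mem hY hP), logDer_sub, logDer_add,
      logDer_units_smul, logDer_smul, Vect.map_sub, map_add, AddMonoidHom.sub_apply,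
      AddMonoidHom.add_apply, map_units_smul_left, g.smul_left, mul_add, smul_add]
    abel
  rw [e]
  simp only [logForm, Vect.app_add, app_logDer hh hX hY, hL.metric _ _ _ _ _ hX hY, hessian,
    sub_mul, add_mul, mul_add, smul_add, hc]
  simp only [logDer]
  abel

theorem inv_smul_grad_form (hh : (h : M.Fn) ∈ M.FnDeg 0) (hP : P.HasDeg d) :
    g.form (h⁻¹.val • grad g h.val) P = sgn d • logDer h P := by
  have sg : ∀ d : ZMod 2, (-1 : ℤˣ) ^ (d * d) = sgn d := by decide
  rw [g.symm _ _ _ _ (hasDeg_inv_smul_grad hh) hP, form_inv_smul_grad hh, sg]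

/-- This is the vector field in R(X,V)W. The derivative of 1/h removes (X(h)/h) grad(h)/h, and the
term (X(h)/h) P cancels against g(X, grad(h)/h) P. -/
theorem semiSymm_logField (hh : (h : M.Fn) ∈ M.FnDeg 0) (hP : P.HasDeg d) (hX : X.HasDeg i) :
    logDer h X • logField g h P + semiSymm g.toSymmForm L P X (logField g h P) =
      h⁻¹.val • L.cov X (grad g h.val) + sgn ((i + d) * d) • (P.app h * h⁻¹.val) • X
        + L.cov X P + X.rmul (g.form P P) - g.form X P • P := by
  have e₁ : L.cov X (h⁻¹.val • grad g h.val) =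
      -(logDer h X • h⁻¹.val • grad g h.val) + h⁻¹.val • L.cov X (grad g h.val) := by
    rw [L.leibniz i 0 _ _ _ hX (inv_mem_even hh), mul_zero, uzpow_zero, one_smul, app_inv hh hX,
      Vect.neg_smul, mul_smul]
  have e₃ : X.rmul (sgn d • logDer h P) = sgn ((i + d) * d) • (P.app h * h⁻¹.val) • X := by
    rw [hX.rmul_eq (units_smul_mem _ (logDer_mem hh hP)), units_smul_fn_smul, smul_smul]
    have sg : ∀ i d : ZMod 2, sgn (i * d) * sgn d = sgn ((i + d) * d) := by decide
    rw [sg]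
    rfl
  rw [semiSymm, logField, map_add, map_add, AddMonoidHom.add_apply, map_add, e₁, inv_smul_grad_form hh hP, Vect.rmul_add,
    e₃, form_inv_smul_grad hh, smul_add, add_smul]
  abel

theorem form_logField (hh : (h : M.Fn) ∈ M.FnDeg 0) (hP : P.HasDeg d) :
    logForm g h P (logField g h P) =
      (grad g h.val).app h * h⁻¹.val ^ 2 + P.app h * h⁻¹.val + sgn d • (P.app h * h⁻¹.val) +
        g.form P P := by
  rw [logForm, logField, logDer_add, map_add, AddMonoidHom.add_apply, inv_smul_grad_form hh hP, logDer_smul,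
    commute_even (inv_mem_even hh), logDer, mul_assoc, ← pow_two]
  simp only [logDer]
  abel

end Base

/-! ### The semi-symmetric connection of the warped product on lifts -/

section Product

variable {M N M₁ : SuperManifold.{u}} {π₁ : Hom M₁.toSuperSpace M.toSuperSpace}
  {π₂ : Hom M₁.toSuperSpace N.toSuperSpace} {d : ZMod 2} {g₁ : Metric M.toSuperSpace d}
  {g₂ : Metric N.toSuperSpace d} {h : M.Fnˣ} {G : SymmForm M₁.toSuperSpace d}
  {LM : Connection M.toSuperSpace} {LN : Connection N.toSuperSpace}
  {Lμ : Connection M₁.toSuperSpace} {i j k : ZMod 2} {P X Y Z : M.Vect} {U V W : N.Vect}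
  {f : M.Fn}

theorem IsProduct.lift₁_rmul (hp : IsProduct π₁ π₂) (hX : X.HasDeg i) (hf : f ∈ M.FnDeg j) :
    (lift₁ π₁ π₂ X).rmul (π₁.star f) = lift₁ π₁ π₂ (X.rmul f) := by
  rw [hX.rmul_eq hf, (hp.hasDeg_lift₁ hX).rmul_eq (π₁.star_mem hf), hp.lift₁_units_smul,
    hp.lift₁_smul]

variable (hp : IsProduct π₁ π₂) (hh : (h : M.Fn) ∈ M.FnDeg 0)
    (hG : IsWarped π₁ π₂ g₁.toSymmForm g₂.toSymmForm ((h : M.Fn) ^ 2) G)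
    (hLM : IsLeviCivita g₁.toSymmForm LM) (hLN : IsLeviCivita g₂.toSymmForm LN)
    (hLμ : IsLeviCivita G Lμ) (hP : P.HasDeg d)

include hp hh hG hLM hLN hLμ

include hP in
theorem semiSymm_lift₁_lift₁ (hX : X.HasDeg i) (hY : Y.HasDeg j) :
    semiSymm G Lμ (lift₁ π₁ π₂ P) (lift₁ π₁ π₂ X) (lift₁ π₁ π₂ Y) =
      lift₁ π₁ π₂ (semiSymm g₁.toSymmForm LM P X Y) := by
  rw [semiSymm, semiSymm, cov_lift₁_lift₁ hp hh hG hLM hLN hLμ hX hY, hG.form_lift₁_lift₁ hp,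
    hG.form_lift₁_lift₁ hp, hp.lift₁_rmul hX (form_mem hY hP), hp.lift₁_sub, hp.lift₁_add,
    hp.lift₁_smul]

/-- The lift of P is horizontal, so U is orthogonal to it and both correction terms vanish. -/
theorem semiSymm_lift₁_lift₂ (P : M.Vect) (hX : X.HasDeg i) (hU : U.HasDeg j) :
    semiSymm G Lμ (lift₁ π₁ π₂ P) (lift₁ π₁ π₂ X) (lift₂ π₁ π₂ U) =
      π₁.star (logDer h X) • lift₂ π₁ π₂ U := by
  rw [semiSymm, cov_lift₁_lift₂ hp hh hG hLM hLN hLμ hX hU, hG.form_lift₂_lift₁ hp,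
    hG.form_lift₁_lift₂ hp, zero_smul, Vect.sub_zero,
    (hp.hasDeg_lift₁ hX).rmul_eq (zero_mem (M₁.FnDeg 0)), zero_smul, smul_zero, add_zero]

include hP in
theorem semiSymm_lift₂_lift₁ (hU : U.HasDeg i) (hX : X.HasDeg j) :
    semiSymm G Lμ (lift₁ π₁ π₂ P) (lift₂ π₁ π₂ U) (lift₁ π₁ π₂ X) =
      sgn (i * j) • π₁.star (logForm g₁ h P X) • lift₂ π₁ π₂ U := by
  rw [semiSymm, cov_lift₂_lift₁ hp hh hG hLM hLN hLμ hU hX, hG.form_lift₂_lift₁ hp,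
    hG.form_lift₁_lift₁ hp, zero_smul, Vect.sub_zero,
    (hp.hasDeg_lift₂ hU).rmul_eq (π₁.star_mem (form_mem hX hP)), logForm, map_add, add_smul,
    smul_add]

theorem semiSymm_lift₂_lift₂ (P : M.Vect) (hU : U.HasDeg i) (hV : V.HasDeg j) :
    semiSymm G Lμ (lift₁ π₁ π₂ P) (lift₂ π₁ π₂ U) (lift₂ π₁ π₂ V) =
      lift₂ π₁ π₂ (LN.cov U V) -
        G.form (lift₂ π₁ π₂ U) (lift₂ π₁ π₂ V) • lift₁ π₁ π₂ (logField g₁ h P) := by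
  rw [semiSymm, cov_lift₂_lift₂ hp hh hG hLM hLN hLμ hU hV, hG.form_lift₂_lift₁ hp,
    (hp.hasDeg_lift₂ hU).rmul_eq (zero_mem (M₁.FnDeg 0)), zero_smul, smul_zero, add_zero, logField,
    hp.lift₁_add, smul_add]
  abel

/-! ### Curvature on lifts -/

include hP

theorem semiSymmCurvature_lift₁_lift₁_lift₁ (hX : X.HasDeg i) (hY : Y.HasDeg j) (hZ : Z.HasDeg k) :
    semiSymmCurvature G Lμ (lift₁ π₁ π₂ P) (lift₁ π₁ π₂ X) (lift₁ π₁ π₂ Y) (lift₁ π₁ π₂ Z) =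
      lift₁ π₁ π₂ (semiSymmCurvature g₁.toSymmForm LM P X Y Z) := by
  have hd := fun {i j : ZMod 2} {X Y : M.Vect} (hX : X.HasDeg i) (hY : Y.HasDeg j) =>
    semiSymm_lift₁_lift₁ hp hh hG hLM hLN hLμ hP hX hY
  rw [semiSymmCurvature_eq (hp.hasDeg_lift₁ hX) (hp.hasDeg_lift₁ hY), semiSymmCurvature_eq hX hY,
    hp.bracket_lift₁ hX hY, hd hY hZ, hd hX hZ, hd hX (hasDeg_semiSymm hP hY hZ),
    hd hY (hasDeg_semiSymm hP hX hZ), hd (hX.bracket hY) hZ, hp.lift₁_sub, hp.lift₁_sub,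
    hp.lift₁_units_smul]

/-- The fields V and X commute, so only the two iterated derivatives matter: ∇_V∇_X Y gives β(∇_X Y)
V, and ∇_X(β(Y) V) gives the other two terms. -/
theorem semiSymmCurvature_lift₂_lift₁_lift₁ (hV : V.HasDeg k) (hX : X.HasDeg i) (hY : Y.HasDeg j) :
    semiSymmCurvature G Lμ (lift₁ π₁ π₂ P) (lift₂ π₁ π₂ V) (lift₁ π₁ π₂ X) (lift₁ π₁ π₂ Y) =
      -(sgn (k * (i + j)) • π₁.star (X.app (logForm g₁ h P Y) +
        sgn (i * j) • (logForm g₁ h P Y * logDer h X) -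
        logForm g₁ h P (semiSymm g₁.toSymmForm LM P X Y)) • lift₂ π₁ π₂ V) := by
  rw [semiSymmCurvature_eq (hp.hasDeg_lift₂ hV) (hp.hasDeg_lift₁ hX), hp.bracket_lift₂_lift₁ hX hV,
    semiSymm_zero_left, Vect.sub_zero, semiSymm_lift₁_lift₁ hp hh hG hLM hLN hLμ hP hX hY,
    semiSymm_lift₂_lift₁ hp hh hG hLM hLN hLμ hP hV (hasDeg_semiSymm hP hX hY),
    semiSymm_lift₂_lift₁ hp hh hG hLM hLN hLμ hP hV hY, semiSymm_units_smul_right,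
    semiSymm_leibniz (hp.hasDeg_lift₁ hP) (hp.hasDeg_lift₁ hX) (hp.hasDeg_lift₂ hV)
      (π₁.star_mem (logForm_mem hh hP hY)), hp.lift₁_app,
    semiSymm_lift₁_lift₂ hp hh hG hLM hLN hLμ P hX hV, smul_smul (sgn (k * i)), mul_add k i j,
    sgn_add, map_sub, map_add, map_units_smul, map_mul, Vect.sub_smul, add_smul, units_smul_fn_smul,
    mul_smul (π₁.star _) (π₁.star _), Vect.units_smul_sub]
  abel

/-- Along horizontal directions ∇ acts on V through the one-form d log h, which is closed. -/
theorem semiSymmCurvature_lift₁_lift₁_lift₂ (hX : X.HasDeg i) (hY : Y.HasDeg j) (hV : V.HasDeg k) :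
    semiSymmCurvature G Lμ (lift₁ π₁ π₂ P) (lift₁ π₁ π₂ X) (lift₁ π₁ π₂ Y) (lift₂ π₁ π₂ V) = 0 := by
  have hX' := hp.hasDeg_lift₁ hX
  have hY' := hp.hasDeg_lift₁ hY
  have hV' := hp.hasDeg_lift₂ hV
  have hP' := hp.hasDeg_lift₁ hP
  have hd := fun i (X : M.Vect) (hX : X.HasDeg i) =>
    semiSymm_lift₁_lift₂ hp hh hG hLM hLN hLμ P hX hV
  rw [semiSymmCurvature_eq hX' hY', hp.bracket_lift₁ hX hY, hd _ _ hX, hd _ _ hY,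
    hd _ _ (hX.bracket hY), semiSymm_leibniz hP' hX' hV' (π₁.star_mem (logDer_mem hh hY)),
    semiSymm_leibniz hP' hY' hV' (π₁.star_mem (logDer_mem hh hX)), hd _ _ hX, hd _ _ hY,
    hp.lift₁_app, hp.lift₁_app, app_logDer hh hX hY, app_logDer hh hY hX, logDer_bracket hX hY]
  simp only [map_sub, map_units_smul, Vect.sub_smul, units_smul_fn_smul, Vect.units_smul_sub,
    smul_add, smul_smul, map_mul, mul_comm j i, sgn_mul_self, one_smul]
  abel

/-- Vertical fields kill β(X). Up to sign the rest is β(X) times the torsion of ∇ on V and W, which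
vanishes: `LN` is torsion-free and the multiples of Q cancel by symmetry of the form. -/
theorem semiSymmCurvature_lift₂_lift₂_lift₁ (hV : V.HasDeg i) (hW : W.HasDeg j) (hX : X.HasDeg k) :
    semiSymmCurvature G Lμ (lift₁ π₁ π₂ P) (lift₂ π₁ π₂ V) (lift₂ π₁ π₂ W) (lift₁ π₁ π₂ X) = 0 := by
  have hX' := hp.hasDeg_lift₁ hX
  have hW' := hp.hasDeg_lift₂ hW
  have hV' := hp.hasDeg_lift₂ hV
  have hP' := hp.hasDeg_lift₁ hP
  have hd := fun i (V : N.Vect) (hV : V.HasDeg i) =>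
    semiSymm_lift₂_lift₁ hp hh hG hLM hLN hLμ hP hV hX
  have hβ := π₁.star_mem (logForm_mem (g := g₁) hh hP hX)
  have ht : LN.cov V W = sgn (i * j) • LN.cov W V + V.bracket W := by
    rw [← Vect.sub_eq_zero.1 (hLN.torsion_free _ _ _ _ hV hW)]
    abel
  rw [semiSymmCurvature_eq hV' hW', hp.bracket_lift₂ hV hW, hd _ _ hV, hd _ _ hW,
    hd _ _ (hV.bracket hW), semiSymm_units_smul_right, semiSymm_units_smul_right,
    semiSymm_leibniz hP' hV' hW' hβ, semiSymm_leibniz hP' hW' hV' hβ, hp.lift₂_app', hp.lift₂_app',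
    zero_smul, zero_smul, zero_add, zero_add,
    semiSymm_lift₂_lift₂ hp hh hG hLM hLN hLμ P hV hW,
    semiSymm_lift₂_lift₂ hp hh hG hLM hLN hLμ P hW hV, G.symm _ _ _ _ hV' hW', ht,
    hp.lift₂_add, hp.lift₂_units_smul, add_mul i j k, sgn_add]
  simp only [Vect.fn_smul_sub, smul_add, Vect.units_smul_sub, fn_smul_units_smul,
    units_smul_fn_smul, smul_smul (sgn _)]
  have s₁ : sgn (j * k) * (sgn (i * k) * sgn (i * j)) =
      sgn (i * j) * (sgn (i * k) * sgn (j * k)) := by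
    rw [mul_comm, mul_comm (sgn (i * k)), mul_assoc]
  rw [s₁, mul_comm (sgn (j * k)) (sgn (i * k))]
  abel

/-- The terms in ∇^N_V W cancel. Differentiating g_μ(V,W) along X yields two copies of (X(h)/h)
g_μ(V,W) Q, and ∇_V∇_X W removes one of them. There remain (X(h)/h) Q and ∇_X Q. -/
theorem semiSymmCurvature_lift₁_lift₂_lift₂ (hX : X.HasDeg i) (hV : V.HasDeg j) (hW : W.HasDeg k) :
    semiSymmCurvature G Lμ (lift₁ π₁ π₂ P) (lift₁ π₁ π₂ X) (lift₂ π₁ π₂ V) (lift₂ π₁ π₂ W) =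
      -(sgn (i * (j + k + d)) • G.form (lift₂ π₁ π₂ V) (lift₂ π₁ π₂ W) •
        lift₁ π₁ π₂ (logDer h X • logField g₁ h P +
          semiSymm g₁.toSymmForm LM P X (logField g₁ h P))) := by
  have hX' := hp.hasDeg_lift₁ hX
  have hW' := hp.hasDeg_lift₂ hW
  have hV' := hp.hasDeg_lift₂ hV
  have hP' := hp.hasDeg_lift₁ hP
  have hQ := hasDeg_logField (g := g₁) hh hP
  have hQ' := hp.hasDeg_lift₁ hQ
  have hVW := G.deg j k _ _ hV' hW'
  have hc := M₁.supercomm ⊤ _ _ _ _ (π₁.star_mem (logDer_mem hh hX)) hVW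
  rw [semiSymmCurvature_eq hX' hV', hp.bracket_lift₁_lift₂ hX hV, semiSymm_zero_left,
    Vect.sub_zero, semiSymm_lift₂_lift₂ hp hh hG hLM hLN hLμ P hV hW,
    semiSymm_lift₁_lift₂ hp hh hG hLM hLN hLμ P hX hW, semiSymm_sub_right,
    semiSymm_lift₁_lift₂ hp hh hG hLM hLN hLμ P hX (LN.deg _ _ _ _ hV hW),
    semiSymm_leibniz hP' hX' hQ' hVW, semiSymm_lift₁_lift₁ hp hh hG hLM hLN hLμ hP hX hQ,
    semiSymm_leibniz hP' hV' hW' (π₁.star_mem (logDer_mem hh hX)),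
    semiSymm_lift₂_lift₂ hp hh hG hLM hLN hLμ P hV hW, lift₁_app_form hp hh hG hX,
    hp.lift₂_app', zero_smul, zero_add, smul_smul, mul_comm j i, sgn_mul_self, one_smul,
    hp.lift₁_add, hp.lift₁_smul, smul_add, smul_add, add_smul, ← mul_smul (G.form _ _),
    Vect.fn_smul_sub, ← mul_smul (π₁.star _), hc, units_smul_fn_smul]
  abel

-- All multiples of Q cancel, by metric compatibility and torsion-freeness of `LN`. Besides the
-- curvature of `LN` only the terms from ∇_U Q = ±β(Q) U and ∇_V Q = ±β(Q) V survive.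
set_option maxHeartbeats 1000000 in
theorem semiSymmCurvature_lift₂_lift₂_lift₂ (hU : U.HasDeg i) (hV : V.HasDeg j) (hW : W.HasDeg k) :
    semiSymmCurvature G Lμ (lift₁ π₁ π₂ P) (lift₂ π₁ π₂ U) (lift₂ π₁ π₂ V) (lift₂ π₁ π₂ W) =
      lift₂ π₁ π₂ (LN.curv U V W) +
        sgn (j * k) • (G.form (lift₂ π₁ π₂ U) (lift₂ π₁ π₂ W) *
          π₁.star (logForm g₁ h P (logField g₁ h P))) • lift₂ π₁ π₂ V -
        sgn (i * (j + k)) • (G.form (lift₂ π₁ π₂ V) (lift₂ π₁ π₂ W) *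
          π₁.star (logForm g₁ h P (logField g₁ h P))) • lift₂ π₁ π₂ U := by
  have hU' := hp.hasDeg_lift₂ hU
  have hV' := hp.hasDeg_lift₂ hV
  have hW' := hp.hasDeg_lift₂ hW
  have hP' := hp.hasDeg_lift₁ hP
  have hQ := hasDeg_logField (g := g₁) hh hP
  have hQ' := hp.hasDeg_lift₁ hQ
  have hd := fun {i j : ZMod 2} {U V : N.Vect} (hU : U.HasDeg i) (hV : V.HasDeg j) =>
    semiSymm_lift₂_lift₂ hp hh hG hLM hLN hLμ P hU hV
  have hb : G.form (lift₂ π₁ π₂ (U.bracket V)) (lift₂ π₁ π₂ W) =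
      G.form (lift₂ π₁ π₂ (LN.cov U V)) (lift₂ π₁ π₂ W) -
        sgn (i * j) • G.form (lift₂ π₁ π₂ (LN.cov V U)) (lift₂ π₁ π₂ W) := by
    rw [← Vect.sub_eq_zero.1 (hLN.torsion_free _ _ _ _ hU hV), hp.lift₂_sub, hp.lift₂_units_smul,
      Vect.map_sub, AddMonoidHom.sub_apply, map_units_smul_left]
  have s₁ : ∀ i j k d : ZMod 2, sgn (i * (j + k + d)) * sgn (i * d) = sgn (i * (j + k)) := by
    decide
  have s₂ : ∀ i j k : ZMod 2, sgn (i * j) * sgn (j * (i + k)) = sgn (j * k) := by decide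
  rw [semiSymmCurvature_eq hU' hV', hp.bracket_lift₂ hU hV, hd hV hW, hd hU hW,
    hd (hU.bracket hV) hW, semiSymm_sub_right, semiSymm_sub_right,
    hd hU (LN.deg _ _ _ _ hV hW), hd hV (LN.deg _ _ _ _ hU hW),
    semiSymm_leibniz hP' hU' hQ' (G.deg _ _ _ _ hV' hW'),
    semiSymm_leibniz hP' hV' hQ' (G.deg _ _ _ _ hU' hW'),
    semiSymm_lift₂_lift₁ hp hh hG hLM hLN hLμ hP hU hQ,
    semiSymm_lift₂_lift₁ hp hh hG hLM hLN hLμ hP hV hQ,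
    lift₂_app_form hp hh hG hLN hU hV, lift₂_app_form hp hh hG hLN hV hU, hb,
    Connection.curv_eq hU hV, hp.lift₂_sub, hp.lift₂_sub, hp.lift₂_units_smul,
    fn_smul_units_smul, fn_smul_units_smul, smul_smul (sgn _) (sgn _), smul_smul (sgn _) (sgn _),
    s₁, s₁, ← s₂ i j k]
  simp only [Vect.units_smul_sub, smul_add, add_smul, Vect.sub_smul, units_smul_fn_smul, mul_smul,
    mul_comm j i]
  rw [smul_smul (sgn (i * j)) (sgn (i * j)), sgn_mul_self, one_smul]
  abel

end Product

/-- Moving β(Q), of degree |g|, past F costs a sign. P(h)/h occurs twice in β(Q): from Q(h)/h, and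
with a sign from g(grad(h)/h, P). The second copy is moved to the left of F and the first is left on
its right, whence the asymmetric shape of the formula for R(U,V)W. -/
theorem mul_star_logForm_logField {S M : SuperSpace.{u}} {φ : Hom S M} {d i k : ZMod 2}
    {g : Metric M d} {h : M.Fnˣ} {P : M.Vect} (hh : (h : M.Fn) ∈ M.FnDeg 0) (hP : P.HasDeg d)
    {F : S.Fn} (hF : F ∈ S.FnDeg (i + k + d)) :
    F * φ.star (logForm g h P (logField g h P)) =
      sgn (d * i) • (φ.star (sgn (d * (k + d)) • ((grad g h.val).app h * h⁻¹.val ^ 2) +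
        sgn (d * k) • (P.app h * h⁻¹.val) + sgn (d * (k + d)) • g.form P P) * F) +
      F * φ.star (P.app h * h⁻¹.val) := by
  have h2 : h⁻¹.val ^ 2 ∈ M.FnDeg 0 := by
    have := SetLike.mul_mem_graded (inv_mem_even hh) (inv_mem_even hh)
    rwa [add_zero, ← pow_two] at this
  have hc : ∀ f ∈ M.FnDeg d, F * φ.star f = sgn ((i + k + d) * d) • (φ.star f * F) :=
    fun f hf => S.supercomm ⊤ _ _ _ _ hF (φ.star_mem hf)
  have m₁ : (grad g h.val).app h * h⁻¹.val ^ 2 ∈ M.FnDeg d := by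
    have := SetLike.mul_mem_graded ((hasDeg_grad (g := g) hh).app_mem hh) h2
    rwa [add_zero, add_zero] at this
  have m₂ : P.app h * h⁻¹.val ∈ M.FnDeg d := logDer_mem hh hP
  have s₁ : ∀ d i k : ZMod 2, sgn ((i + k + d) * d) = sgn (d * i) * sgn (d * (k + d)) := by decide
  have s₂ : ∀ d i k : ZMod 2, sgn d * sgn ((i + k + d) * d) = sgn (d * i) * sgn (d * k) := by
    decide
  -- Both copies of P(h)/h are commuted past F; the reverse use of `hc _ m₂` then restores the one
  -- without the factor `sgn d`.
  rw [form_logField hh hP, map_add, map_add, map_add, mul_add, mul_add, mul_add, hc _ m₁,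
    hc _ (form_mem hP hP), map_units_smul, units_mul_smul_comm, hc _ m₂, smul_smul (sgn d), s₂,
    ← hc _ m₂, s₁, map_add, map_add, map_units_smul, map_units_smul, map_units_smul, add_mul,
    add_mul, units_smul_mul_assoc, units_smul_mul_assoc, units_smul_mul_assoc, smul_add, smul_add,
    smul_smul, smul_smul, smul_smul]
  abel

end SuperGeometry

/-! ### The curvature formulas -/

theorem proposition3p5 {M N M₁ : SuperManifold.{u}}
    (π₁ : Hom M₁.toSuperSpace M.toSuperSpace) (π₂ : Hom M₁.toSuperSpace N.toSuperSpace)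
    (hprod : IsProduct π₁ π₂)
    -- the metrics, of common degree `d`, and the warped metric `g_μ`, `μ = h ^ 2`
    (d : ZMod 2) (g₁ : M.Metric d) (g₂ : N.Metric d)
    (h : M.Fnˣ) (hh : (h : M.Fn) ∈ M.FnDeg 0)
    (gμ : M₁.SymmForm d)
    (hgμ : IsWarped π₁ π₂ g₁.toSymmForm g₂.toSymmForm ((h : M.Fn) ^ 2) gμ)
    -- the Levi-Civita connections
    (LM : M.Connection) (LN : N.Connection) (Lμ : M₁.Connection)
    (hLM : IsLeviCivita g₁.toSymmForm LM) (hLN : IsLeviCivita g₂.toSymmForm LN)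
    (hLμ : IsLeviCivita gμ Lμ)
    -- the vector field `P` on the base, with `|g| + |P| = 0`
    (P : M.Vect) (hP : P.HasDeg d)
    -- homogeneous vector fields on the base and on the fiber
    (x y z u v w : ZMod 2) (X Y Z : M.Vect) (U V W : N.Vect)
    (hX : X.HasDeg x) (hY : Y.HasDeg y) (hZ : Z.HasDeg z)
    (hU : U.HasDeg u) (hV : V.HasDeg v) (hW : W.HasDeg w) :
    -- (1)
    semiSymmCurvature gμ Lμ (lift₁ π₁ π₂ P) (lift₁ π₁ π₂ X) (lift₁ π₁ π₂ Y) (lift₁ π₁ π₂ Z) =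
      lift₁ π₁ π₂ (semiSymmCurvature g₁.toSymmForm LM P X Y Z) ∧
    -- (2)
    semiSymmCurvature gμ Lμ (lift₁ π₁ π₂ P) (lift₂ π₁ π₂ V) (lift₁ π₁ π₂ X) (lift₁ π₁ π₂ Y) =
      -(sgn (v * (x + y)) •
        π₁.star (hessian LM h X Y * h⁻¹.val + sgn (x * y) • g₁.form Y (LM.cov X P)
          + g₁.form X Y * (P.app h * h⁻¹.val) + g₁.form X Y * g₁.form P P
          - g₁.form X P * g₁.form Y P) • lift₂ π₁ π₂ V) ∧
    -- (3)
    semiSymmCurvature gμ Lμ (lift₁ π₁ π₂ P) (lift₁ π₁ π₂ X) (lift₁ π₁ π₂ Y) (lift₂ π₁ π₂ V) = 0 ∧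
    -- (4)
    semiSymmCurvature gμ Lμ (lift₁ π₁ π₂ P) (lift₂ π₁ π₂ V) (lift₂ π₁ π₂ W) (lift₁ π₁ π₂ X) = 0 ∧
    -- (5)
    semiSymmCurvature gμ Lμ (lift₁ π₁ π₂ P) (lift₁ π₁ π₂ X) (lift₂ π₁ π₂ V) (lift₂ π₁ π₂ W) =
      -(sgn (x * (v + w + d)) • gμ.form (lift₂ π₁ π₂ V) (lift₂ π₁ π₂ W) •
        lift₁ π₁ π₂ (h⁻¹.val • LM.cov X (grad g₁ h)
          + sgn ((x + d) * d) • (P.app h * h⁻¹.val) • X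
          + LM.cov X P + X.rmul (g₁.form P P) - g₁.form X P • P)) ∧
    (d = 0 →
      semiSymmCurvature gμ Lμ (lift₁ π₁ π₂ P) (lift₁ π₁ π₂ X) (lift₂ π₁ π₂ V) (lift₂ π₁ π₂ W) =
        -(sgn (x * (v + w)) • gμ.form (lift₂ π₁ π₂ V) (lift₂ π₁ π₂ W) •
          lift₁ π₁ π₂ (h⁻¹.val • LM.cov X (grad g₁ h) + (P.app h * h⁻¹.val) • X
            + LM.cov X P + X.rmul (g₁.form P P) - g₁.form X P • P))) ∧
    -- (6)
    semiSymmCurvature gμ Lμ (lift₁ π₁ π₂ P) (lift₂ π₁ π₂ U) (lift₂ π₁ π₂ V) (lift₂ π₁ π₂ W) =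
      lift₂ π₁ π₂ (LN.curv U V W)
        + π₁.star (sgn (d * (w + d)) • ((grad g₁ h).app h * h⁻¹.val ^ 2)
            + sgn (d * w) • (P.app h * h⁻¹.val) + sgn (d * (w + d)) • g₁.form P P) •
          (sgn (v * w) • sgn (d * u) •
              gμ.form (lift₂ π₁ π₂ U) (lift₂ π₁ π₂ W) • lift₂ π₁ π₂ V
            - sgn (u * (v + w)) • sgn (d * v) •
              gμ.form (lift₂ π₁ π₂ V) (lift₂ π₁ π₂ W) • lift₂ π₁ π₂ U)
        + sgn (v * w) • (gμ.form (lift₂ π₁ π₂ U) (lift₂ π₁ π₂ W)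
            * π₁.star (P.app h * h⁻¹.val)) • lift₂ π₁ π₂ V
        - sgn (u * (v + w)) • (gμ.form (lift₂ π₁ π₂ V) (lift₂ π₁ π₂ W)
            * π₁.star (P.app h * h⁻¹.val)) • lift₂ π₁ π₂ U ∧
    (d = 0 →
      semiSymmCurvature gμ Lμ (lift₁ π₁ π₂ P) (lift₂ π₁ π₂ U) (lift₂ π₁ π₂ V) (lift₂ π₁ π₂ W) =
        lift₂ π₁ π₂ (LN.curv U V W)
          + π₁.star ((grad g₁ h).app h * h⁻¹.val ^ 2 + 2 * (P.app h * h⁻¹.val)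
              + g₁.form P P) •
            (sgn (v * w) • gμ.form (lift₂ π₁ π₂ U) (lift₂ π₁ π₂ W) • lift₂ π₁ π₂ V
              - sgn (u * (v + w)) •
                gμ.form (lift₂ π₁ π₂ V) (lift₂ π₁ π₂ W) • lift₂ π₁ π₂ U)) := by
  have r₂ := semiSymmCurvature_lift₂_lift₁_lift₁ hprod hh hgμ hLM hLN hLμ hP hV hX hY
  have r₅ := semiSymmCurvature_lift₁_lift₂_lift₂ hprod hh hgμ hLM hLN hLμ hP hX hV hW
  have r₆ := semiSymmCurvature_lift₂_lift₂_lift₂ hprod hh hgμ hLM hLN hLμ hP hU hV hW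
  have hU' := hprod.hasDeg_lift₂ hU
  have hV' := hprod.hasDeg_lift₂ hV
  have hW' := hprod.hasDeg_lift₂ hW
  -- The curvatures are known in terms of β and Q; these rewrites expand the expressions on the
  -- base.
  rw [app_logForm hh hLM hP hX hY] at r₂
  rw [semiSymm_logField hh hP hX] at r₅
  rw [mul_star_logForm_logField hh hP (gμ.deg _ _ _ _ hU' hW'),
    mul_star_logForm_logField hh hP (gμ.deg _ _ _ _ hV' hW')] at r₆
  refine ⟨semiSymmCurvature_lift₁_lift₁_lift₁ hprod hh hgμ hLM hLN hLμ hP hX hY hZ, r₂,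
    semiSymmCurvature_lift₁_lift₁_lift₂ hprod hh hgμ hLM hLN hLμ hP hX hY hV,
    semiSymmCurvature_lift₂_lift₂_lift₁ hprod hh hgμ hLM hLN hLμ hP hV hW hX, r₅, ?_, ?_, ?_⟩
  · rintro rfl
    rw [add_zero, mul_zero, sgn_zero, one_smul] at r₅
    exact r₅
  · rw [r₆]
    simp only [add_smul, smul_add, Vect.fn_smul_sub, fn_smul_units_smul, units_smul_fn_smul,
      mul_smul]
    abel
  · rintro rfl
    -- In even degree P(h)/h is central, so its two occurrences add up to 2 P(h)/h.
    have hc : ∀ F : M₁.Fn, F * π₁.star (P.app h * h⁻¹.val) = π₁.star (P.app h * h⁻¹.val) * F :=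
      fun F => (commute_even (π₁.star_mem (logDer_mem hh hP)) F).symm
    rw [r₆, hc, hc]
    simp only [zero_mul, sgn_zero, one_smul, two_mul, map_add, add_smul, add_mul, smul_add,
      Vect.fn_smul_sub, fn_smul_units_smul, mul_smul]
    abel
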